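/- **Setting.** A linear array has $M$ sensors at distinct positions $\bar d_1 d_0,\dots,\bar d_M d_0$ with $\bar d_m\in\mathbb Z$, $d_0>0$, and $K$ narrow-band far-field sources of wavelength $\lambda$, with $d_0\le\lambda/2$, come from distinct directions $\theta_1,\dots,\theta_K\in(-\pi/2,\pi/2)$. Put $\phi(\theta)=2\pi d_0\sin(\theta)/\lambda$ and $A=[e^{j\bar d_m\phi(\theta_k)}]_{m,k}$. The snapshots are $y(t)=Ax(t)+n(t)$, $t=1,2,\dots$, where the entries of all $x(t)$ and $n(t)$ are mutually independent zero-mean circularly-symmetric complex Gaussian variables, with $x_k(t)$ of variance $p_k>0$ and the entries of $n(t)$ of variance $\sigma^2>0$. Let $R=A\,\mathrm{diag}(p_1,\dots,p_K)A^H+\sigma^2I$ and $\hat R=\frac1N\sum_{t=1}^N y(t)y(t)^H$. **Coarray.** Let $M_v>K$ be such that every integer $l$ with $|l|<M_v$ is a difference $\bar d_p-\bar d_q$, and let $\omega(l)\ge 1$ be the number of pairs $(p,q)$ with $\bar d_p-\bar d_q=l$. Let $F$ be the $(2M_v-1)\times M^2$ matrix with $F_{m,p+(q-1)M}=1/\omega(m-M_v)$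 if $\bar d_p-\bar d_q=m-M_v$ and $0$ otherwise, let $\Gamma_i=[0_{M_v\times(i-1)}\ I_{M_v}\ 0_{M_v\times(M_v-i)}]$ and $\Gamma=[\Gamma_{M_v}^T\ \cdots\ \Gamma_1^T]^T$. With $\hat z_i=\Gamma_iF\,\mathrm{vec}(\hat R)$ put $\hat R_{v1}=[\hat z_{M_v}\ \cdots\ \hat z_1]$ and $\hat R_{v2}=\frac1{M_v}\sum_{i=1}^{M_v}\hat z_i\hat z_i^H$. Let $a_v(\theta)=[e^{jm\phi(\theta)}]_{m=0}^{M_v-1}$, $A_v=[a_v(\theta_1)\cdots a_v(\theta_K)]$, $A_v^\dagger=(A_v^HA_v)^{-1}A_v^H$, $\Pi^\perp=I-A_vA_v^\dagger$, $\dot a_v=\partial a_v/\partial\theta$, and $$\alpha_k^T=-e_k^TA_v^\dagger,\quad \beta_k=\Pi^\perp\dot a_v(\theta_k),\quad \gamma_k=\dot a_v(\theta_k)^H\Pi^\perp\dot a_v(\theta_k),\quad \xi_k=F^T\Gamma^T(\beta_k\otimes\alpha_k).$$ **Estimators.** DA-MUSIC and SS-MUSIC are MUSIC applied to $\hat R_{v1}$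 and $\hat R_{v2}$, respectively: with $\hat E_n$ the matrix of orthonormal eigenvectors for the $M_v-K$ smallest eigenvalues, $\hat\theta_1,\dots,\hat\theta_K$ are $K$ distinct local minima of $\theta\mapsto\|\hat E_n^Ha_v(\theta)\|^2$ on $(-\pi/2,\pi/2)$ with the smallest values, labelled in the order of $\theta_1,\dots,\theta_K$. (On the event that there are fewer than $K$ local minima, the $\hat\theta_k$ may be any values in $[-\pi/2,\pi/2]$. The estimates are random variables.) **Theorem.** All $\gamma_k$ are positive, and both for DA-MUSIC and for SS-MUSIC, for all $k_1,k_2$, as $N\to\infty$, $$\mathbb E[(\hat\theta_{k_1}-\theta_{k_1})(\hat\theta_{k_2}-\theta_{k_2})]=\frac{\mathrm{Re}[\xi_{k_1}^H(R\otimes R^T)\xi_{k_2}]}{N\,p_{k_1}p_{k_2}\gamma_{k_1}\gamma_{k_2}}+o(1/N).$$ In particular $\xi_k^H(R\otimes R^T)\xi_k$ is real, and the asymptotic mean square error of either estimator is $$\mathbb E[(\hat\theta_k-\theta_k)^2]=\frac{\xi_k^H(R\otimes R^T)\xi_k}{N\,p_k^2\gamma_k^2}+o(1/N).$$ -/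

import Mathlib

open MeasureTheory ProbabilityTheory Filter Asymptotics
open scoped Matrix Kronecker

noncomputable section

namespace CoarrayMusic

/-- Parameters of the model with `M` sensors and `K` narrow-band far-field sources.
`pos` holds the integer sensor positions in units of the spacing `d₀`, `lam` is the wavelength,
`θ` holds the source directions, `p` the source powers and `noiseVar` the noise variance. -/
structure Model (M K : ℕ) where
  pos : Fin M → ℤ
  d₀ : ℝ
  lam : ℝ
  θ : Fin K → ℝ
  p : Fin K → ℝ
  noiseVar : ℝ

/-! ### Circularly-symmetric complex Gaussian variables -/

/-- The circularly-symmetric complex Gaussian law of mean zero and variance `v`: the real and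
imaginary parts are independent real Gaussians of mean zero and variance `v / 2`. -/
def circGaussian (v : ℝ) : Measure ℂ :=
  ((gaussianReal 0 (v / 2).toNNReal).prod (gaussianReal 0 (v / 2).toNNReal)).map
    (fun z : ℝ × ℝ => (⟨z.1, z.2⟩ : ℂ))

/-! ### Pseudo-inverse and projection -/

/-- The Moore-Penrose pseudo-inverse `(Bᴴ B)⁻¹ Bᴴ` of a matrix `B` of full column rank (it is
used below only for the steering matrix of the virtual array, which has full column rank). -/
def pinv {m n : ℕ} (B : Matrix (Fin m) (Fin n) ℂ) : Matrix (Fin n) (Fin m) ℂ :=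
  (Bᴴ * B)⁻¹ * Bᴴ

/-- The orthogonal projection onto the orthogonal complement of the range of `B`, for `B` of full
column rank. -/
def projPerp {m n : ℕ} (B : Matrix (Fin m) (Fin n) ℂ) : Matrix (Fin m) (Fin m) ℂ :=
  1 - B * pinv B

/-! ### The coarray: selection matrices and augmented covariance matrices -/

/-- The weight function `ω(l)`: the number of ordered pairs of sensors with difference `l`. -/
def weight {M : ℕ} (pos : Fin M → ℤ) (l : ℤ) : ℕ :=
  (Finset.univ.filter (fun mn : Fin M × Fin M => pos mn.1 - pos mn.2 = l)).card

/-- The coarray selection matrix `F`, of size `(2 Mv - 1) × M²`. Its columns are indexed like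
`Matrix.vec`, which stacks columns: the entry `R p q` of `R` is entry `(q, p)` of `R.vec`. Row `m`
(counted from `0`) belongs to the difference `m - (Mv - 1)`. -/
def coarraySel {M : ℕ} (pos : Fin M → ℤ) (Mv : ℕ) :
    Matrix (Fin (2 * Mv - 1)) (Fin M × Fin M) ℂ :=
  Matrix.of fun m qp =>
    if pos qp.2 - pos qp.1 = (m : ℤ) - ((Mv : ℤ) - 1) then
      1 / (weight pos ((m : ℤ) - ((Mv : ℤ) - 1)) : ℂ)
    else 0

/-- The selection matrix of the `i`-th subarray of the virtual uniform linear array, with `i`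
counted from `0`: `[0 I 0]` with `i` zero columns on the left. -/
def subarraySel (Mv : ℕ) (i : Fin Mv) : Matrix (Fin Mv) (Fin (2 * Mv - 1)) ℂ :=
  Matrix.of fun a c => if (c : ℕ) = (a : ℕ) + (i : ℕ) then 1 else 0

/-- The matrix `Γ` that stacks the subarray selection matrices, last subarray on top. The row
index `(b, a)` stands for row `a` of block `b`. -/
def stackedSel (Mv : ℕ) : Matrix (Fin Mv × Fin Mv) (Fin (2 * Mv - 1)) ℂ :=
  Matrix.of fun ba c => subarraySel Mv ba.1.rev ba.2 c

/-- Output `z_i = Γ_i F vec(S)` of the `i`-th subarray for an `M × M` covariance matrix `S`. -/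
def subarrayOut {M : ℕ} (pos : Fin M → ℤ) (Mv : ℕ) (S : Matrix (Fin M) (Fin M) ℂ)
    (i : Fin Mv) : Fin Mv → ℂ :=
  subarraySel Mv i *ᵥ (coarraySel pos Mv *ᵥ S.vec)

/-- Direct augmentation: the matrix with columns `z_{Mv}, ..., z_1`. -/
def daMatrix {M : ℕ} (pos : Fin M → ℤ) (Mv : ℕ) (S : Matrix (Fin M) (Fin M) ℂ) :
    Matrix (Fin Mv) (Fin Mv) ℂ :=
  Matrix.of fun a b => subarrayOut pos Mv S b.rev a

/-- Spatial smoothing: `(1 / Mv) ∑ i, z_i z_iᴴ`. -/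
def ssMatrix {M : ℕ} (pos : Fin M → ℤ) (Mv : ℕ) (S : Matrix (Fin M) (Fin M) ℂ) :
    Matrix (Fin Mv) (Fin Mv) ℂ :=
  (1 / (Mv : ℂ)) • ∑ i : Fin Mv,
    Matrix.vecMulVec (subarrayOut pos Mv S i) (star (subarrayOut pos Mv S i))

/-! ### MUSIC -/

/-- `H = U diag(ev) Uᴴ` with `U` unitary and real eigenvalues `ev` in decreasing order. -/
structure IsEigendecomposition {m : ℕ} (H U : Matrix (Fin m) (Fin m) ℂ) (ev : Fin m → ℝ) :
    Prop where
  unitary : U ∈ Matrix.unitaryGroup (Fin m) ℂ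
  antitone : Antitone ev
  eq : H = U * Matrix.diagonal (fun i => (ev i : ℂ)) * Uᴴ

/-- The MUSIC null spectrum `t ↦ ‖E_nᴴ a(t)‖²` (the reciprocal of the MUSIC pseudo-spectrum), for
the array manifold `a`, where the noise eigenvectors `E_n` are the columns of `U` other than the
first `K`. -/
def nullSpectrum {m : ℕ} (K : ℕ) (U : Matrix (Fin m) (Fin m) ℂ) (a : ℝ → Fin m → ℂ) (t : ℝ) : ℝ :=
  ∑ j : Fin m, if K ≤ (j : ℕ) then ‖star (U.col j) ⬝ᵥ a t‖ ^ 2 else 0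

/-- The local minima of a null spectrum over the field of view `(-π/2, π/2)`. -/
def localMinima (f : ℝ → ℝ) : Set ℝ :=
  {t | t ∈ Set.Ioo (-(Real.pi / 2)) (Real.pi / 2) ∧ IsLocalMin f t}

/-- `est` is an output of MUSIC for `K` sources, applied to the Hermitian matrix `H` with array
manifold `a`: for an eigendecomposition of `H`, `est` lists `K` distinct local minima of the null
spectrum over `(-π/2, π/2)`, and no local minimum that is left out has a smaller value than one
that is listed. The estimates are labelled in the order of the true directions `θ`. If the null
spectrum happens to have fewer than `K` local minima, `est` may be anything in the field of
view. -/
def IsMusicEstimate {m K : ℕ} (a : ℝ → Fin m → ℂ) (θ : Fin K → ℝ)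
    (H : Matrix (Fin m) (Fin m) ℂ) (est : Fin K → ℝ) : Prop :=
  (∀ k, est k ∈ Set.Icc (-(Real.pi / 2)) (Real.pi / 2)) ∧
  ∃ (U : Matrix (Fin m) (Fin m) ℂ) (ev : Fin m → ℝ), IsEigendecomposition H U ev ∧
    ((K : ℕ∞) ≤ (localMinima (nullSpectrum K U a)).encard →
      Function.Injective est ∧
      (∀ k, est k ∈ localMinima (nullSpectrum K U a)) ∧
      (∀ s ∈ localMinima (nullSpectrum K U a), s ∉ Set.range est →
        ∀ k, nullSpectrum K U a (est k) ≤ nullSpectrum K U a s) ∧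
      (∀ k l, θ k < θ l → est k < est l))

namespace Model

variable {M K : ℕ} (S : Model M K)

/-! ### Steering vectors and covariance matrix -/

/-- The electrical angle `φ(t) = 2π d₀ sin(t) / λ` of the direction `t`. -/
def phase (t : ℝ) : ℝ := 2 * Real.pi * S.d₀ * Real.sin t / S.lam

/-- Steering vector of the physical array. -/
def steer (t : ℝ) : Fin M → ℂ :=
  fun m => Complex.exp (Complex.I * ((S.pos m : ℝ) * S.phase t : ℝ))

/-- The steering matrix `A` of the physical array. -/
def steerMat : Matrix (Fin M) (Fin K) ℂ := Matrix.of fun m k => S.steer (S.θ k) m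

/-- The covariance matrix `R = A P Aᴴ + σ² I` of a snapshot. -/
def cov : Matrix (Fin M) (Fin M) ℂ :=
  S.steerMat * Matrix.diagonal (fun k => (S.p k : ℂ)) * S.steerMatᴴ
    + (S.noiseVar : ℂ) • (1 : Matrix (Fin M) (Fin M) ℂ)

/-- Steering vector of the virtual uniform linear array with sensors `0, ..., Mv - 1`. -/
def vsteer (Mv : ℕ) (t : ℝ) : Fin Mv → ℂ :=
  fun m => Complex.exp (Complex.I * (((m : ℕ) : ℝ) * S.phase t : ℝ))

/-- The steering matrix `A_v` of the virtual uniform linear array. -/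
def vsteerMat (Mv : ℕ) : Matrix (Fin Mv) (Fin K) ℂ := Matrix.of fun m k => S.vsteer Mv (S.θ k) m

/-- The derivative of the virtual steering vector with respect to the direction. -/
def vsteerDeriv (Mv : ℕ) (t : ℝ) : Fin Mv → ℂ := fun m => deriv (fun s : ℝ => S.vsteer Mv s m) t

/-! ### The quantities in the error formula -/

/-- `α_k`, given by `α_kᵀ = - e_kᵀ A_v†`. -/
def alpha (Mv : ℕ) (k : Fin K) : Fin Mv → ℂ := fun a => -(pinv (S.vsteerMat Mv) k a)

/-- `β_k = Π^⊥ ȧ_v(θ_k)`. -/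
def beta (Mv : ℕ) (k : Fin K) : Fin Mv → ℂ :=
  projPerp (S.vsteerMat Mv) *ᵥ S.vsteerDeriv Mv (S.θ k)

/-- `γ_k = ȧ_v(θ_k)ᴴ Π^⊥ ȧ_v(θ_k)`, which is a real number because `Π^⊥` is Hermitian. -/
def gamma (Mv : ℕ) (k : Fin K) : ℝ :=
  (star (S.vsteerDeriv Mv (S.θ k)) ⬝ᵥ
    (projPerp (S.vsteerMat Mv) *ᵥ S.vsteerDeriv Mv (S.θ k))).re

/-- `ξ_k = Fᵀ Γᵀ (β_k ⊗ α_k)`. -/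
def xi (Mv : ℕ) (k : Fin K) : Fin M × Fin M → ℂ :=
  (coarraySel S.pos Mv)ᵀ *ᵥ
    ((stackedSel Mv)ᵀ *ᵥ (fun ba : Fin Mv × Fin Mv => S.beta Mv k ba.1 * S.alpha Mv k ba.2))

/-- `ξ_kᴴ (R ⊗ Rᵀ) ξ_l`. -/
def errForm (Mv : ℕ) (k l : Fin K) : ℂ :=
  star (S.xi Mv k) ⬝ᵥ ((S.cov ⊗ₖ S.covᵀ) *ᵥ S.xi Mv l)

/-! ### The stochastic signal model -/

variable {Ω : Type*} [MeasurableSpace Ω]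

/-- The assumptions on the source signals `x t` and the noise `n t` (snapshots `t = 0, 1, ...`):
the entries of all `x t` and all `n t` are circularly-symmetric complex Gaussian, of variances
`p k` and `σ²`, and mutually independent over sources, sensors and snapshots (for jointly Gaussian
signals this is the same as uncorrelated). -/
structure IsSignal (x : ℕ → Ω → Fin K → ℂ) (n : ℕ → Ω → Fin M → ℂ) (μ : Measure Ω) : Prop where
  law_source : ∀ t k, HasLaw (fun ω => x t ω k) (circGaussian (S.p k)) μ
  law_noise : ∀ t m, HasLaw (fun ω => n t ω m) (circGaussian S.noiseVar) μ
  indep : iIndepFun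
    (fun (i : ℕ × (Fin K ⊕ Fin M)) (ω : Ω) => Sum.elim (x i.1 ω) (n i.1 ω) i.2) μ

/-- The received snapshot `y t = A x t + n t`. -/
def received (x : ℕ → Ω → Fin K → ℂ) (n : ℕ → Ω → Fin M → ℂ) (t : ℕ) (ω : Ω) : Fin M → ℂ :=
  S.steerMat *ᵥ x t ω + n t ω

/-- The sample covariance matrix `(1 / N) ∑ t, y t (y t)ᴴ` of the first `N` snapshots. -/
def sampleCov (x : ℕ → Ω → Fin K → ℂ) (n : ℕ → Ω → Fin M → ℂ) (N : ℕ) (ω : Ω) :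
    Matrix (Fin M) (Fin M) ℂ :=
  (1 / (N : ℂ)) • ∑ t ∈ Finset.range N,
    Matrix.vecMulVec (S.received x n t ω) (star (S.received x n t ω))

/-- `est` is a sequence of DA-MUSIC estimators: for every `N`, `est N` is a random vector that is
almost surely an output of MUSIC on the directly augmented sample covariance matrix of the first
`N` snapshots. -/
def IsDAMusic (Mv : ℕ) (x : ℕ → Ω → Fin K → ℂ) (n : ℕ → Ω → Fin M → ℂ) (μ : Measure Ω)
    (est : ℕ → Ω → Fin K → ℝ) : Prop :=
  ∀ N, AEMeasurable (est N) μ ∧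
    ∀ᵐ ω ∂μ, IsMusicEstimate (S.vsteer Mv) S.θ
      (daMatrix S.pos Mv (S.sampleCov x n N ω)) (est N ω)

/-- `est` is a sequence of SS-MUSIC estimators: the same for the spatially smoothed matrix. -/
def IsSSMusic (Mv : ℕ) (x : ℕ → Ω → Fin K → ℂ) (n : ℕ → Ω → Fin M → ℂ) (μ : Measure Ω)
    (est : ℕ → Ω → Fin K → ℝ) : Prop :=
  ∀ N, AEMeasurable (est N) μ ∧
    ∀ᵐ ω ∂μ, IsMusicEstimate (S.vsteer Mv) S.θ
      (ssMatrix S.pos Mv (S.sampleCov x n N ω)) (est N ω)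

end Model

end CoarrayMusic

end

open CoarrayMusic

/-! The error formula is a deterministic first-order expansion, combined with moment bounds for the
sample covariance matrix.

*Reduction to direct augmentation.* For a Hermitian `C` the directly augmented matrix `D(C)` is
Hermitian Toeplitz, its entries are averages of `C` over the coarray, and the spatially smoothed
matrix is `D(C)² / Mv` (`ssMatrix_eq`). At the true covariance matrix `R` one has
`D(R) = A_v P A_vᴴ + σ²` (`Model.daMatrix_cov`), so near `R` the matrix `D(C)` is positive
semidefinite, and its square has the same ordered eigenvectors
(`Model.exists_isMusicEstimate_of_ssMatrix`). Both estimators then see the same null spectrum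
`a_v(t)ᴴ P a_v(t)`, where `P` is the projector onto the noise eigenvectors of `D(C)`.

*Expansion of the estimates.* Ky Fan's trace inequality (`kyFan`) says that `P` minimises the trace
against `D(C)`. Together with the fact that `P` commutes with `D(C)`, this gives
`P = Π^⊥ + O(‖C - R‖)` and the first-order term (`exists_noiseProj_perturbation`). So the null spectrum is close, with
two derivatives, to the true one, which vanishes in the source directions only and has curvature
`2 γ_k > 0` there: by a Vandermonde argument, `K < Mv` and `d₀ ≤ λ / 2` make steering vectors of
distinct directions, together with one derivative, linearly independent (`Model.gamma_pos`). Hence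
the `K` smallest local minima lie next to the sources, one each (`near_of_smallest_localMinima`), and
one Newton step yields `est k - θ k = -(ξ_k · vec(C - R)) / (p_k γ_k) + o(‖C - R‖)`
(`Model.exists_estimate_expansion`).

*The error form is real.* Reversal of the virtual array conjugates `D(C)`, and it changes `α_k` and
`β_k` into their conjugates up to phases that cancel. So `ξ_k · vec C` is real for every Hermitian `C`
(`Model.star_alpha_daMatrix_beta`), and the error form is an honest covariance of real variables.

*Moments.* In terms of the independent sources and noise, `ξ_k · vec(y yᴴ - R)` is a centered
sesquilinear form, and Isserlis' formula for circular Gaussians gives its covariances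
`ξ_kᴴ (R ⊗ Rᵀ) ξ_l` (`Model.errForm_eq_integral`). Averaging over `N` independent snapshots divides
them by `N`, and the same sums show that `‖R̂ - R‖` has second and fourth moments of orders `1 / N`
and `1 / N²` (`Model.exists_moment_bound`). The second moment controls the error of the linearisation
where `‖R̂ - R‖` is small; the fourth moment bounds the probability of the complement, where the
estimates are merely bounded (`integral_mul_sub_isLittleO`). -/

noncomputable section

open MeasureTheory ProbabilityTheory Filter Asymptotics
open scoped Matrix Kronecker ComplexOrder

namespace CoarrayMusic

/-! ### Positive square roots and eigendecompositions -/

section SquareRoot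

open scoped MatrixOrder Matrix.Norms.L2Operator

/-- Positive semidefinite square roots are unique. -/
lemma posSemidef_eq_of_mul_self_eq {m : ℕ} {X Y : Matrix (Fin m) (Fin m) ℂ}
    (hX : X.PosSemidef) (hY : Y.PosSemidef) (h : X * X = Y * Y) : X = Y :=
  (CFC.mul_self_eq_mul_self_iff X Y hX.nonneg hY.nonneg).1 h

end SquareRoot

/-- An eigendecomposition of a positive multiple of `D * D`, for `D` positive semidefinite, is also
an eigendecomposition of `D`. -/
lemma IsEigendecomposition.of_smul_mul_self {m : ℕ} {D U : Matrix (Fin m) (Fin m) ℂ}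
    {ev : Fin m → ℝ} {c : ℝ} (hc : 0 < c) (hD : D.PosSemidef)
    (h : IsEigendecomposition ((c : ℂ) • (D * D)) U ev) :
    IsEigendecomposition D U (fun i => Real.sqrt (ev i / c)) := by
  have hUU : Uᴴ * U = 1 := Matrix.mem_unitaryGroup_iff'.1 h.unitary
  have hUU' : U * Uᴴ = 1 := Matrix.mem_unitaryGroup_iff.1 h.unitary
  have hc' : (c : ℂ) ≠ 0 := by exact_mod_cast hc.ne'
  have hdiag : Uᴴ * ((c : ℂ) • (D * D)) * U = Matrix.diagonal (fun i => (ev i : ℂ)) := by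
    rw [h.eq]
    calc Uᴴ * (U * Matrix.diagonal (fun i => (ev i : ℂ)) * Uᴴ) * U
        = (Uᴴ * U) * Matrix.diagonal (fun i => (ev i : ℂ)) * (Uᴴ * U) := by
          simp only [Matrix.mul_assoc]
      _ = _ := by rw [hUU]; simp
  have hDD : (D * D).PosSemidef := by
    have := Matrix.posSemidef_conjTranspose_mul_self D
    rwa [hD.isHermitian.eq] at this
  have hev : ∀ i, 0 ≤ ev i := by
    intro i
    have h1 : ((c : ℂ) • (D * D)).PosSemidef :=
      hDD.smul (by exact_mod_cast hc.le)
    have h2 := h1.conjTranspose_mul_mul_same U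
    rw [hdiag] at h2
    have h3 := Matrix.posSemidef_diagonal_iff.1 h2 i
    exact_mod_cast h3
  refine ⟨h.unitary, fun i j hij => Real.sqrt_le_sqrt (by gcongr; exact h.antitone hij), ?_⟩
  apply posSemidef_eq_of_mul_self_eq hD
  · apply Matrix.PosSemidef.mul_mul_conjTranspose_same
    rw [Matrix.posSemidef_diagonal_iff]
    intro i
    exact_mod_cast Real.sqrt_nonneg _
  · have h1 : D * D = (c : ℂ)⁻¹ • ((c : ℂ) • (D * D)) := by
      rw [smul_smul, inv_mul_cancel₀ hc', one_smul]
    have h2 : (Matrix.diagonal fun i => ((Real.sqrt (ev i / c) : ℝ) : ℂ)) *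
        (Matrix.diagonal fun i => ((Real.sqrt (ev i / c) : ℝ) : ℂ))
        = (c : ℂ)⁻¹ • Matrix.diagonal (fun i => (ev i : ℂ)) := by
      rw [Matrix.diagonal_mul_diagonal, ← Matrix.diagonal_smul]
      congr 1
      funext i
      rw [← Complex.ofReal_mul, Real.mul_self_sqrt (div_nonneg (hev i) hc.le)]
      simp [div_eq_inv_mul]
    rw [h1, h.eq]
    calc (c : ℂ)⁻¹ • (U * Matrix.diagonal (fun i => (ev i : ℂ)) * Uᴴ)
        = U * ((c : ℂ)⁻¹ • Matrix.diagonal (fun i => (ev i : ℂ))) * Uᴴ := by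
          simp
      _ = _ := by
          rw [← h2]
          simp only [Matrix.mul_assoc]
          rw [← Matrix.mul_assoc Uᴴ U, hUU, Matrix.one_mul]

/-! ### The noise projector -/

/-- The orthogonal projector onto the span of the columns of the unitary matrix `U` other than
the first `K`. -/
def noiseProj {m : ℕ} (K : ℕ) (U : Matrix (Fin m) (Fin m) ℂ) : Matrix (Fin m) (Fin m) ℂ :=
  U * Matrix.diagonal (fun j : Fin m => if K ≤ (j : ℕ) then (1 : ℂ) else 0) * Uᴴ

section NoiseProj

variable {m K : ℕ} {U H : Matrix (Fin m) (Fin m) ℂ} {ev : Fin m → ℝ}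

lemma noiseProj_isHermitian : (noiseProj K U)ᴴ = noiseProj K U := by
  simp only [noiseProj, Matrix.conjTranspose_mul, Matrix.conjTranspose_conjTranspose,
    Matrix.diagonal_conjTranspose, Matrix.mul_assoc]
  congr 3
  funext j
  by_cases h : K ≤ (j : ℕ) <;> simp [h]

/-- Products of matrices that are diagonal in the same unitary basis. -/
lemma conj_diagonal_mul (hU : U ∈ Matrix.unitaryGroup (Fin m) ℂ) (v w : Fin m → ℂ) :
    (U * Matrix.diagonal v * Uᴴ) * (U * Matrix.diagonal w * Uᴴ)
      = U * Matrix.diagonal (fun i => v i * w i) * Uᴴ := by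
  have hUU : Uᴴ * U = 1 := Matrix.mem_unitaryGroup_iff'.1 hU
  rw [← Matrix.diagonal_mul_diagonal]
  simp only [Matrix.mul_assoc]
  rw [← Matrix.mul_assoc Uᴴ U, hUU, Matrix.one_mul]

lemma trace_conj_diagonal (hU : U ∈ Matrix.unitaryGroup (Fin m) ℂ) (v : Fin m → ℂ) :
    (U * Matrix.diagonal v * Uᴴ).trace = ∑ i, v i := by
  have hUU : Uᴴ * U = 1 := Matrix.mem_unitaryGroup_iff'.1 hU
  rw [Matrix.trace_mul_comm, ← Matrix.mul_assoc, hUU, Matrix.one_mul, Matrix.trace_diagonal]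

lemma noiseProj_mul_self (hU : U ∈ Matrix.unitaryGroup (Fin m) ℂ) :
    noiseProj K U * noiseProj K U = noiseProj K U := by
  rw [noiseProj, conj_diagonal_mul hU]
  congr 3
  funext j
  by_cases h : K ≤ (j : ℕ) <;> simp [h]

lemma noiseProj_commute (h : IsEigendecomposition H U ev) :
    H * noiseProj K U = noiseProj K U * H := by
  rw [h.eq, noiseProj, conj_diagonal_mul h.unitary, conj_diagonal_mul h.unitary]
  simp only [mul_comm]

lemma trace_noiseProj (hU : U ∈ Matrix.unitaryGroup (Fin m) ℂ) (hK : K ≤ m) :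
    (noiseProj K U).trace = (m : ℂ) - K := by
  rw [noiseProj, trace_conj_diagonal hU, Finset.sum_ite, Finset.sum_const_zero, add_zero,
    Finset.sum_const, nsmul_eq_mul, mul_one]
  have : (Finset.univ.filter fun j : Fin m => K ≤ (j : ℕ)).card = m - K := by
    rcases hK.lt_or_eq with h | rfl
    · have h2 : (Finset.univ.filter fun j : Fin m => K ≤ (j : ℕ)) = Finset.Ici ⟨K, h⟩ := by
        ext j; simp [Fin.le_def]
      rw [h2, Fin.card_Ici]
    · simp
  rw [this, Nat.cast_sub hK]

/-- Ky Fan's trace inequality: among the orthogonal projectors of its rank, the noise projector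
minimises `trace (P * H)`. -/
lemma kyFan (hH : IsEigendecomposition H U ev) (hK : K ≤ m) {P : Matrix (Fin m) (Fin m) ℂ}
    (hP : Pᴴ = P) (hPP : P * P = P) (htr : P.trace = (m : ℂ) - K) :
    (noiseProj K U * H).trace.re ≤ (P * H).trace.re := by
  have hUU : Uᴴ * U = 1 := Matrix.mem_unitaryGroup_iff'.1 hH.unitary
  have hUU' : U * Uᴴ = 1 := Matrix.mem_unitaryGroup_iff.1 hH.unitary
  set Y := Uᴴ * P * U with hY
  set w : Fin m → ℝ := fun i => (Y i i).re with hw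
  have hYY : Yᴴ * Y = Y := by
    simp only [hY, Matrix.conjTranspose_mul, Matrix.conjTranspose_conjTranspose, hP,
      Matrix.mul_assoc]
    rw [← Matrix.mul_assoc U Uᴴ, hUU', Matrix.one_mul, ← Matrix.mul_assoc P P, hPP]
  have hYH : Yᴴ = Y := by
    simp only [hY, Matrix.conjTranspose_mul, Matrix.conjTranspose_conjTranspose, hP,
      Matrix.mul_assoc]
  have hdiag : ∀ i, w i = ∑ j, ‖Y j i‖ ^ 2 := by
    intro i
    have : Y i i = ∑ j, ((‖Y j i‖ ^ 2 : ℝ) : ℂ) := by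
      conv_lhs => rw [← hYY]
      rw [Matrix.mul_apply]
      refine Finset.sum_congr rfl fun j _ => ?_
      rw [Matrix.conjTranspose_apply, Complex.star_def, mul_comm, Complex.mul_conj,
        Complex.normSq_eq_norm_sq]
    rw [hw]
    simp only [this, ← Complex.ofReal_sum, Complex.ofReal_re]
  have hw0 : ∀ i, 0 ≤ w i := fun i => by rw [hdiag]; positivity
  have hw1 : ∀ i, w i ≤ 1 := by
    intro i
    have h1 : ‖Y i i‖ ^ 2 ≤ w i := by
      rw [hdiag]
      exact Finset.single_le_sum (f := fun j => ‖Y j i‖ ^ 2) (fun j _ => by positivity)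
        (Finset.mem_univ i)
    have h2 : w i ≤ ‖Y i i‖ := Complex.re_le_norm _
    nlinarith [hw0 i]
  have hwsum : ∑ i, w i = (m : ℝ) - K := by
    have h1 : Y.trace = (m : ℂ) - K := by
      rw [hY, Matrix.trace_mul_comm, ← Matrix.mul_assoc, hUU', Matrix.one_mul, htr]
    have h2 := congrArg Complex.re h1
    simpa [Matrix.trace, hw] using h2
  have hlhs : (noiseProj K U * H).trace.re = ∑ i : Fin m, if K ≤ (i : ℕ) then ev i else 0 := by
    rw [hH.eq, noiseProj, conj_diagonal_mul hH.unitary, trace_conj_diagonal hH.unitary]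
    rw [Complex.re_sum]
    refine Finset.sum_congr rfl fun i _ => ?_
    by_cases h : K ≤ (i : ℕ) <;> simp [h]
  have hrhs : (P * H).trace.re = ∑ i, ev i * w i := by
    have : (P * H).trace = (Y * Matrix.diagonal (fun i => (ev i : ℂ))).trace := by
      rw [hH.eq, hY, ← Matrix.mul_assoc, ← Matrix.mul_assoc, Matrix.trace_mul_comm]
      simp only [Matrix.mul_assoc]
    rw [this, Matrix.trace, Complex.re_sum]
    refine Finset.sum_congr rfl fun i _ => ?_
    rw [Matrix.diag_apply, Matrix.mul_diagonal, Complex.re_mul_ofReal, mul_comm]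
  have hisum : ∑ i : Fin m, (if K ≤ (i : ℕ) then (1 : ℝ) else 0) = (m : ℝ) - K := by
    have h1 := trace_noiseProj (U := U) hH.unitary hK
    rw [noiseProj, trace_conj_diagonal hH.unitary] at h1
    have h2 := congrArg Complex.re h1
    rw [Complex.re_sum] at h2
    simp only [Complex.sub_re, Complex.natCast_re] at h2
    rw [← h2]
    refine Finset.sum_congr rfl fun i _ => ?_
    by_cases h : K ≤ (i : ℕ) <;> simp [h]
  rw [hlhs, hrhs]
  rcases hK.lt_or_eq with hlt | rfl
  · -- compare termwise after subtracting the threshold eigenvalue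
    set c := ev ⟨K, hlt⟩ with hc
    have key : ∀ i : Fin m, 0 ≤ (ev i - c) * (w i - if K ≤ (i : ℕ) then 1 else 0) := by
      intro i
      by_cases h : K ≤ (i : ℕ)
      · have : ev i ≤ c := hH.antitone (by rw [Fin.le_def]; exact h)
        simp only [h, if_true]
        nlinarith [hw1 i]
      · have : c ≤ ev i := hH.antitone (by rw [Fin.le_def]; exact (not_le.1 h).le)
        simp only [h, if_false]
        nlinarith [hw0 i]
    have hs := Finset.sum_nonneg fun i (_ : i ∈ Finset.univ) => key i
    have hexp : ∑ i : Fin m, (ev i - c) * (w i - if K ≤ (i : ℕ) then 1 else 0)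
        = ∑ i, ev i * w i - (∑ i : Fin m, if K ≤ (i : ℕ) then ev i else 0)
          - c * (∑ i, w i - ∑ i : Fin m, if K ≤ (i : ℕ) then (1 : ℝ) else 0) := by
      rw [← Finset.sum_sub_distrib, ← Finset.sum_sub_distrib, Finset.mul_sum,
        ← Finset.sum_sub_distrib]
      refine Finset.sum_congr rfl fun i _ => ?_
      by_cases h : K ≤ (i : ℕ) <;> simp [h] <;> ring
    rw [hexp, hwsum, hisum] at hs
    linarith
  · have hz : ∀ i, w i = 0 := by
      have : ∑ i, w i = 0 := by rw [hwsum]; simp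
      intro i
      exact (Finset.sum_eq_zero_iff_of_nonneg fun i _ => hw0 i).1 this i (Finset.mem_univ i)
    simp [hz, not_le.2 (Fin.is_lt _)]

lemma nullSpectrum_eq (a : ℝ → Fin m → ℂ) (t : ℝ) :
    nullSpectrum K U a t = (star (a t) ⬝ᵥ (noiseProj K U *ᵥ a t)).re := by
  rw [noiseProj, ← Matrix.mulVec_mulVec, ← Matrix.mulVec_mulVec, Matrix.dotProduct_mulVec]
  have h1 : star (a t) ᵥ* U = star (Uᴴ *ᵥ a t) := by
    rw [Matrix.star_mulVec, Matrix.conjTranspose_conjTranspose]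
  rw [h1, dotProduct, Complex.re_sum, nullSpectrum]
  refine Finset.sum_congr rfl fun j _ => ?_
  have h2 : (Uᴴ *ᵥ a t) j = star (U.col j) ⬝ᵥ a t := rfl
  rw [Matrix.mulVec_diagonal, h2, Pi.star_apply, h2]
  by_cases h : K ≤ (j : ℕ)
  · simp only [h, if_true, one_mul, Complex.star_def]
    rw [mul_comm, Complex.mul_conj, Complex.ofReal_re, Complex.normSq_eq_norm_sq]
  · simp [h]

end NoiseProj

/-! ### First-order perturbation of the noise projector -/

section Perturbation

open scoped Matrix.Norms.Frobenius

lemma frobenius_sq_eq_sum {m n : ℕ} (X : Matrix (Fin m) (Fin n) ℂ) :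
    ‖X‖ ^ 2 = ∑ i, ∑ j, ‖X i j‖ ^ 2 := by
  rw [Matrix.frobenius_norm_def, ← Real.sqrt_eq_rpow, Real.sq_sqrt (by positivity)]
  simp

lemma frobenius_sq_eq_trace {m n : ℕ} (X : Matrix (Fin m) (Fin n) ℂ) :
    ‖X‖ ^ 2 = (Xᴴ * X).trace.re := by
  rw [frobenius_sq_eq_sum, Matrix.trace, Complex.re_sum, Finset.sum_comm]
  refine Finset.sum_congr rfl fun j _ => ?_
  rw [Matrix.diag_apply, Matrix.mul_apply, Complex.re_sum]
  refine Finset.sum_congr rfl fun i _ => ?_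
  rw [Matrix.conjTranspose_apply, Complex.star_def, mul_comm, Complex.mul_conj,
    Complex.ofReal_re, Complex.normSq_eq_norm_sq]

lemma norm_trace_mul_le {m : ℕ} (X Y : Matrix (Fin m) (Fin m) ℂ) :
    ‖(X * Y).trace‖ ≤ ‖X‖ * ‖Y‖ := by
  have h : (X * Y).trace = ∑ p : Fin m × Fin m, X p.1 p.2 * Y p.2 p.1 := by
    simp only [Matrix.trace, Matrix.diag_apply, Matrix.mul_apply, Fintype.sum_prod_type]
  have hX : ‖X‖ ^ 2 = ∑ p : Fin m × Fin m, ‖X p.1 p.2‖ ^ 2 := by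
    rw [frobenius_sq_eq_sum, Fintype.sum_prod_type]
  have hY : ‖Y‖ ^ 2 = ∑ p : Fin m × Fin m, ‖Y p.2 p.1‖ ^ 2 := by
    rw [frobenius_sq_eq_sum, Fintype.sum_prod_type, Finset.sum_comm]
  have h1 : ‖(X * Y).trace‖ ≤ ∑ p : Fin m × Fin m, ‖X p.1 p.2‖ * ‖Y p.2 p.1‖ := by
    rw [h]
    refine (norm_sum_le _ _).trans (le_of_eq ?_)
    simp only [norm_mul]
  refine h1.trans (abs_le_of_sq_le_sq ?_ (by positivity) |> (le_abs_self _).trans)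
  rw [mul_pow, hX, hY]
  exact Finset.sum_mul_sq_le_sq_mul_sq _ _ _

set_option maxHeartbeats 1000000 in
/-- Linear and quadratic bounds for a perturbed noise projector `P`. The unperturbed matrix is
`σ + Cᴴ * C`, with noise projector `Q`, and `G` is a pseudo-inverse of `Cᴴ * C`; the projector `P`
has the rank of `Q`, commutes with the perturbed matrix `σ + Cᴴ * C + E`, and its trace against that
matrix is at most that of `Q`. The trace condition bounds `‖C * P‖ ^ 2` by a multiple of
`‖E‖`. With the commutation relation, `B * P = P * B * P + P * E * P - E * P` for `B = Cᴴ * C`, and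
multiplication by `G` first bounds `(1 - Q) * P` and with it `P - Q`; then `P * B * P` is seen to be
of second order, which leaves the first-order term `-G * E * Q`. -/
lemma exists_noiseProj_perturbation {m k : ℕ} (C : Matrix (Fin k) (Fin m) ℂ)
    (Q G : Matrix (Fin m) (Fin m) ℂ) (σ : ℂ) (hQ : Qᴴ = Q) (hQQ : Q * Q = Q)
    (hCQ : C * Q = 0) (hGQ : G * Q = 0) (hG : G * (Cᴴ * C) = 1 - Q) :
    ∃ κ : ℝ, 0 ≤ κ ∧ ∀ E P : Matrix (Fin m) (Fin m) ℂ, Pᴴ = P → P * P = P → P.trace = Q.trace →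
      (σ • 1 + Cᴴ * C + E) * P = P * (σ • 1 + Cᴴ * C + E) →
      (P * (σ • 1 + Cᴴ * C + E)).trace.re ≤ (Q * (σ • 1 + Cᴴ * C + E)).trace.re →
      ‖P - Q‖ ≤ κ * ‖E‖ ∧ ‖(1 - Q) * P + G * E * Q‖ ≤ κ * ‖E‖ ^ 2 := by
  set B := Cᴴ * C with hB
  have hQB : Q * B = 0 := by
    have : Q * Cᴴ = 0 := by
      rw [← hQ, ← Matrix.conjTranspose_mul, hCQ, Matrix.conjTranspose_zero]
    rw [hB, ← Matrix.mul_assoc, this, Matrix.zero_mul]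
  have hBQ : B * Q = 0 := by rw [hB, Matrix.mul_assoc, hCQ, Matrix.mul_zero]
  obtain ⟨q, hq⟩ : ∃ q, q = ‖Q‖ := ⟨_, rfl⟩
  have hq0 : 0 ≤ q := hq ▸ norm_nonneg _
  obtain ⟨g, hg⟩ : ∃ g, g = ‖G‖ := ⟨_, rfl⟩
  have hg0 : 0 ≤ g := hg ▸ norm_nonneg _
  obtain ⟨b, hb⟩ : ∃ b, b = ‖B‖ := ⟨_, rfl⟩
  have hb0 : 0 ≤ b := hb ▸ norm_nonneg _
  obtain ⟨κ₂, hκ₂⟩ : ∃ κ₂, κ₂ = g * (2 * q + q ^ 2 + q) := ⟨_, rfl⟩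
  have hκ₂0 : 0 ≤ κ₂ := by rw [hκ₂]; positivity
  refine ⟨2 * κ₂ + (g * (κ₂ * b * κ₂) + (g * κ₂) * q + g * (2 * κ₂)), by positivity, ?_⟩
  intro E P hP hPP htr hcomm hle
  obtain ⟨e, he⟩ : ∃ e, e = ‖E‖ := ⟨_, rfl⟩
  have he0 : 0 ≤ e := he ▸ norm_nonneg _
  rw [← he]
  have hPn : ‖P‖ = q := by
    have h1 : ‖P‖ ^ 2 = q ^ 2 := by
      rw [hq, frobenius_sq_eq_trace, frobenius_sq_eq_trace, hP, hPP, hQ, hQQ, htr]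
    exact (pow_left_inj₀ (norm_nonneg P) hq0 two_ne_zero).1 h1
  -- the energy of `P` in the signal part is bounded by the minimality of the trace
  have htrace : (P * B).trace.re ≤ 2 * q * e := by
    have h1 : (P * (σ • 1 + B + E)).trace = σ * P.trace + (P * B).trace + (P * E).trace := by
      simp [Matrix.mul_add, Matrix.trace_add]
    have h2 : (Q * (σ • 1 + B + E)).trace = σ * P.trace + (Q * E).trace := by
      simp [Matrix.mul_add, Matrix.trace_add, hQB, htr]
    rw [h1, h2] at hle
    simp only [Complex.add_re] at hle
    have h3 : |(P * E).trace.re| ≤ q * e :=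
      (Complex.abs_re_le_norm _).trans ((norm_trace_mul_le _ _).trans (by rw [hPn, he]))
    have h4 : |(Q * E).trace.re| ≤ q * e :=
      (Complex.abs_re_le_norm _).trans ((norm_trace_mul_le _ _).trans (by rw [hq, he]))
    linarith [abs_le.1 h3, abs_le.1 h4]
  have hPBP : ‖P * B * P‖ ≤ 2 * q * e := by
    have h1 : P * B * P = (C * P)ᴴ * (C * P) := by
      rw [Matrix.conjTranspose_mul, hP, hB]; simp only [Matrix.mul_assoc]
    have h2 : ‖C * P‖ ^ 2 = (P * B).trace.re := by
      rw [frobenius_sq_eq_trace, ← h1, Matrix.trace_mul_comm, ← Matrix.mul_assoc, hPP]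
    calc ‖P * B * P‖ ≤ ‖(C * P)ᴴ‖ * ‖C * P‖ := by rw [h1]; exact Matrix.frobenius_norm_mul _ _
      _ = ‖C * P‖ ^ 2 := by rw [Matrix.frobenius_norm_conjTranspose, sq]
      _ ≤ _ := by rw [h2]; exact htrace
  have hBP : B * P = P * B * P + P * E * P - E * P := by
    have h1 : P * (σ • 1 + B + E) * P = (σ • 1 + B + E) * P := by
      rw [← hcomm, Matrix.mul_assoc, hPP]
    have h2 : σ • P + P * B * P + P * E * P = σ • P + B * P + E * P := by
      simpa [Matrix.mul_add, Matrix.add_mul, hPP] using h1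
    have h3 : P * B * P + P * E * P = B * P + E * P := by
      simpa [add_assoc] using h2
    rw [h3]; abel
  have hPEP : ‖P * E * P‖ ≤ q ^ 2 * e := by
    calc ‖P * E * P‖ ≤ ‖P‖ * ‖E‖ * ‖P‖ := norm_mul₃_le
      _ = q ^ 2 * e := by rw [hPn, he]; ring
  have hEP : ‖E * P‖ ≤ q * e := by
    calc ‖E * P‖ ≤ ‖E‖ * ‖P‖ := norm_mul_le _ _
      _ = q * e := by rw [hPn, he]; ring
  have hQP : (1 - Q) * P = G * (B * P) := by rw [← hG]; simp only [Matrix.mul_assoc]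
  have hQPn : ‖(1 - Q) * P‖ ≤ κ₂ * e := by
    rw [hQP, hBP]
    calc ‖G * (P * B * P + P * E * P - E * P)‖
        ≤ g * ‖P * B * P + P * E * P - E * P‖ := by rw [hg]; exact norm_mul_le _ _
      _ ≤ g * (‖P * B * P‖ + ‖P * E * P‖ + ‖E * P‖) := by
          gcongr
          exact (norm_sub_le _ _).trans (by gcongr; exact norm_add_le _ _)
      _ ≤ g * (2 * q * e + q ^ 2 * e + q * e) := by gcongr
      _ = κ₂ * e := by rw [hκ₂]; ring
  have hdiff : ‖P - Q‖ ≤ 2 * κ₂ * e := by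
    have h1 : ‖P - Q‖ ^ 2 = 2 * ‖(1 - Q) * P‖ ^ 2 := by
      rw [frobenius_sq_eq_trace, frobenius_sq_eq_trace]
      have h2 : (P - Q)ᴴ * (P - Q) = P - P * Q - Q * P + Q := by
        simp only [Matrix.conjTranspose_sub, hP, hQ, Matrix.sub_mul, Matrix.mul_sub, hPP, hQQ]
        abel
      have h3 : ((1 - Q) * P)ᴴ * ((1 - Q) * P) = P - P * (Q * P) := by
        simp only [Matrix.conjTranspose_mul, Matrix.conjTranspose_sub, hP, hQ,
          Matrix.sub_mul, Matrix.mul_sub, Matrix.one_mul, hPP, Matrix.mul_assoc]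
        rw [← Matrix.mul_assoc Q Q, hQQ]
        abel
      have h4 : (P * (Q * P)).trace = (Q * P).trace := by
        rw [Matrix.trace_mul_comm, Matrix.mul_assoc, hPP]
      rw [h2, h3]
      simp only [Matrix.trace_add, Matrix.trace_sub, h4, htr, Matrix.trace_mul_comm P Q,
        Complex.add_re, Complex.sub_re]
      ring
    have h5 : ‖P - Q‖ ^ 2 ≤ (2 * ‖(1 - Q) * P‖) ^ 2 := by
      rw [h1]; nlinarith [sq_nonneg ‖(1 - Q) * P‖]
    have h6 := (sq_le_sq₀ (norm_nonneg _) (by positivity)).1 h5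
    linarith
  refine ⟨hdiff.trans ?_, ?_⟩
  · apply mul_le_mul_of_nonneg_right _ he0
    have : 0 ≤ g * (κ₂ * b * κ₂) + (g * κ₂) * q + g * (2 * κ₂) := by positivity
    linarith
  · -- the part of the first-order identity that is of second order
    have hPQ : ‖P * (1 - Q)‖ ≤ κ₂ * e := by
      have : P * (1 - Q) = ((1 - Q) * P)ᴴ := by
        simp [Matrix.conjTranspose_mul, hP, hQ]
      rw [this, Matrix.frobenius_norm_conjTranspose]
      exact hQPn
    have hBsplit : P * B * P = (P * (1 - Q)) * B * ((1 - Q) * P) := by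
      have : (1 - Q) * B * (1 - Q) = B := by
        simp [Matrix.sub_mul, Matrix.mul_sub, hQB, hBQ]
      conv_lhs => rw [← this]
      simp only [Matrix.mul_assoc]
    have hsq : ‖P * B * P‖ ≤ (κ₂ * e) * b * (κ₂ * e) := by
      rw [hBsplit]
      refine norm_mul₃_le.trans ?_
      rw [hb]
      gcongr
    have hGP : ‖G * P‖ ≤ g * (κ₂ * e) := by
      have : G * P = G * ((1 - Q) * P) := by
        rw [← Matrix.mul_assoc, Matrix.mul_sub, hGQ, Matrix.mul_one, sub_zero]
      rw [this]
      refine (norm_mul_le _ _).trans ?_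
      rw [hg]
      gcongr
    have hsplit : (1 - Q) * P + G * E * Q
        = G * (P * B * P) + (G * P) * (E * P) - G * (E * (P - Q)) := by
      rw [hQP, hBP]
      simp only [Matrix.mul_add, Matrix.mul_sub, Matrix.mul_assoc]
      abel
    have h1 : ‖G * (P * B * P)‖ ≤ g * ((κ₂ * e) * b * (κ₂ * e)) :=
      (norm_mul_le _ _).trans (by rw [← hg]; exact mul_le_mul_of_nonneg_left hsq hg0)
    have h2 : ‖(G * P) * (E * P)‖ ≤ g * (κ₂ * e) * (q * e) :=
      (norm_mul_le _ _).trans (mul_le_mul hGP hEP (norm_nonneg _) (by positivity))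
    have h3 : ‖E * (P - Q)‖ ≤ e * (2 * κ₂ * e) :=
      (norm_mul_le _ _).trans (by rw [← he]; exact mul_le_mul_of_nonneg_left hdiff he0)
    have h4 : ‖G * (E * (P - Q))‖ ≤ g * (e * (2 * κ₂ * e)) :=
      (norm_mul_le _ _).trans (by rw [← hg]; exact mul_le_mul_of_nonneg_left h3 hg0)
    have h5 : ‖(1 - Q) * P + G * E * Q‖
        ≤ ‖G * (P * B * P)‖ + ‖(G * P) * (E * P)‖ + ‖G * (E * (P - Q))‖ := by
      rw [hsplit]
      exact (norm_sub_le _ _).trans (add_le_add_left (norm_add_le _ _) _)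
    have h6 : 0 ≤ 2 * κ₂ * e ^ 2 := by positivity
    linarith

end Perturbation

/-! ### Pseudo-inverse and projector of a matrix of full column rank -/

section Pinv

variable {m n : ℕ} {B : Matrix (Fin m) (Fin n) ℂ}

lemma pinv_mul_self (hB : Function.Injective B.mulVec) : pinv B * B = 1 := by
  have h : (Bᴴ * B).PosDef := Matrix.PosDef.conjTranspose_mul_self B hB
  rw [pinv, Matrix.mul_assoc, Matrix.nonsing_inv_mul]
  exact (Matrix.isUnit_iff_isUnit_det _).1 h.isUnit

lemma conjTranspose_mul_pinv : (B * pinv B)ᴴ = B * pinv B := by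
  simp only [pinv, Matrix.conjTranspose_mul, Matrix.conjTranspose_conjTranspose,
    Matrix.conjTranspose_nonsing_inv, Matrix.mul_assoc]

lemma projPerp_isHermitian : (projPerp B)ᴴ = projPerp B := by
  rw [projPerp, Matrix.conjTranspose_sub, Matrix.conjTranspose_one, conjTranspose_mul_pinv]

lemma projPerp_mul (hB : Function.Injective B.mulVec) : projPerp B * B = 0 := by
  rw [projPerp, Matrix.sub_mul, Matrix.mul_assoc, pinv_mul_self hB, Matrix.one_mul,
    Matrix.mul_one, sub_self]

lemma conjTranspose_mul_projPerp (hB : Function.Injective B.mulVec) : Bᴴ * projPerp B = 0 := by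
  rw [← projPerp_isHermitian, ← Matrix.conjTranspose_mul, projPerp_mul hB,
    Matrix.conjTranspose_zero]

lemma pinv_mul_projPerp (hB : Function.Injective B.mulVec) : pinv B * projPerp B = 0 := by
  rw [pinv, Matrix.mul_assoc, conjTranspose_mul_projPerp hB, Matrix.mul_zero]

lemma projPerp_mul_self (hB : Function.Injective B.mulVec) :
    projPerp B * projPerp B = projPerp B := by
  conv_lhs => rw [projPerp, Matrix.sub_mul, Matrix.one_mul, Matrix.mul_assoc]
  rw [← projPerp, pinv_mul_projPerp hB, Matrix.mul_zero, sub_zero]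

lemma trace_projPerp (hB : Function.Injective B.mulVec) : (projPerp B).trace = (m : ℂ) - n := by
  rw [projPerp, Matrix.trace_sub, Matrix.trace_mul_comm, pinv_mul_self hB]
  simp

lemma dotProduct_projPerp (hB : Function.Injective B.mulVec) (v : Fin m → ℂ) :
    star v ⬝ᵥ (projPerp B *ᵥ v) = star (projPerp B *ᵥ v) ⬝ᵥ (projPerp B *ᵥ v) := by
  rw [Matrix.star_mulVec, projPerp_isHermitian, ← Matrix.dotProduct_mulVec, Matrix.mulVec_mulVec,
    projPerp_mul_self hB]

lemma dotProduct_projPerp_pos (hB : Function.Injective B.mulVec) {v : Fin m → ℂ}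
    (hv : ∀ c : Fin n → ℂ, v ≠ B *ᵥ c) : 0 < (star v ⬝ᵥ (projPerp B *ᵥ v)).re := by
  rw [dotProduct_projPerp hB]
  have h : projPerp B *ᵥ v ≠ 0 := by
    intro h
    apply hv (pinv B *ᵥ v)
    rw [projPerp, Matrix.sub_mulVec, Matrix.one_mulVec, sub_eq_zero] at h
    rw [Matrix.mulVec_mulVec]
    exact h
  have h2 := Matrix.dotProduct_star_self_pos_iff.2 h
  exact (Complex.pos_iff.1 h2).1

end Pinv

/-! ### The manifold of the virtual uniform linear array -/

namespace Model

open Polynomial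

variable {M K : ℕ} (S : Model M K)

/-- The ratio of the geometric progression `S.vsteer Mv t`. -/
def ratio (t : ℝ) : ℂ := Complex.exp (Complex.I * (S.phase t : ℝ))

/-- The derivative of the electrical angle. -/
def phaseDeriv (t : ℝ) : ℝ := 2 * Real.pi * S.d₀ * Real.cos t / S.lam

lemma hasDerivAt_phase (t : ℝ) : HasDerivAt S.phase (S.phaseDeriv t) t :=
  ((Real.hasDerivAt_sin t).const_mul _).div_const _

lemma vsteer_eq_pow (Mv : ℕ) (t : ℝ) (m : Fin Mv) : S.vsteer Mv t m = S.ratio t ^ (m : ℕ) := by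
  rw [vsteer, ratio, ← Complex.exp_nat_mul]
  congr 1
  push_cast
  ring

lemma ratio_ne_zero (t : ℝ) : S.ratio t ≠ 0 := Complex.exp_ne_zero _

lemma norm_ratio (t : ℝ) : ‖S.ratio t‖ = 1 := by
  rw [ratio, mul_comm, Complex.norm_exp_ofReal_mul_I]

lemma hasDerivAt_vsteer (Mv : ℕ) (t : ℝ) (m : Fin Mv) :
    HasDerivAt (fun s : ℝ => S.vsteer Mv s m)
      (Complex.I * ((m : ℕ) : ℂ) * S.phaseDeriv t * S.vsteer Mv t m) t := by
  have h1 : HasDerivAt (fun s : ℝ => Complex.I * ((((m : ℕ) : ℝ) * S.phase s : ℝ) : ℂ))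
      (Complex.I * ((((m : ℕ) : ℝ) * S.phaseDeriv t : ℝ) : ℂ)) t :=
    (((S.hasDerivAt_phase t).const_mul _).ofReal_comp).const_mul _
  convert! h1.cexp using 1
  rw [vsteer]
  push_cast
  ring

lemma vsteerDeriv_eq (Mv : ℕ) (t : ℝ) (m : Fin Mv) :
    S.vsteerDeriv Mv t m = Complex.I * ((m : ℕ) : ℂ) * S.phaseDeriv t * S.vsteer Mv t m :=
  (S.hasDerivAt_vsteer Mv t m).deriv

/-- Pairing a steering vector with the coefficients of a polynomial evaluates the polynomial. -/
lemma sum_coeff_vsteer {Mv : ℕ} {q : ℂ[X]} (hq : q.natDegree < Mv) (t : ℝ) :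
    ∑ m : Fin Mv, q.coeff m * S.vsteer Mv t m = q.eval (S.ratio t) := by
  rw [eval_eq_sum_range' hq, ← Fin.sum_univ_eq_sum_range
    (fun i => q.coeff i * S.ratio t ^ i) Mv]
  simp only [vsteer_eq_pow]

lemma sum_coeff_vsteerDeriv {Mv : ℕ} {q : ℂ[X]} (hq : q.natDegree < Mv) (t : ℝ) :
    ∑ m : Fin Mv, q.coeff m * S.vsteerDeriv Mv t m
      = Complex.I * S.phaseDeriv t * S.ratio t * q.derivative.eval (S.ratio t) := by
  have h : (X * q.derivative).natDegree < Mv := by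
    rcases Nat.eq_zero_or_pos q.natDegree with h0 | h0
    · rw [derivative_of_natDegree_zero h0, mul_zero, natDegree_zero]
      exact lt_of_le_of_lt (Nat.zero_le _) hq
    · have := natDegree_derivative_lt h0.ne'
      have h2 := natDegree_mul_le (p := (X : ℂ[X])) (q := q.derivative)
      rw [natDegree_X] at h2
      omega
  have h2 := S.sum_coeff_vsteer h t
  rw [eval_mul, eval_X] at h2
  calc ∑ m : Fin Mv, q.coeff m * S.vsteerDeriv Mv t m
      = Complex.I * S.phaseDeriv t *
          ∑ m : Fin Mv, (X * q.derivative).coeff m * S.vsteer Mv t m := by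
        rw [Finset.mul_sum]
        refine Finset.sum_congr rfl fun m _ => ?_
        rw [vsteerDeriv_eq]
        rcases m with ⟨_ | i, hi⟩
        · simp
        · simp only [coeff_X_mul, coeff_derivative]
          push_cast
          ring
    _ = _ := by rw [h2]; ring

lemma abs_phase_le (hd₀ : 0 < S.d₀) (hlam : 0 < S.lam) (hhalf : S.d₀ ≤ S.lam / 2) (t : ℝ) :
    |S.phase t| ≤ Real.pi * |Real.sin t| := by
  rw [phase, abs_div, abs_mul, abs_of_pos hlam, abs_of_pos (by positivity), div_le_iff₀ hlam]
  nlinarith [mul_nonneg Real.pi_pos.le (abs_nonneg (Real.sin t))]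

lemma ratio_inj (hd₀ : 0 < S.d₀) (hlam : 0 < S.lam) (hhalf : S.d₀ ≤ S.lam / 2) {s t : ℝ}
    (hs : s ∈ Set.Ioo (-(Real.pi / 2)) (Real.pi / 2))
    (ht : t ∈ Set.Icc (-(Real.pi / 2)) (Real.pi / 2)) (h : S.ratio t = S.ratio s) : t = s := by
  obtain ⟨n, hn⟩ := Complex.exp_eq_exp_iff_exists_int.1 h
  have h1 : S.phase t = S.phase s + n * (2 * Real.pi) := by
    have h2 : Complex.I * (S.phase t : ℂ)
        = Complex.I * ((S.phase s + n * (2 * Real.pi) : ℝ) : ℂ) := by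
      rw [hn]; push_cast; ring
    exact_mod_cast mul_left_cancel₀ Complex.I_ne_zero h2
  have hpi := Real.pi_pos
  have h3 : |S.phase t| ≤ Real.pi :=
    (S.abs_phase_le hd₀ hlam hhalf t).trans
      (mul_le_of_le_one_right hpi.le (Real.abs_sin_le_one t))
  have h4 : |S.phase s| < Real.pi := by
    refine (S.abs_phase_le hd₀ hlam hhalf s).trans_lt (mul_lt_of_lt_one_right hpi ?_)
    have hc : 0 < Real.cos s := Real.cos_pos_of_mem_Ioo hs
    rw [abs_lt]
    constructor <;> nlinarith [Real.sin_sq_add_cos_sq s]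
  have hn0 : n = 0 := by
    rw [abs_le] at h3
    rw [abs_lt] at h4
    have h5 : (n : ℝ) < 1 := by nlinarith
    have h6 : (-1 : ℝ) < n := by nlinarith
    have h7 : n < 1 := by exact_mod_cast h5
    have h8 : -1 < n := by exact_mod_cast h6
    omega
  have h9 : Real.sin t = Real.sin s := by
    rw [hn0, Int.cast_zero, zero_mul, add_zero, phase, phase, div_left_inj' hlam.ne'] at h1
    exact mul_left_cancel₀ (by positivity) h1
  exact Real.injOn_sin ht (Set.Ioo_subset_Icc_self hs) h9

lemma sum_coeff_vsteerMat {Mv : ℕ} {q : ℂ[X]} (hq : q.natDegree < Mv) (c : Fin K → ℂ) :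
    ∑ m : Fin Mv, q.coeff m * (S.vsteerMat Mv *ᵥ c) m = ∑ k, q.eval (S.ratio (S.θ k)) * c k := by
  have h : ∀ m : Fin Mv, q.coeff m * (S.vsteerMat Mv *ᵥ c) m
      = ∑ k, q.coeff m * S.vsteer Mv (S.θ k) m * c k := by
    intro m
    rw [Matrix.mulVec, dotProduct, Finset.mul_sum]
    refine Finset.sum_congr rfl fun k _ => ?_
    rw [vsteerMat, Matrix.of_apply, mul_assoc]
  simp only [h]
  rw [Finset.sum_comm]
  refine Finset.sum_congr rfl fun k _ => ?_
  rw [← Finset.sum_mul, S.sum_coeff_vsteer hq]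

/-- The monic polynomial whose roots are the ratios of the sources in `s`. -/
def annihilator (s : Finset (Fin K)) : ℂ[X] := ∏ j ∈ s, (X - C (S.ratio (S.θ j)))

lemma natDegree_annihilator {Mv : ℕ} (hK : K < Mv) (s : Finset (Fin K)) :
    (S.annihilator s).natDegree < Mv := by
  rw [annihilator, natDegree_prod_of_monic _ _ fun j _ => monic_X_sub_C _]
  simp only [natDegree_X_sub_C, Finset.sum_const, smul_eq_mul, mul_one]
  exact lt_of_le_of_lt ((Finset.card_le_univ s).trans (by simp)) hK

lemma eval_annihilator (s : Finset (Fin K)) (z : ℂ) :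
    (S.annihilator s).eval z = ∏ j ∈ s, (z - S.ratio (S.θ j)) := by
  simp [annihilator, eval_prod]

lemma eval_annihilator_univ (k : Fin K) :
    (S.annihilator Finset.univ).eval (S.ratio (S.θ k)) = 0 := by
  rw [eval_annihilator]
  exact Finset.prod_eq_zero (Finset.mem_univ k) (sub_self _)

variable {Mv : ℕ} (hd₀ : 0 < S.d₀) (hlam : 0 < S.lam) (hhalf : S.d₀ ≤ S.lam / 2) (hK : K < Mv)
  (hθ : ∀ k, S.θ k ∈ Set.Ioo (-(Real.pi / 2)) (Real.pi / 2)) (hθinj : Function.Injective S.θ)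

include hd₀ hlam hhalf hθ hθinj in
lemma eval_annihilator_erase_ne_zero (k : Fin K) :
    (S.annihilator (Finset.univ.erase k)).eval (S.ratio (S.θ k)) ≠ 0 := by
  rw [eval_annihilator, Finset.prod_ne_zero_iff]
  intro j hj h
  exact (Finset.mem_erase.1 hj).1 (hθinj (S.ratio_inj hd₀ hlam hhalf (hθ j)
    (Set.Ioo_subset_Icc_self (hθ k)) (sub_eq_zero.1 h))).symm

include hd₀ hlam hhalf hK hθ hθinj in
/-- The steering matrix of the virtual array has full column rank. -/
lemma vsteerMat_injective : Function.Injective (S.vsteerMat Mv).mulVec := by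
  rw [← Matrix.coe_mulVecLin, injective_iff_map_eq_zero]
  intro c hc
  rw [Matrix.mulVecLin_apply] at hc
  funext k
  have h := S.sum_coeff_vsteerMat (S.natDegree_annihilator hK (Finset.univ.erase k)) c
  rw [hc, Finset.sum_eq_single k] at h
  · simp only [Pi.zero_apply, mul_zero, Finset.sum_const_zero] at h
    exact (mul_eq_zero.1 h.symm).resolve_left
      (S.eval_annihilator_erase_ne_zero hd₀ hlam hhalf hθ hθinj k)
  · intro j _ hj
    rw [eval_annihilator, Finset.prod_eq_zero (i := j), zero_mul]
    · exact Finset.mem_erase.2 ⟨hj, Finset.mem_univ j⟩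
    · exact sub_self _
  · simp

include hd₀ hlam hhalf hK hθ in
/-- Only the steering vectors of the sources lie in the signal subspace. -/
lemma vsteer_ne_mulVec {t : ℝ} (ht : t ∈ Set.Icc (-(Real.pi / 2)) (Real.pi / 2))
    (htθ : ∀ k, t ≠ S.θ k) (c : Fin K → ℂ) : S.vsteer Mv t ≠ S.vsteerMat Mv *ᵥ c := by
  intro h
  have h1 := S.sum_coeff_vsteer (S.natDegree_annihilator hK Finset.univ) t
  rw [h, S.sum_coeff_vsteerMat (S.natDegree_annihilator hK Finset.univ)] at h1
  simp only [eval_annihilator_univ, zero_mul, Finset.sum_const_zero] at h1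
  rw [eval_annihilator, eq_comm, Finset.prod_eq_zero_iff] at h1
  obtain ⟨j, -, hj⟩ := h1
  exact htθ j (S.ratio_inj hd₀ hlam hhalf (hθ j) ht (sub_eq_zero.1 hj))

include hd₀ hlam hhalf hK hθ hθinj in
lemma vsteerDeriv_ne_mulVec (k : Fin K) (c : Fin K → ℂ) :
    S.vsteerDeriv Mv (S.θ k) ≠ S.vsteerMat Mv *ᵥ c := by
  intro h
  have h1 := S.sum_coeff_vsteerDeriv (S.natDegree_annihilator hK Finset.univ) (S.θ k)
  rw [h, S.sum_coeff_vsteerMat (S.natDegree_annihilator hK Finset.univ)] at h1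
  simp only [eval_annihilator_univ, zero_mul, Finset.sum_const_zero] at h1
  have hq : S.annihilator Finset.univ
      = (X - Polynomial.C (S.ratio (S.θ k))) * S.annihilator (Finset.univ.erase k) :=
    (Finset.mul_prod_erase _ _ (Finset.mem_univ k)).symm
  have h2 : (S.annihilator Finset.univ).derivative.eval (S.ratio (S.θ k))
      = (S.annihilator (Finset.univ.erase k)).eval (S.ratio (S.θ k)) := by
    rw [hq, derivative_mul, derivative_X_sub_C]
    simp
  rw [h2] at h1
  have hc : 0 < Real.cos (S.θ k) := Real.cos_pos_of_mem_Ioo (hθ k)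
  have h3 : (S.phaseDeriv (S.θ k) : ℂ) ≠ 0 := by
    have hpi := Real.pi_pos
    have : 0 < S.phaseDeriv (S.θ k) := by rw [phaseDeriv]; positivity
    exact_mod_cast this.ne'
  exact mul_ne_zero (mul_ne_zero (mul_ne_zero Complex.I_ne_zero h3) (S.ratio_ne_zero _))
    (S.eval_annihilator_erase_ne_zero hd₀ hlam hhalf hθ hθinj k) h1.symm

include hd₀ hlam hhalf hK hθ hθinj in
lemma gamma_pos (k : Fin K) : 0 < S.gamma Mv k :=
  dotProduct_projPerp_pos (S.vsteerMat_injective hd₀ hlam hhalf hK hθ hθinj)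
    (S.vsteerDeriv_ne_mulVec hd₀ hlam hhalf hK hθ hθinj k)

end Model

/-! ### The augmented covariance matrices -/

section Coarray

variable {M : ℕ} (pos : Fin M → ℤ) (Mv : ℕ)

/-- The average of the entries of `C` over the sensor pairs with difference `l`. -/
def coarrayAvg (C : Matrix (Fin M) (Fin M) ℂ) (l : ℤ) : ℂ :=
  ∑ qp : Fin M × Fin M, (if pos qp.2 - pos qp.1 = l then 1 / (weight pos l : ℂ) else 0)
    * C qp.2 qp.1

variable {pos Mv}

lemma subarrayOut_eq (C : Matrix (Fin M) (Fin M) ℂ) (i a : Fin Mv) :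
    subarrayOut pos Mv C i a = coarrayAvg pos C ((a : ℤ) + (i : ℤ) - ((Mv : ℤ) - 1)) := by
  have hlt : (a : ℕ) + (i : ℕ) < 2 * Mv - 1 := by omega
  rw [subarrayOut, Matrix.mulVec, dotProduct, Finset.sum_eq_single ⟨(a : ℕ) + (i : ℕ), hlt⟩]
  · rw [subarraySel, Matrix.of_apply, if_pos rfl, one_mul, Matrix.mulVec, dotProduct, coarrayAvg]
    refine Finset.sum_congr rfl fun qp _ => ?_
    rw [coarraySel, Matrix.of_apply]
    simp only [Nat.cast_add, Matrix.vec]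
  · intro c _ hc
    rw [subarraySel, Matrix.of_apply, if_neg, zero_mul]
    intro h
    exact hc (Fin.ext h)
  · simp

/-- The directly augmented matrix is Toeplitz: its entries are the averages over the coarray. -/
lemma daMatrix_apply (C : Matrix (Fin M) (Fin M) ℂ) (a b : Fin Mv) :
    daMatrix pos Mv C a b = coarrayAvg pos C ((a : ℤ) - (b : ℤ)) := by
  rw [daMatrix, Matrix.of_apply, subarrayOut_eq]
  congr 1
  have := b.rev_eq_iff (j := b.rev)
  rw [Fin.val_rev]
  omega

lemma coarrayAvg_sub (C C' : Matrix (Fin M) (Fin M) ℂ) (l : ℤ) :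
    coarrayAvg pos (C - C') l = coarrayAvg pos C l - coarrayAvg pos C' l := by
  simp only [coarrayAvg, Matrix.sub_apply, mul_sub, Finset.sum_sub_distrib]

lemma daMatrix_sub (C C' : Matrix (Fin M) (Fin M) ℂ) :
    daMatrix pos Mv (C - C') = daMatrix pos Mv C - daMatrix pos Mv C' := by
  ext a b
  simp only [Matrix.sub_apply, daMatrix_apply, coarrayAvg_sub]

lemma weight_neg (l : ℤ) : weight pos (-l) = weight pos l := by
  rw [weight, weight]
  refine Finset.card_bij' (fun x _ => x.swap) (fun x _ => x.swap) ?_ ?_ ?_ ?_ <;>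
    simp <;> intros <;> omega

lemma star_coarrayAvg {C : Matrix (Fin M) (Fin M) ℂ} (hC : Cᴴ = C) (l : ℤ) :
    star (coarrayAvg pos C l) = coarrayAvg pos C (-l) := by
  rw [coarrayAvg, coarrayAvg, star_sum, ← (Equiv.prodComm (Fin M) (Fin M)).sum_comp]
  refine Finset.sum_congr rfl fun qp _ => ?_
  have h : star (C qp.1 qp.2) = C qp.2 qp.1 := by
    conv_rhs => rw [← hC, Matrix.conjTranspose_apply]
  simp only [Equiv.prodComm_apply, Prod.fst_swap, Prod.snd_swap, star_mul', h, weight_neg]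
  congr 1
  by_cases hl : pos qp.1 - pos qp.2 = l
  · have hl' : pos qp.2 - pos qp.1 = -l := by omega
    simp [hl, hl']
  · have hl' : ¬ pos qp.2 - pos qp.1 = -l := by omega
    simp [hl, hl']

lemma daMatrix_isHermitian {C : Matrix (Fin M) (Fin M) ℂ} (hC : Cᴴ = C) :
    (daMatrix pos Mv C)ᴴ = daMatrix pos Mv C := by
  ext a b
  rw [Matrix.conjTranspose_apply, daMatrix_apply, daMatrix_apply, star_coarrayAvg hC, neg_sub]

/-- The augmented matrix of a Hermitian matrix is invariant under conjugation combined with the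
reversal of the virtual array. -/
lemma daMatrix_rev {C : Matrix (Fin M) (Fin M) ℂ} (hC : Cᴴ = C) (a b : Fin Mv) :
    daMatrix pos Mv C a.rev b.rev = star (daMatrix pos Mv C a b) := by
  rw [daMatrix_apply, daMatrix_apply, star_coarrayAvg hC, Fin.val_rev, Fin.val_rev]
  congr 1
  omega

/-- Spatial smoothing squares the directly augmented matrix. -/
lemma ssMatrix_eq {C : Matrix (Fin M) (Fin M) ℂ} (hC : Cᴴ = C) :
    ssMatrix pos Mv C
      = (((1 / (Mv : ℝ) : ℝ)) : ℂ) • (daMatrix pos Mv C * daMatrix pos Mv C) := by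
  rw [ssMatrix]
  congr 1
  · push_cast; rfl
  · conv_rhs => rw [← daMatrix_isHermitian hC]
    conv_rhs => arg 1; rw [daMatrix_isHermitian hC]
    ext a b
    rw [Matrix.sum_apply, Matrix.mul_apply, ← Equiv.sum_comp Fin.revPerm]
    rfl

lemma coarrayAvg_const {C : Matrix (Fin M) (Fin M) ℂ} {l : ℤ} {c : ℂ}
    (hl : ∃ m n : Fin M, pos m - pos n = l) (hC : ∀ p q, pos p - pos q = l → C p q = c) :
    coarrayAvg pos C l = c := by
  have hw : (weight pos l : ℂ) ≠ 0 := by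
    obtain ⟨m, n, hmn⟩ := hl
    have : 0 < weight pos l := Finset.card_pos.2 ⟨(m, n), by simpa using hmn⟩
    exact_mod_cast this.ne'
  have h1 : coarrayAvg pos C l
      = ∑ qp : Fin M × Fin M, if pos qp.2 - pos qp.1 = l then c / (weight pos l : ℂ) else 0 := by
    refine Finset.sum_congr rfl fun qp _ => ?_
    by_cases h : pos qp.2 - pos qp.1 = l
    · rw [if_pos h, if_pos h, hC _ _ h]; ring
    · rw [if_neg h, if_neg h, zero_mul]
  rw [h1, ← Finset.sum_filter, Finset.sum_const, nsmul_eq_mul]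
  have h2 : (Finset.univ.filter fun qp : Fin M × Fin M => pos qp.2 - pos qp.1 = l).card
      = weight pos l := by
    rw [weight]
    refine Finset.card_bij' (fun x _ => x.swap) (fun x _ => x.swap) ?_ ?_ ?_ ?_ <;> simp
  rw [h2]
  field_simp

/-- A linear functional of the augmented matrix as a functional of the covariance matrix. -/
lemma sum_coarraySel_mul_vec (C : Matrix (Fin M) (Fin M) ℂ) (α β : Fin Mv → ℂ) :
    ((coarraySel pos Mv)ᵀ *ᵥ ((stackedSel Mv)ᵀ *ᵥ
      (fun ba : Fin Mv × Fin Mv => β ba.1 * α ba.2))) ⬝ᵥ C.vec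
      = α ⬝ᵥ (daMatrix pos Mv C *ᵥ β) := by
  rw [Matrix.mulVec_transpose, ← Matrix.dotProduct_mulVec, Matrix.mulVec_transpose,
    ← Matrix.dotProduct_mulVec]
  have h : ∀ ba : Fin Mv × Fin Mv, (stackedSel Mv *ᵥ (coarraySel pos Mv *ᵥ C.vec)) ba
      = daMatrix pos Mv C ba.2 ba.1 := fun ba => rfl
  rw [dotProduct, Fintype.sum_prod_type, Finset.sum_comm, dotProduct]
  simp only [h]
  simp only [dotProduct, Matrix.mulVec, Finset.mul_sum]
  refine Finset.sum_congr rfl fun a _ => Finset.sum_congr rfl fun b _ => ?_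
  ring

end Coarray

namespace Model

variable {M K : ℕ} (S : Model M K)

/-- Augmenting the covariance matrix yields the covariance matrix of the virtual array. -/
lemma daMatrix_cov {Mv : ℕ} (hpos : Function.Injective S.pos)
    (hMv : ∀ l : ℤ, |l| < (Mv : ℤ) → ∃ m n : Fin M, S.pos m - S.pos n = l) :
    daMatrix S.pos Mv S.cov = (S.noiseVar : ℂ) • 1
      + S.vsteerMat Mv * Matrix.diagonal (fun k => (S.p k : ℂ)) * (S.vsteerMat Mv)ᴴ := by
  ext a b
  rw [daMatrix_apply]
  apply coarrayAvg_const
  · apply hMv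
    rw [abs_lt]
    omega
  · intro p q hpq
    rw [cov, add_comm, Matrix.add_apply, Matrix.add_apply]
    congr 1
    · simp only [Matrix.smul_apply, Matrix.one_apply, smul_eq_mul]
      have : p = q ↔ a = b := by
        rw [← hpos.eq_iff, Fin.ext_iff]
        omega
      simp only [this]
    · rw [Matrix.mul_apply, Matrix.mul_apply]
      simp only [Matrix.mul_diagonal, Matrix.conjTranspose_apply]
      refine Finset.sum_congr rfl fun k _ => ?_
      have key : ∀ x y : ℝ, Complex.exp (Complex.I * (x : ℝ)) * star (Complex.exp (Complex.I * (y : ℝ)))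
          = Complex.exp (Complex.I * ((x - y : ℝ) : ℂ)) := by
        intro x y
        rw [Complex.star_def, ← Complex.exp_conj, ← Complex.exp_add]
        congr 1
        simp
        ring
      have h1 : S.steer (S.θ k) p * star (S.steer (S.θ k) q)
          = S.vsteer Mv (S.θ k) a * star (S.vsteer Mv (S.θ k) b) := by
        rw [steer, steer, vsteer, vsteer, key, key, ← sub_mul, ← sub_mul]
        congr 4
        exact_mod_cast hpq
      simp only [steerMat, vsteerMat, Matrix.of_apply]
      calc _ = (S.p k : ℂ) * (S.steer (S.θ k) p * star (S.steer (S.θ k) q)) := by ring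
        _ = _ := by rw [h1]; ring

lemma cov_isHermitian : S.covᴴ = S.cov := by
  rw [cov, Matrix.conjTranspose_add, Matrix.conjTranspose_mul, Matrix.conjTranspose_mul,
    Matrix.conjTranspose_conjTranspose, Matrix.diagonal_conjTranspose, Matrix.conjTranspose_smul,
    Matrix.conjTranspose_one, Matrix.mul_assoc]
  congr 3
  · congr 2
    funext k
    simp
  · simp

/-- The leading term of the estimation error: `α_kᵀ D β_k`, with `D` the augmented matrix of `C`. -/
lemma xi_dotProduct_vec (Mv : ℕ) (k : Fin K) (C : Matrix (Fin M) (Fin M) ℂ) :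
    S.xi Mv k ⬝ᵥ C.vec = S.alpha Mv k ⬝ᵥ (daMatrix S.pos Mv C *ᵥ S.beta Mv k) :=
  sum_coarraySel_mul_vec C _ _

lemma errForm_eq (Mv : ℕ) (k l : Fin K) :
    S.errForm Mv k l = ∑ qp : Fin M × Fin M, ∑ sr : Fin M × Fin M,
      star (S.xi Mv k qp) * S.xi Mv l sr * (S.cov qp.1 sr.1 * S.cov sr.2 qp.2) := by
  simp only [errForm, dotProduct, Matrix.mulVec, Finset.mul_sum]
  refine Finset.sum_congr rfl fun qp _ => Finset.sum_congr rfl fun sr _ => ?_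
  rw [Matrix.kroneckerMap_apply, Matrix.transpose_apply, Pi.star_apply]
  ring

section Reversal

variable {Mv : ℕ}

lemma vsteer_rev (t : ℝ) (a : Fin Mv) :
    S.vsteer Mv t a.rev = S.ratio t ^ (Mv - 1) * star (S.vsteer Mv t a) := by
  have h : star (S.ratio t) = (S.ratio t)⁻¹ := by
    rw [Complex.star_def, Complex.inv_eq_conj (S.norm_ratio t)]
  rw [vsteer_eq_pow, vsteer_eq_pow, star_pow, h, inv_pow, Fin.val_rev, eq_mul_inv_iff_mul_eq₀
    (pow_ne_zero _ (S.ratio_ne_zero t)), ← pow_add]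
  congr 1
  omega

lemma vsteerDeriv_rev (t : ℝ) (a : Fin Mv) :
    S.vsteerDeriv Mv t a.rev = S.ratio t ^ (Mv - 1) * (star (S.vsteerDeriv Mv t a)
      + Complex.I * ((Mv - 1 : ℕ) : ℂ) * S.phaseDeriv t * star (S.vsteer Mv t a)) := by
  rw [vsteerDeriv_eq, vsteerDeriv_eq, vsteer_rev, Fin.val_rev]
  have h : ((Mv - ((a : ℕ) + 1) : ℕ) : ℂ) = ((Mv - 1 : ℕ) : ℂ) - (a : ℕ) := by
    rw [← Nat.cast_sub (by omega)]
    congr 1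
    omega
  rw [h]
  simp only [star_mul', Complex.star_def, Complex.conj_I, Complex.conj_natCast, Complex.conj_ofReal]
  ring

/-- The phases by which the reversal of the virtual array acts on the steering vectors. -/
def revPhase (Mv : ℕ) : Matrix (Fin K) (Fin K) ℂ :=
  Matrix.diagonal fun k => S.ratio (S.θ k) ^ (Mv - 1)

lemma ratio_pow_mul_star (t : ℝ) (i : ℕ) : S.ratio t ^ i * star (S.ratio t ^ i) = 1 := by
  rw [Complex.star_def, Complex.mul_conj, Complex.normSq_eq_norm_sq, norm_pow, norm_ratio]
  simp

lemma revPhase_mul_conjTranspose : S.revPhase Mv * (S.revPhase Mv)ᴴ = 1 := by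
  rw [revPhase, Matrix.diagonal_conjTranspose, Matrix.diagonal_mul_diagonal, ← Matrix.diagonal_one]
  congr 1
  funext k
  exact S.ratio_pow_mul_star _ _

lemma vsteerMat_rev :
    (S.vsteerMat Mv).submatrix Fin.revPerm id = (S.vsteerMat Mv)ᴴᵀ * S.revPhase Mv := by
  ext a k
  rw [revPhase, Matrix.mul_diagonal, Matrix.submatrix_apply]
  simp only [vsteerMat, Matrix.transpose_apply, Matrix.conjTranspose_apply, Matrix.of_apply, id,
    Fin.revPerm_apply]
  rw [vsteer_rev, mul_comm]

lemma gram_rev : (S.vsteerMat Mv)ᴴ * S.vsteerMat Mv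
    = (S.revPhase Mv)ᴴ * ((S.vsteerMat Mv)ᴴ * S.vsteerMat Mv)ᵀ * S.revPhase Mv := by
  have h : (S.vsteerMat Mv)ᴴ * S.vsteerMat Mv
      = ((S.vsteerMat Mv).submatrix Fin.revPerm id)ᴴ
        * (S.vsteerMat Mv).submatrix Fin.revPerm id := by
    rw [Matrix.conjTranspose_submatrix, Matrix.submatrix_mul_equiv]
    rfl
  conv_lhs => rw [h, vsteerMat_rev, Matrix.conjTranspose_mul]
  rw [Matrix.transpose_mul]
  have h2 : ((S.vsteerMat Mv)ᴴᵀ)ᴴ = (S.vsteerMat Mv)ᵀ := by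
    ext i j; simp
  rw [h2]
  simp only [Matrix.mul_assoc]

lemma pinv_rev : (pinv (S.vsteerMat Mv)).submatrix id Fin.revPerm
    = (S.revPhase Mv)ᴴ * (pinv (S.vsteerMat Mv))ᴴᵀ := by
  have hW := S.revPhase_mul_conjTranspose (Mv := Mv)
  have hW' : (S.revPhase Mv)⁻¹ = (S.revPhase Mv)ᴴ := Matrix.inv_eq_right_inv hW
  have hW'' : (S.revPhase Mv)ᴴ⁻¹ = S.revPhase Mv := Matrix.inv_eq_left_inv hW
  set G := ((S.vsteerMat Mv)ᴴ * S.vsteerMat Mv)⁻¹ with hG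
  have hGG : G = (S.revPhase Mv)ᴴ * Gᵀ * S.revPhase Mv := by
    conv_lhs => rw [hG, gram_rev, Matrix.mul_inv_rev, Matrix.mul_inv_rev, hW', hW'',
      ← Matrix.transpose_nonsing_inv]
    rw [Matrix.mul_assoc]
  have hGH : Gᴴ = G := by
    rw [hG, Matrix.conjTranspose_nonsing_inv, Matrix.conjTranspose_mul,
      Matrix.conjTranspose_conjTranspose]
  have h1 : (pinv (S.vsteerMat Mv)).submatrix id Fin.revPerm
      = G * ((S.vsteerMat Mv).submatrix Fin.revPerm id)ᴴ := by
    rw [pinv, Matrix.conjTranspose_submatrix, ← hG]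
    ext i j
    rfl
  have h2 : ((S.vsteerMat Mv)ᴴᵀ)ᴴ = (S.vsteerMat Mv)ᵀ := by
    ext i j; simp
  have h3 : (pinv (S.vsteerMat Mv))ᴴᵀ = Gᵀ * (S.vsteerMat Mv)ᵀ := by
    rw [pinv, ← hG, Matrix.conjTranspose_mul, Matrix.transpose_mul, hGH,
      Matrix.conjTranspose_conjTranspose]
  rw [h1, vsteerMat_rev, Matrix.conjTranspose_mul, h2, h3]
  conv_lhs => rw [hGG]
  calc _ = (S.revPhase Mv)ᴴ * Gᵀ * (S.revPhase Mv * (S.revPhase Mv)ᴴ) * (S.vsteerMat Mv)ᵀ := by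
        simp only [Matrix.mul_assoc]
    _ = _ := by rw [hW, Matrix.mul_one, Matrix.mul_assoc]

lemma projPerp_rev : (projPerp (S.vsteerMat Mv)).submatrix Fin.revPerm Fin.revPerm
    = (projPerp (S.vsteerMat Mv))ᵀ := by
  have h1 : (S.vsteerMat Mv * pinv (S.vsteerMat Mv)).submatrix Fin.revPerm Fin.revPerm
      = (S.vsteerMat Mv).submatrix Fin.revPerm id
        * (pinv (S.vsteerMat Mv)).submatrix id Fin.revPerm := by
    ext i j; rfl
  have h2 : (S.vsteerMat Mv)ᴴᵀ * (pinv (S.vsteerMat Mv))ᴴᵀ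
      = (S.vsteerMat Mv * pinv (S.vsteerMat Mv))ᵀ := by
    rw [← Matrix.transpose_mul, ← Matrix.conjTranspose_mul, conjTranspose_mul_pinv]
  rw [projPerp, Matrix.submatrix_sub, Pi.sub_apply, Pi.sub_apply, h1, vsteerMat_rev, pinv_rev,
    Matrix.transpose_sub, Matrix.submatrix_one_equiv, Matrix.transpose_one, ← h2]
  congr 1
  calc _ = (S.vsteerMat Mv)ᴴᵀ * (S.revPhase Mv * (S.revPhase Mv)ᴴ)
        * (pinv (S.vsteerMat Mv))ᴴᵀ := by simp only [Matrix.mul_assoc]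
    _ = _ := by rw [revPhase_mul_conjTranspose, Matrix.mul_one]

lemma alpha_rev (k : Fin K) (a : Fin Mv) :
    S.alpha Mv k a.rev = star (S.ratio (S.θ k) ^ (Mv - 1)) * star (S.alpha Mv k a) := by
  have h := congrFun (congrFun (S.pinv_rev (Mv := Mv)) k) a
  rw [revPhase, Matrix.diagonal_conjTranspose, Matrix.diagonal_mul] at h
  simp only [Matrix.submatrix_apply, id, Fin.revPerm_apply, Pi.star_apply, Matrix.transpose_apply,
    Matrix.conjTranspose_apply] at h
  rw [alpha, h, alpha, star_neg, mul_neg]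

lemma beta_rev (hinj : Function.Injective (S.vsteerMat Mv).mulVec) (k : Fin K) (a : Fin Mv) :
    S.beta Mv k a.rev = S.ratio (S.θ k) ^ (Mv - 1) * star (S.beta Mv k a) := by
  have hP : ∀ b, projPerp (S.vsteerMat Mv) a.rev b.rev = star (projPerp (S.vsteerMat Mv) a b) := by
    intro b
    have h := congrFun (congrFun (S.projPerp_rev (Mv := Mv)) a) b
    rw [Matrix.submatrix_apply, Fin.revPerm_apply, Fin.revPerm_apply, Matrix.transpose_apply] at h
    rw [h, ← Matrix.conjTranspose_apply, projPerp_isHermitian]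
  have h0 : ∑ b, star (projPerp (S.vsteerMat Mv) a b) * star (S.vsteer Mv (S.θ k) b) = 0 := by
    have h := congrArg star (congrFun (congrFun (projPerp_mul hinj) a) k)
    simpa [Matrix.mul_apply, vsteerMat] using h
  rw [beta, Matrix.mulVec, dotProduct, ← Equiv.sum_comp Fin.revPerm]
  simp only [Fin.revPerm_apply, hP, vsteerDeriv_rev]
  calc ∑ b, star (projPerp (S.vsteerMat Mv) a b) * (S.ratio (S.θ k) ^ (Mv - 1) *
        (star (S.vsteerDeriv Mv (S.θ k) b)
          + Complex.I * ((Mv - 1 : ℕ) : ℂ) * S.phaseDeriv (S.θ k) * star (S.vsteer Mv (S.θ k) b)))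
      = S.ratio (S.θ k) ^ (Mv - 1) *
          (∑ b, star (projPerp (S.vsteerMat Mv) a b) * star (S.vsteerDeriv Mv (S.θ k) b))
        + S.ratio (S.θ k) ^ (Mv - 1) * (Complex.I * ((Mv - 1 : ℕ) : ℂ) * S.phaseDeriv (S.θ k)) *
          ∑ b, star (projPerp (S.vsteerMat Mv) a b) * star (S.vsteer Mv (S.θ k) b) := by
        rw [Finset.mul_sum, Finset.mul_sum, ← Finset.sum_add_distrib]
        refine Finset.sum_congr rfl fun b _ => ?_
        ring
    _ = _ := by
        rw [h0, mul_zero, add_zero]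
        simp [Matrix.mulVec, dotProduct]

/-- The leading term of the estimation error is real: reversing the virtual array conjugates
it. -/
lemma star_alpha_daMatrix_beta (hinj : Function.Injective (S.vsteerMat Mv).mulVec) (k : Fin K)
    {C : Matrix (Fin M) (Fin M) ℂ} (hC : Cᴴ = C) :
    star (S.alpha Mv k ⬝ᵥ (daMatrix S.pos Mv C *ᵥ S.beta Mv k))
      = S.alpha Mv k ⬝ᵥ (daMatrix S.pos Mv C *ᵥ S.beta Mv k) := by
  simp only [dotProduct, Matrix.mulVec, Finset.mul_sum, star_sum]
  conv_rhs => rw [← Equiv.sum_comp Fin.revPerm]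
  refine Finset.sum_congr rfl fun a _ => ?_
  conv_rhs => rw [← Equiv.sum_comp Fin.revPerm]
  refine Finset.sum_congr rfl fun b _ => ?_
  simp only [Fin.revPerm_apply, daMatrix_rev hC, alpha_rev, S.beta_rev hinj, star_mul']
  have h := S.ratio_pow_mul_star (S.θ k) (Mv - 1)
  linear_combination (-(star (S.alpha Mv k a) * (star (daMatrix S.pos Mv C a b)
    * star (S.beta Mv k b)))) * h

end Reversal

end Model

/-! ### Null spectra of matrices near the noise projector -/

section NullForm

open scoped Matrix.Norms.Frobenius

/-- The Euclidean length of a complex vector. -/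
def l2 {m : ℕ} (v : Fin m → ℂ) : ℝ := Real.sqrt (∑ i, ‖v i‖ ^ 2)

lemma l2_nonneg {m : ℕ} (v : Fin m → ℂ) : 0 ≤ l2 v := Real.sqrt_nonneg _

lemma l2_sq {m : ℕ} (v : Fin m → ℂ) : l2 v ^ 2 = ∑ i, ‖v i‖ ^ 2 :=
  Real.sq_sqrt (by positivity)

lemma norm_dotProduct_mulVec_le {m n : ℕ} (x : Fin m → ℂ) (X : Matrix (Fin m) (Fin n) ℂ)
    (y : Fin n → ℂ) : ‖x ⬝ᵥ (X *ᵥ y)‖ ≤ ‖X‖ * (l2 x * l2 y) := by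
  have h1 : ‖x ⬝ᵥ (X *ᵥ y)‖ ≤ ∑ p : Fin m × Fin n, ‖X p.1 p.2‖ * (‖x p.1‖ * ‖y p.2‖) := by
    simp only [dotProduct, Matrix.mulVec, Finset.mul_sum, Fintype.sum_prod_type]
    refine (norm_sum_le _ _).trans (Finset.sum_le_sum fun i _ => ?_)
    refine (norm_sum_le _ _).trans (Finset.sum_le_sum fun j _ => ?_)
    rw [norm_mul, norm_mul]
    exact le_of_eq (by ring)
  refine h1.trans (abs_le_of_sq_le_sq ?_ ?_ |> (le_abs_self _).trans)
  · rw [mul_pow, mul_pow, l2_sq, l2_sq, Finset.sum_mul_sum, frobenius_sq_eq_sum,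
      ← Fintype.sum_prod_type', ← Fintype.sum_prod_type']
    refine (Finset.sum_mul_sq_le_sq_mul_sq _ _ _).trans (le_of_eq ?_)
    simp only [mul_pow]
  · exact mul_nonneg (norm_nonneg _) (mul_nonneg (l2_nonneg _) (l2_nonneg _))

lemma l2_star {m : ℕ} (v : Fin m → ℂ) : l2 (star v) = l2 v := by
  simp [l2]

lemma star_dotProduct_self {m : ℕ} (v : Fin m → ℂ) : star v ⬝ᵥ v = ((l2 v ^ 2 : ℝ) : ℂ) := by
  rw [l2_sq, Complex.ofReal_sum, dotProduct]
  refine Finset.sum_congr rfl fun i _ => ?_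
  rw [Pi.star_apply, Complex.star_def, mul_comm, Complex.mul_conj, Complex.normSq_eq_norm_sq]

/-- A Hermitian matrix within distance `σ` of `σ • 1 + B` is positive semidefinite if `B` is. -/
lemma posSemidef_of_norm_le {m : ℕ} {B E : Matrix (Fin m) (Fin m) ℂ} {σ : ℝ} (hB : B.PosSemidef)
    (hE : Eᴴ = E) (h : ‖E‖ ≤ σ) : ((σ : ℂ) • 1 + B + E).PosSemidef := by
  have h1 : ((σ : ℂ) • 1 + E : Matrix (Fin m) (Fin m) ℂ).PosSemidef := by
    have hherm : ((σ : ℂ) • 1 + E : Matrix (Fin m) (Fin m) ℂ).IsHermitian := by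
      rw [Matrix.IsHermitian, Matrix.conjTranspose_add, hE, Matrix.conjTranspose_smul,
        Matrix.conjTranspose_one, Complex.star_def, Complex.conj_ofReal]
    refine Matrix.PosSemidef.of_dotProduct_mulVec_nonneg hherm fun v => ?_
    have him : (star v ⬝ᵥ (((σ : ℂ) • 1 + E : Matrix (Fin m) (Fin m) ℂ) *ᵥ v)).im = 0 := by
      have hs : star (star v ⬝ᵥ (((σ : ℂ) • 1 + E : Matrix (Fin m) (Fin m) ℂ) *ᵥ v))
          = star v ⬝ᵥ (((σ : ℂ) • 1 + E : Matrix (Fin m) (Fin m) ℂ) *ᵥ v) := by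
        rw [← Matrix.star_dotProduct_star, star_star, Matrix.star_mulVec, hherm.eq,
          ← Matrix.dotProduct_mulVec]
      exact Complex.conj_eq_iff_im.1 hs
    have hre : 0 ≤ (star v ⬝ᵥ (((σ : ℂ) • 1 + E : Matrix (Fin m) (Fin m) ℂ) *ᵥ v)).re := by
      rw [Matrix.add_mulVec, Matrix.smul_mulVec, Matrix.one_mulVec, dotProduct_add,
        dotProduct_smul, star_dotProduct_self, smul_eq_mul, ← Complex.ofReal_mul,
        Complex.add_re, Complex.ofReal_re]
      have h2 := norm_dotProduct_mulVec_le (star v) E v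
      rw [l2_star] at h2
      have h3 := abs_le.1 (Complex.abs_re_le_norm (star v ⬝ᵥ (E *ᵥ v)))
      nlinarith [sq_nonneg (l2 v), mul_le_mul_of_nonneg_right h (sq_nonneg (l2 v))]
    exact Complex.nonneg_iff.2 ⟨hre, him.symm⟩
  have : (σ : ℂ) • 1 + B + E = B + ((σ : ℂ) • 1 + E) := by abel
  rw [this]
  exact hB.add h1

lemma norm_entry_le_frobenius {m n : ℕ} (X : Matrix (Fin m) (Fin n) ℂ) (i : Fin m) (j : Fin n) :
    ‖X i j‖ ≤ ‖X‖ := by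
  refine abs_le_of_sq_le_sq ?_ (norm_nonneg _) |> (le_abs_self _).trans
  rw [frobenius_sq_eq_sum]
  exact (Finset.single_le_sum (f := fun j => ‖X i j‖ ^ 2) (fun _ _ => by positivity)
    (Finset.mem_univ j)).trans (Finset.single_le_sum (f := fun i => ∑ j, ‖X i j‖ ^ 2)
      (fun _ _ => by positivity) (Finset.mem_univ i))

lemma frobenius_le {m : ℕ} {X : Matrix (Fin m) (Fin m) ℂ} {c : ℝ} (hc : 0 ≤ c)
    (h : ∀ i j, ‖X i j‖ ≤ c) : ‖X‖ ≤ m * c := by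
  refine abs_le_of_sq_le_sq ?_ (by positivity) |> (le_abs_self _).trans
  rw [frobenius_sq_eq_sum]
  calc ∑ i, ∑ j, ‖X i j‖ ^ 2 ≤ ∑ _i : Fin m, ∑ _j : Fin m, c ^ 2 := by
        gcongr with i _ j _
        exact h i j
    _ = (m * c) ^ 2 := by simp; ring

end NullForm

namespace Model

open scoped Matrix.Norms.Frobenius

variable {M K : ℕ} (S : Model M K)

lemma exists_norm_daMatrix_le (pos : Fin M → ℤ) (Mv : ℕ) :
    ∃ κ : ℝ, 0 ≤ κ ∧ ∀ C : Matrix (Fin M) (Fin M) ℂ, ‖daMatrix pos Mv C‖ ≤ κ * ‖C‖ := by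
  refine ⟨Mv * (M * M : ℕ), by positivity, fun C => ?_⟩
  rw [mul_assoc]
  refine frobenius_le (by positivity) fun a b => ?_
  rw [daMatrix_apply, coarrayAvg]
  refine (norm_sum_le _ _).trans ((Finset.sum_le_card_nsmul _ _ ‖C‖ fun qp _ => ?_).trans ?_)
  · rw [norm_mul]
    refine (mul_le_of_le_one_left (norm_nonneg _) ?_).trans (norm_entry_le_frobenius C _ _)
    split_ifs with h
    · rw [norm_div, norm_one, Complex.norm_natCast]
      rw [one_div]
      exact Nat.cast_inv_le_one _
    · simp
  · simp

/-- The null spectrum attached to a matrix `P` in place of the noise projector. -/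
def nullForm (Mv : ℕ) (P : Matrix (Fin Mv) (Fin Mv) ℂ) (t : ℝ) : ℝ :=
  (star (S.vsteer Mv t) ⬝ᵥ (P *ᵥ S.vsteer Mv t)).re

/-- The derivative of `nullForm` with respect to the direction. -/
def nullFormDeriv (Mv : ℕ) (P : Matrix (Fin Mv) (Fin Mv) ℂ) (t : ℝ) : ℝ :=
  (star (S.vsteerDeriv Mv t) ⬝ᵥ (P *ᵥ S.vsteer Mv t)
    + star (S.vsteer Mv t) ⬝ᵥ (P *ᵥ S.vsteerDeriv Mv t)).re

variable {Mv : ℕ}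

/-- First-order expansion of the noise projector and of the slope of the null spectrum in the
source directions, in terms of the error of the covariance matrix. -/
lemma exists_slope_expansion (hpos : Function.Injective S.pos)
    (hMv : ∀ l : ℤ, |l| < (Mv : ℤ) → ∃ m n : Fin M, S.pos m - S.pos n = l) (hK : K < Mv)
    (hp : ∀ k, 0 < S.p k) (hinj : Function.Injective (S.vsteerMat Mv).mulVec) :
    ∃ κ : ℝ, 0 ≤ κ ∧ ∀ (C : Matrix (Fin M) (Fin M) ℂ) (U : Matrix (Fin Mv) (Fin Mv) ℂ)
      (ev : Fin Mv → ℝ), IsEigendecomposition (daMatrix S.pos Mv C) U ev →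
      ‖noiseProj K U - projPerp (S.vsteerMat Mv)‖ ≤ κ * ‖C - S.cov‖ ∧
      ∀ k, |S.nullFormDeriv Mv (noiseProj K U) (S.θ k)
        - 2 * ((S.xi Mv k ⬝ᵥ (C - S.cov).vec).re / S.p k)| ≤ κ * ‖C - S.cov‖ ^ 2 := by
  set A := S.vsteerMat Mv with hA
  set Q := projPerp A with hQdef
  have hpA := pinv_mul_self hinj
  have hp' : ∀ k, (S.p k : ℂ) ≠ 0 := fun k => by exact_mod_cast (hp k).ne'
  -- `Cs` is a square root of the signal part of the covariance matrix of the virtual array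
  set Cs : Matrix (Fin K) (Fin Mv) ℂ :=
    Matrix.diagonal (fun k => ((Real.sqrt (S.p k) : ℝ) : ℂ)) * Aᴴ with hCs
  set G : Matrix (Fin Mv) (Fin Mv) ℂ :=
    (pinv A)ᴴ * Matrix.diagonal (fun k => (S.p k : ℂ)⁻¹) * pinv A with hG
  have hB : Csᴴ * Cs = A * Matrix.diagonal (fun k => (S.p k : ℂ)) * Aᴴ := by
    have h1 : (Matrix.diagonal fun k => ((Real.sqrt (S.p k) : ℝ) : ℂ))ᴴ *
        (Matrix.diagonal fun k => ((Real.sqrt (S.p k) : ℝ) : ℂ))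
        = Matrix.diagonal (fun k => (S.p k : ℂ)) := by
      rw [Matrix.diagonal_conjTranspose, Matrix.diagonal_mul_diagonal]
      congr 1
      funext k
      rw [Pi.star_apply, Complex.star_def, Complex.conj_ofReal, ← Complex.ofReal_mul,
        Real.mul_self_sqrt (hp k).le]
    rw [hCs, Matrix.conjTranspose_mul, Matrix.conjTranspose_conjTranspose, ← h1]
    simp only [Matrix.mul_assoc]
  have hCQ : Cs * Q = 0 := by
    rw [hCs, Matrix.mul_assoc, conjTranspose_mul_projPerp hinj, Matrix.mul_zero]
  have hGQ : G * Q = 0 := by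
    rw [hG, Matrix.mul_assoc, pinv_mul_projPerp hinj, Matrix.mul_zero]
  have hGB : G * (Csᴴ * Cs) = 1 - Q := by
    rw [hB, hG]
    calc (pinv A)ᴴ * Matrix.diagonal (fun k => (S.p k : ℂ)⁻¹) * pinv A *
          (A * Matrix.diagonal (fun k => (S.p k : ℂ)) * Aᴴ)
        = (pinv A)ᴴ * (Matrix.diagonal (fun k => (S.p k : ℂ)⁻¹) * ((pinv A * A) *
            Matrix.diagonal (fun k => (S.p k : ℂ)))) * Aᴴ := by simp only [Matrix.mul_assoc]
      _ = (A * pinv A)ᴴ := by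
          rw [hpA, Matrix.one_mul, Matrix.diagonal_mul_diagonal, Matrix.conjTranspose_mul]
          simp [hp']
      _ = 1 - Q := by rw [conjTranspose_mul_pinv, hQdef, projPerp]; abel
  obtain ⟨κ₁, hκ₁, hmain⟩ := exists_noiseProj_perturbation Cs Q G (S.noiseVar : ℂ)
    projPerp_isHermitian (projPerp_mul_self hinj) hCQ hGQ hGB
  obtain ⟨κ₂, hκ₂, hda⟩ := exists_norm_daMatrix_le S.pos Mv
  -- the slope bound, one source at a time
  set L : ℝ := ∑ k, l2 (S.vsteer Mv (S.θ k)) * l2 (S.vsteerDeriv Mv (S.θ k)) with hL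
  have hLk : ∀ k, l2 (S.vsteer Mv (S.θ k)) * l2 (S.vsteerDeriv Mv (S.θ k)) ≤ L := fun k =>
    Finset.single_le_sum
      (f := fun k => l2 (S.vsteer Mv (S.θ k)) * l2 (S.vsteerDeriv Mv (S.θ k)))
      (fun j _ => mul_nonneg (l2_nonneg _) (l2_nonneg _)) (Finset.mem_univ k)
  have hL0 : 0 ≤ L := Finset.sum_nonneg fun j _ => mul_nonneg (l2_nonneg _) (l2_nonneg _)
  refine ⟨κ₁ * κ₂ + 2 * (κ₁ * κ₂ ^ 2 * L), by positivity, ?_⟩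
  intro C U ev hU
  set E := daMatrix S.pos Mv (C - S.cov) with hE
  set P := noiseProj K U with hP
  have hEn : ‖E‖ ≤ κ₂ * ‖C - S.cov‖ := hda _
  have hH : daMatrix S.pos Mv C = (S.noiseVar : ℂ) • 1 + Csᴴ * Cs + E := by
    rw [hB, ← S.daMatrix_cov hpos hMv, hE, daMatrix_sub]
    abel
  have hPH : Pᴴ = P := noiseProj_isHermitian
  rw [hH] at hU
  have htrQ : Q.trace = (Mv : ℂ) - K := trace_projPerp hinj
  obtain ⟨h1, h2⟩ := hmain E P hPH (noiseProj_mul_self hU.unitary)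
    ((trace_noiseProj hU.unitary hK.le).trans htrQ.symm) (noiseProj_commute hU)
    (kyFan hU hK.le projPerp_isHermitian (projPerp_mul_self hinj) htrQ)
  have hn0 : 0 ≤ ‖C - S.cov‖ := norm_nonneg _
  constructor
  · calc ‖P - Q‖ ≤ κ₁ * ‖E‖ := h1
      _ ≤ κ₁ * (κ₂ * ‖C - S.cov‖) := by gcongr
      _ ≤ _ := by
        have : 0 ≤ 2 * (κ₁ * κ₂ ^ 2 * L) * ‖C - S.cov‖ := by positivity
        linarith
  · intro k
    set x := S.vsteer Mv (S.θ k) with hx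
    set y := S.vsteerDeriv Mv (S.θ k) with hy
    have hxA : x = A *ᵥ Pi.single k 1 := by
      rw [Matrix.mulVec_single_one]; rfl
    have hQx : Q *ᵥ x = 0 := by
      rw [hxA, Matrix.mulVec_mulVec, projPerp_mul hinj, Matrix.zero_mulVec]
    have hpx : pinv A *ᵥ x = Pi.single k 1 := by
      rw [hxA, Matrix.mulVec_mulVec, hpA, Matrix.one_mulVec]
    have hleft : star x ⬝ᵥ (((1 - Q) * P) *ᵥ y) = star x ⬝ᵥ (P *ᵥ y) := by
      have h3 : star x ᵥ* Q = 0 := by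
        have : star x ᵥ* Q = star (Q *ᵥ x) := by rw [Matrix.star_mulVec, projPerp_isHermitian]
        rw [this, hQx, star_zero]
      rw [← Matrix.mulVec_mulVec, Matrix.dotProduct_mulVec, Matrix.vecMul_sub, h3, sub_zero,
        Matrix.vecMul_one]
    have hright : star x ⬝ᵥ ((G * E * Q) *ᵥ y)
        = -((S.xi Mv k ⬝ᵥ (C - S.cov).vec) / (S.p k : ℂ)) := by
      have h4 : star x ᵥ* (pinv A)ᴴ = Pi.single k 1 := by
        rw [← Matrix.star_mulVec, hpx, ← Pi.single_star, star_one]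
      have h5 : (G * E * Q) *ᵥ y = (pinv A)ᴴ *ᵥ (Matrix.diagonal (fun k => (S.p k : ℂ)⁻¹) *ᵥ
          (pinv A *ᵥ (E *ᵥ S.beta Mv k))) := by
        rw [beta, hG, ← hA, ← hQdef, ← hy]
        simp only [Matrix.mulVec_mulVec, Matrix.mul_assoc]
      rw [h5, Matrix.dotProduct_mulVec, h4, single_one_dotProduct, Matrix.mulVec_diagonal,
        xi_dotProduct_vec, ← hE]
      have h6 : S.alpha Mv k ⬝ᵥ (E *ᵥ S.beta Mv k) = -((pinv A *ᵥ (E *ᵥ S.beta Mv k)) k) := by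
        conv_rhs => rw [Matrix.mulVec]
        rw [← neg_dotProduct]
        rfl
      rw [h6]
      ring
    have hsum : star x ⬝ᵥ (((1 - Q) * P + G * E * Q) *ᵥ y)
        = star x ⬝ᵥ (P *ᵥ y) - (S.xi Mv k ⬝ᵥ (C - S.cov).vec) / (S.p k : ℂ) := by
      rw [Matrix.add_mulVec, dotProduct_add, hleft, hright]
      ring
    have hbound : ‖star x ⬝ᵥ (P *ᵥ y) - (S.xi Mv k ⬝ᵥ (C - S.cov).vec) / (S.p k : ℂ)‖
        ≤ κ₁ * κ₂ ^ 2 * L * ‖C - S.cov‖ ^ 2 := by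
      rw [← hsum]
      refine (norm_dotProduct_mulVec_le _ _ _).trans ?_
      rw [l2_star]
      calc ‖(1 - Q) * P + G * E * Q‖ * (l2 x * l2 y) ≤ (κ₁ * ‖E‖ ^ 2) * L := by
            apply mul_le_mul h2 (hLk k) (mul_nonneg (l2_nonneg _) (l2_nonneg _)) (by positivity)
        _ ≤ (κ₁ * (κ₂ * ‖C - S.cov‖) ^ 2) * L := by gcongr
        _ = _ := by ring
    have hderiv : S.nullFormDeriv Mv P (S.θ k) = 2 * (star x ⬝ᵥ (P *ᵥ y)).re := by
      have h7 : star y ⬝ᵥ (P *ᵥ x) = star (star x ⬝ᵥ (P *ᵥ y)) := by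
        rw [← Matrix.star_dotProduct_star, star_star, Matrix.star_mulVec, hPH,
          ← Matrix.dotProduct_mulVec]
      rw [nullFormDeriv, ← hx, ← hy, h7, Complex.add_re, Complex.star_def, Complex.conj_re]
      ring
    have hre := (Complex.abs_re_le_norm _).trans hbound
    rw [Complex.sub_re, Complex.div_ofReal_re] at hre
    rw [hderiv, ← mul_sub, abs_mul, abs_two]
    have : 0 ≤ κ₁ * κ₂ * ‖C - S.cov‖ ^ 2 := by positivity
    linarith

/-- Near the true covariance matrix, spatial smoothing yields the estimates of direct
augmentation. -/
lemma exists_isMusicEstimate_of_ssMatrix (hpos : Function.Injective S.pos)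
    (hMv : ∀ l : ℤ, |l| < (Mv : ℤ) → ∃ m n : Fin M, S.pos m - S.pos n = l) (hK : K < Mv)
    (hp : ∀ k, 0 < S.p k) (hσ : 0 < S.noiseVar) :
    ∃ δ : ℝ, 0 < δ ∧ ∀ C : Matrix (Fin M) (Fin M) ℂ, Cᴴ = C → ‖C - S.cov‖ ≤ δ →
      ∀ est : Fin K → ℝ, IsMusicEstimate (S.vsteer Mv) S.θ (ssMatrix S.pos Mv C) est →
        IsMusicEstimate (S.vsteer Mv) S.θ (daMatrix S.pos Mv C) est := by
  obtain ⟨κ, hκ, hda⟩ := exists_norm_daMatrix_le S.pos Mv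
  refine ⟨S.noiseVar / (κ + 1), by positivity, ?_⟩
  rintro C hC hle est ⟨hIcc, U, ev, hU, hest⟩
  refine ⟨hIcc, U, _, IsEigendecomposition.of_smul_mul_self (ev := ev) (c := 1 / (Mv : ℝ)) ?_ ?_ ?_, hest⟩
  · have : 0 < Mv := by omega
    positivity
  · have h : daMatrix S.pos Mv C = (S.noiseVar : ℂ) • 1
        + S.vsteerMat Mv * Matrix.diagonal (fun k => (S.p k : ℂ)) * (S.vsteerMat Mv)ᴴ
        + daMatrix S.pos Mv (C - S.cov) := by
      rw [← S.daMatrix_cov hpos hMv, daMatrix_sub]; abel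
    rw [h]
    apply posSemidef_of_norm_le
    · apply Matrix.PosSemidef.mul_mul_conjTranspose_same
      rw [Matrix.posSemidef_diagonal_iff]
      intro k
      exact_mod_cast (hp k).le
    · apply daMatrix_isHermitian
      rw [Matrix.conjTranspose_sub, hC, cov_isHermitian]
    · calc ‖daMatrix S.pos Mv (C - S.cov)‖ ≤ κ * ‖C - S.cov‖ := hda _
        _ ≤ (κ + 1) * (S.noiseVar / (κ + 1)) := by gcongr; linarith
        _ = S.noiseVar := by field_simp
  · rwa [ssMatrix_eq hC] at hU

end Model

/-! ### Selecting the local minima next to the sources -/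

/-- A permutation that preserves the order of an injective labelling by real numbers is the
identity. -/
lemma eq_of_lt_imp_lt {ι : Type*} [Finite ι] {θ : ι → ℝ} (hθ : Function.Injective θ) {σ : ι → ι}
    (hσ : ∀ k l, θ k < θ l → θ (σ k) < θ (σ l)) (k : ι) : σ k = k := by
  let _ : LinearOrder ι := LinearOrder.lift' θ hθ
  have hmono : StrictMono σ := fun k l hkl => hσ k l hkl
  exact le_antisymm hmono.apply_le hmono.le_apply

/-- If `f` is small at the points `θ k`, large away from them, and has at most one local minimum
near each of them, then the smallest `K` local minima lie near the `θ k`, in the same order. -/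
lemma near_of_smallest_localMinima {K : ℕ} {θ est : Fin K → ℝ} {f : ℝ → ℝ} {r c : ℝ}
    (hθ : Function.Injective θ) (hr : 0 < r)
    (hsub : ∀ k, Set.Icc (θ k - r) (θ k + r) ⊆ Set.Ioo (-(Real.pi / 2)) (Real.pi / 2))
    (hsep : ∀ j k, j ≠ k → 2 * r < |θ j - θ k|) (hf : Continuous f) (hlow : ∀ k, f (θ k) < c)
    (hhigh : ∀ t ∈ Set.Icc (-(Real.pi / 2)) (Real.pi / 2), (∀ k, r ≤ |t - θ k|) → c ≤ f t)
    (huniq : ∀ k s t, |s - θ k| < r → |t - θ k| < r → IsLocalMin f s → IsLocalMin f t → s = t)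
    (hest : (K : ℕ∞) ≤ (localMinima f).encard → Function.Injective est ∧
      (∀ k, est k ∈ localMinima f) ∧
      (∀ s ∈ localMinima f, s ∉ Set.range est → ∀ k, f (est k) ≤ f s) ∧
      (∀ k l, θ k < θ l → est k < est l)) (k : Fin K) :
    |est k - θ k| < r ∧ IsLocalMin f (est k) := by
  -- a local minimum with a small value next to each source
  have hmin : ∀ k, ∃ s, |s - θ k| < r ∧ s ∈ localMinima f ∧ f s < c := by
    intro k
    obtain ⟨s, hs, hsmin⟩ := isCompact_Icc.exists_isMinOn
      (Set.nonempty_Icc.2 (by linarith : θ k - r ≤ θ k + r)) hf.continuousOn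
    have hsc : f s < c := lt_of_le_of_lt
      (hsmin (show θ k ∈ Set.Icc (θ k - r) (θ k + r) from ⟨by linarith, by linarith⟩)) (hlow k)
    have hle : |s - θ k| ≤ r := by rw [abs_le]; constructor <;> linarith [hs.1, hs.2]
    have hlt : |s - θ k| < r := by
      refine lt_of_le_of_ne hle fun heq => ?_
      refine absurd (hhigh s (Set.Ioo_subset_Icc_self (hsub k hs)) fun j => ?_) (not_le.2 hsc)
      rcases eq_or_ne j k with rfl | hjk
      · exact heq.ge
      · have h1 := hsep j k hjk
        have h2 : |θ j - θ k| ≤ |s - θ j| + |s - θ k| := by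
          have := abs_sub_le (θ j) s (θ k)
          rwa [abs_sub_comm (θ j) s] at this
        linarith
    refine ⟨s, hlt, ⟨hsub k hs, ?_⟩, hsc⟩
    rw [abs_lt] at hlt
    exact hsmin.isLocalMin (Icc_mem_nhds (by linarith) (by linarith))
  choose m hmr hmmin hmc using hmin
  have hdisj : ∀ {s j k}, |s - θ j| < r → |s - θ k| < r → j = k := by
    intro s j k hj hk
    by_contra hne
    have h1 := hsep j k hne
    have h2 := abs_sub_le (θ j) s (θ k)
    rw [abs_sub_comm (θ j) s] at h2
    linarith
  have hminj : Function.Injective m := fun j k hjk => hdisj (hmr j) (hjk ▸ hmr k)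
  have hcard : (K : ℕ∞) ≤ (localMinima f).encard := by
    have h1 : Set.range m ⊆ localMinima f := by
      rintro _ ⟨k, rfl⟩; exact hmmin k
    refine le_trans (le_of_eq ?_) (Set.encard_le_encard h1)
    rw [← Set.image_univ, hminj.encard_image, Set.encard_univ]
    simp
  obtain ⟨hinj, hloc, hsmall, hord⟩ := hest hcard
  have hnear : ∀ k, ∃ j, |est k - θ j| < r := by
    intro k
    by_contra hcon
    push Not at hcon
    have hbig : c ≤ f (est k) := hhigh _ (Set.Ioo_subset_Icc_self (hloc k).1) hcon
    have hsubset : Finset.univ.image m ⊆ Finset.univ.image est := by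
      intro s hs
      obtain ⟨j, -, rfl⟩ := Finset.mem_image.1 hs
      by_contra hmem
      have hmem' : m j ∉ Set.range est := by
        rintro ⟨i, hi⟩
        exact hmem (Finset.mem_image.2 ⟨i, Finset.mem_univ i, hi⟩)
      have := hsmall (m j) (hmmin j) hmem' k
      linarith [hmc j]
    have heq := Finset.eq_of_subset_of_card_le hsubset (by
      rw [Finset.card_image_of_injective _ hinj, Finset.card_image_of_injective _ hminj])
    have hk : est k ∈ Finset.univ.image m := by
      rw [heq]; exact Finset.mem_image_of_mem _ (Finset.mem_univ k)
    obtain ⟨j, -, hj⟩ := Finset.mem_image.1 hk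
    rw [← hj] at hbig
    linarith [hmc j]
  choose σ hσ using hnear
  have hσmono : ∀ k l, θ k < θ l → θ (σ k) < θ (σ l) := by
    intro k l hkl
    have hlt := hord k l hkl
    have hne : σ k ≠ σ l := fun h => hlt.ne
      (huniq (σ k) _ _ (hσ k) (h ▸ hσ l) (hloc k).2 (hloc l).2)
    by_contra hcon
    have h1 := hsep (σ k) (σ l) hne
    rw [abs_of_nonneg (by linarith)] at h1
    have h2 := abs_lt.1 (hσ k)
    have h3 := abs_lt.1 (hσ l)
    linarith
  have hid := eq_of_lt_imp_lt hθ hσmono k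
  exact ⟨by simpa only [hid] using hσ k, (hloc k).2⟩

/-! ### Derivatives of the null spectrum -/

lemma hasDerivAt_dotProduct_mulVec {m : ℕ} (P : Matrix (Fin m) (Fin m) ℂ) {x y : ℝ → Fin m → ℂ}
    {x' y' : Fin m → ℂ} {t : ℝ} (hx : ∀ i, HasDerivAt (fun s => x s i) (x' i) t)
    (hy : ∀ i, HasDerivAt (fun s => y s i) (y' i) t) :
    HasDerivAt (fun s => star (x s) ⬝ᵥ (P *ᵥ y s))
      (star x' ⬝ᵥ (P *ᵥ y t) + star (x t) ⬝ᵥ (P *ᵥ y')) t := by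
  simp only [dotProduct, Matrix.mulVec, ← Finset.sum_add_distrib, Pi.star_apply]
  refine HasDerivAt.fun_sum fun i _ => ?_
  refine (hx i).star.mul ?_
  exact HasDerivAt.fun_sum fun j _ => (hy j).const_mul _

namespace Model

open scoped Matrix.Norms.Frobenius

variable {M K : ℕ} (S : Model M K) {Mv : ℕ}

/-- The second derivative of the virtual steering vector. -/
def vsteerDeriv2 (Mv : ℕ) (t : ℝ) : Fin Mv → ℂ := fun m =>
  (Complex.I * ((m : ℕ) : ℂ) * ((2 * Real.pi * S.d₀ * (-Real.sin t) / S.lam : ℝ) : ℂ)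
    + (Complex.I * ((m : ℕ) : ℂ) * S.phaseDeriv t) ^ 2) * S.vsteer Mv t m

lemma hasDerivAt_vsteerDeriv (t : ℝ) (m : Fin Mv) :
    HasDerivAt (fun s : ℝ => S.vsteerDeriv Mv s m) (S.vsteerDeriv2 Mv t m) t := by
  simp only [vsteerDeriv_eq]
  have h1 : HasDerivAt S.phaseDeriv (2 * Real.pi * S.d₀ * (-Real.sin t) / S.lam) t :=
    ((Real.hasDerivAt_cos t).const_mul _).div_const _
  convert! (h1.ofReal_comp.const_mul (Complex.I * ((m : ℕ) : ℂ))).mul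
    (S.hasDerivAt_vsteer Mv t m) using 1
  rw [vsteerDeriv2]
  ring

lemma hasDerivAt_vsteer' (t : ℝ) (m : Fin Mv) :
    HasDerivAt (fun s : ℝ => S.vsteer Mv s m) (S.vsteerDeriv Mv t m) t := by
  rw [vsteerDeriv_eq]
  exact S.hasDerivAt_vsteer Mv t m

/-- The second derivative of `nullForm` with respect to the direction. -/
def nullFormDeriv2 (Mv : ℕ) (P : Matrix (Fin Mv) (Fin Mv) ℂ) (t : ℝ) : ℝ :=
  ((star (S.vsteerDeriv2 Mv t) ⬝ᵥ (P *ᵥ S.vsteer Mv t)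
      + star (S.vsteerDeriv Mv t) ⬝ᵥ (P *ᵥ S.vsteerDeriv Mv t))
    + (star (S.vsteerDeriv Mv t) ⬝ᵥ (P *ᵥ S.vsteerDeriv Mv t)
      + star (S.vsteer Mv t) ⬝ᵥ (P *ᵥ S.vsteerDeriv2 Mv t))).re

lemma hasDerivAt_nullForm (P : Matrix (Fin Mv) (Fin Mv) ℂ) (t : ℝ) :
    HasDerivAt (S.nullForm Mv P) (S.nullFormDeriv Mv P t) t :=
  (Complex.reCLM.hasFDerivAt.comp_hasDerivAt t (hasDerivAt_dotProduct_mulVec P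
    (S.hasDerivAt_vsteer' t) (S.hasDerivAt_vsteer' t)))

lemma hasDerivAt_nullFormDeriv (P : Matrix (Fin Mv) (Fin Mv) ℂ) (t : ℝ) :
    HasDerivAt (S.nullFormDeriv Mv P) (S.nullFormDeriv2 Mv P t) t :=
  (Complex.reCLM.hasFDerivAt.comp_hasDerivAt t
    ((hasDerivAt_dotProduct_mulVec P (S.hasDerivAt_vsteerDeriv t) (S.hasDerivAt_vsteer' t)).add
      (hasDerivAt_dotProduct_mulVec P (S.hasDerivAt_vsteer' t) (S.hasDerivAt_vsteerDeriv t))))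

lemma continuous_vsteer : Continuous (S.vsteer Mv) :=
  continuous_pi fun m => continuous_iff_continuousAt.2 fun t =>
    (S.hasDerivAt_vsteer' t m).continuousAt

lemma continuous_vsteerDeriv : Continuous (S.vsteerDeriv Mv) :=
  continuous_pi fun m => continuous_iff_continuousAt.2 fun t =>
    (S.hasDerivAt_vsteerDeriv t m).continuousAt

lemma continuous_vsteerDeriv2 : Continuous (S.vsteerDeriv2 Mv) := by
  refine continuous_pi fun m => ?_
  have h1 : Continuous fun t => S.vsteer Mv t m := (continuous_apply m).comp S.continuous_vsteer
  have h2 : Continuous S.phaseDeriv := by unfold phaseDeriv; fun_prop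
  unfold vsteerDeriv2
  fun_prop

lemma continuous_dotProduct_mulVec (P : Matrix (Fin Mv) (Fin Mv) ℂ) {x y : ℝ → Fin Mv → ℂ}
    (hx : Continuous x) (hy : Continuous y) : Continuous fun t => star (x t) ⬝ᵥ (P *ᵥ y t) := by
  have hx' : ∀ i, Continuous fun t => x t i := fun i => (continuous_apply i).comp hx
  have hy' : ∀ i, Continuous fun t => y t i := fun i => (continuous_apply i).comp hy
  simp only [dotProduct, Matrix.mulVec, Pi.star_apply]
  fun_prop

lemma continuous_nullForm (P : Matrix (Fin Mv) (Fin Mv) ℂ) : Continuous (S.nullForm Mv P) :=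
  continuous_iff_continuousAt.2 fun t => (S.hasDerivAt_nullForm P t).continuousAt

lemma continuous_nullFormDeriv2 (P : Matrix (Fin Mv) (Fin Mv) ℂ) :
    Continuous (S.nullFormDeriv2 Mv P) := by
  have h0 := S.continuous_vsteer (Mv := Mv)
  have h1 := S.continuous_vsteerDeriv (Mv := Mv)
  have h2 := S.continuous_vsteerDeriv2 (Mv := Mv)
  exact Complex.continuous_re.comp
    (((continuous_dotProduct_mulVec P h2 h0).add (continuous_dotProduct_mulVec P h1 h1)).add
      ((continuous_dotProduct_mulVec P h1 h1).add (continuous_dotProduct_mulVec P h0 h2)))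

lemma nullForm_sub (P Q : Matrix (Fin Mv) (Fin Mv) ℂ) (t : ℝ) :
    S.nullForm Mv (P - Q) t = S.nullForm Mv P t - S.nullForm Mv Q t := by
  simp only [nullForm, Matrix.sub_mulVec, dotProduct_sub, Complex.sub_re]

lemma nullFormDeriv2_sub (P Q : Matrix (Fin Mv) (Fin Mv) ℂ) (t : ℝ) :
    S.nullFormDeriv2 Mv (P - Q) t = S.nullFormDeriv2 Mv P t - S.nullFormDeriv2 Mv Q t := by
  simp only [nullFormDeriv2, Matrix.sub_mulVec, dotProduct_sub, Complex.sub_re, Complex.add_re]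
  ring

lemma continuous_l2 {x : ℝ → Fin Mv → ℂ} (hx : Continuous x) : Continuous fun t => l2 (x t) := by
  have hx' : ∀ i, Continuous fun t => x t i := fun i => (continuous_apply i).comp hx
  unfold l2
  fun_prop

lemma exists_l2_bound {x : ℝ → Fin Mv → ℂ} (hx : Continuous x) :
    ∃ L : ℝ, 0 ≤ L ∧ ∀ t ∈ Set.Icc (-(Real.pi / 2)) (Real.pi / 2), l2 (x t) ≤ L := by
  obtain ⟨L, hL⟩ := (isCompact_Icc (a := -(Real.pi / 2)) (b := Real.pi / 2)).exists_bound_of_continuousOn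
    (continuous_l2 hx).continuousOn
  refine ⟨max L 0, le_max_right _ _, fun t ht => ?_⟩
  exact ((le_abs_self _).trans (hL t ht)).trans (le_max_left _ _)

/-- The null form and its second derivative depend on the matrix in a uniformly Lipschitz way. -/
lemma exists_nullForm_bound (Mv : ℕ) : ∃ κ : ℝ, 0 ≤ κ ∧ ∀ (X : Matrix (Fin Mv) (Fin Mv) ℂ),
    ∀ t ∈ Set.Icc (-(Real.pi / 2)) (Real.pi / 2),
      |S.nullForm Mv X t| ≤ κ * ‖X‖ ∧ |S.nullFormDeriv2 Mv X t| ≤ κ * ‖X‖ := by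
  obtain ⟨L₀, hL₀, h0⟩ := exists_l2_bound (S.continuous_vsteer (Mv := Mv))
  obtain ⟨L₁, hL₁, h1⟩ := exists_l2_bound (S.continuous_vsteerDeriv (Mv := Mv))
  obtain ⟨L₂, hL₂, h2⟩ := exists_l2_bound (S.continuous_vsteerDeriv2 (Mv := Mv))
  refine ⟨L₀ * L₀ + (2 * (L₀ * L₂) + 2 * (L₁ * L₁)), by positivity, fun X t ht => ?_⟩
  have key : ∀ {x y : Fin Mv → ℂ} {a b : ℝ}, 0 ≤ a → l2 x ≤ a → l2 y ≤ b →
      ‖star x ⬝ᵥ (X *ᵥ y)‖ ≤ (a * b) * ‖X‖ := by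
    intro x y a b ha hx hy
    refine (norm_dotProduct_mulVec_le _ _ _).trans ?_
    rw [l2_star, mul_comm]
    exact mul_le_mul_of_nonneg_right (mul_le_mul hx hy (l2_nonneg _) ha) (norm_nonneg _)
  have hX := norm_nonneg X
  have k00 := key hL₀ (h0 t ht) (h0 t ht)
  have k20 := key hL₂ (h2 t ht) (h0 t ht)
  have k11 := key hL₁ (h1 t ht) (h1 t ht)
  have k02 := key hL₀ (h0 t ht) (h2 t ht)
  have p1 : 0 ≤ L₀ * L₂ * ‖X‖ := by positivity
  have p2 : 0 ≤ L₁ * L₁ * ‖X‖ := by positivity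
  have p3 : 0 ≤ L₀ * L₀ * ‖X‖ := by positivity
  constructor
  · refine (Complex.abs_re_le_norm _).trans (k00.trans ?_)
    linarith
  · refine (Complex.abs_re_le_norm _).trans ?_
    refine (norm_add_le _ _).trans ((add_le_add (norm_add_le _ _) (norm_add_le _ _)).trans ?_)
    linarith

section Source

variable (hinj : Function.Injective (S.vsteerMat Mv).mulVec)
include hinj

lemma projPerp_mulVec_vsteer (k : Fin K) :
    projPerp (S.vsteerMat Mv) *ᵥ S.vsteer Mv (S.θ k) = 0 := by
  have h : S.vsteer Mv (S.θ k) = S.vsteerMat Mv *ᵥ Pi.single k 1 := by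
    rw [Matrix.mulVec_single_one]; rfl
  rw [h, Matrix.mulVec_mulVec, projPerp_mul hinj, Matrix.zero_mulVec]

lemma nullForm_projPerp_source (k : Fin K) :
    S.nullForm Mv (projPerp (S.vsteerMat Mv)) (S.θ k) = 0 := by
  rw [nullForm, S.projPerp_mulVec_vsteer hinj, dotProduct_zero, Complex.zero_re]

/-- The curvature of the true null spectrum in the direction of a source. -/
lemma nullFormDeriv2_projPerp_source (k : Fin K) :
    S.nullFormDeriv2 Mv (projPerp (S.vsteerMat Mv)) (S.θ k) = 2 * S.gamma Mv k := by
  have h : ∀ v, star (S.vsteer Mv (S.θ k)) ⬝ᵥ (projPerp (S.vsteerMat Mv) *ᵥ v) = 0 := by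
    intro v
    rw [Matrix.dotProduct_mulVec]
    have : star (S.vsteer Mv (S.θ k)) ᵥ* projPerp (S.vsteerMat Mv)
        = star (projPerp (S.vsteerMat Mv) *ᵥ S.vsteer Mv (S.θ k)) := by
      rw [Matrix.star_mulVec, projPerp_isHermitian]
    rw [this, S.projPerp_mulVec_vsteer hinj, star_zero, zero_dotProduct]
  rw [nullFormDeriv2, S.projPerp_mulVec_vsteer hinj, h, dotProduct_zero, gamma]
  simp only [zero_add, add_zero, Complex.add_re]
  ring

end Source

end Model

/-! ### First-order expansion of the estimates -/

open scoped Topology in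
lemma exists_pos_of_eventually {ι : Type*} [Finite ι] {p : ι → ℝ → Prop}
    (h : ∀ i, ∀ᶠ x in 𝓝[>] (0 : ℝ), p i x) : ∃ x, 0 < x ∧ ∀ i, p i x := by
  have h1 := (Filter.eventually_all.2 h).and self_mem_nhdsWithin
  obtain ⟨x, hx, hpos⟩ := h1.exists
  exact ⟨x, hpos, hx⟩

open scoped Topology in
lemma eventually_mul_le_of_pos (c : ℝ) {b : ℝ} (hb : 0 < b) :
    ∀ᶠ x in 𝓝[>] (0 : ℝ), c * x ≤ b := by
  have h : Tendsto (fun x : ℝ => c * x) (𝓝 0) (𝓝 (c * 0)) := tendsto_id.const_mul c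
  rw [mul_zero] at h
  exact (h.eventually (Iic_mem_nhds hb)).filter_mono nhdsWithin_le_nhds

/-- The Newton step: `e` solves `e * g = -F`, where the slope `F` is close to `2 * w` and the mean
curvature `g` is close to `2 * γ`. -/
lemma abs_newton_step_le {e g F w γ κ κw ε n δ η : ℝ} (hγ : 0 < γ) (hg : |g - 2 * γ| ≤ ε)
    (hεγ : ε ≤ γ) (heq : e * g = -F) (hF : |F - 2 * w| ≤ κ * n ^ 2) (hw : |w| ≤ κw * n)
    (hκ : 0 ≤ κ) (hn : 0 ≤ n) (hnδ : n ≤ δ) (hδ : κ / γ * δ ≤ η / 2)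
    (hε : κw / γ ^ 2 * ε ≤ η / 2) : |e + w / γ| ≤ η * n := by
  have hg1 : γ ≤ g := by linarith [(abs_le.1 hg).1]
  have hg0 : 0 < g := hγ.trans_le hg1
  have h1 : e + w / γ = (-(F - 2 * w) + (g - 2 * γ) * (w / γ)) / g := by
    rw [eq_div_iff hg0.ne', add_mul, heq]
    field_simp
    ring
  have h2 : |(g - 2 * γ) * (w / γ)| ≤ ε * (κw * n / γ) := by
    rw [abs_mul, abs_div, abs_of_pos hγ]
    have h0 : 0 ≤ ε := (abs_nonneg _).trans hg
    gcongr
  have h3 : |-(F - 2 * w) + (g - 2 * γ) * (w / γ)| ≤ κ * n ^ 2 + ε * (κw * n / γ) :=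
    (abs_add_le _ _).trans (by rw [abs_neg]; exact add_le_add hF h2)
  have h4 : κ * n ^ 2 ≤ γ * (η / 2) * n := by
    have : κ * n ≤ γ * (η / 2) := by
      calc κ * n ≤ κ * δ := by gcongr
        _ = γ * (κ / γ * δ) := by field_simp
        _ ≤ γ * (η / 2) := by gcongr
    calc κ * n ^ 2 = (κ * n) * n := by ring
      _ ≤ _ := by gcongr
  have h5 : ε * (κw * n / γ) ≤ γ * (η / 2) * n := by
    calc ε * (κw * n / γ) = γ * (κw / γ ^ 2 * ε) * n := by field_simp
      _ ≤ _ := by gcongr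
  rw [h1, abs_div, abs_of_pos hg0, div_le_iff₀ hg0]
  have hη : 0 ≤ η * n := by
    have : 0 ≤ γ * (η / 2) * n := le_trans (by positivity) h4
    have h6 : 0 ≤ γ * (η * n) := by linarith
    exact nonneg_of_mul_nonneg_right h6 hγ
  calc |-(F - 2 * w) + (g - 2 * γ) * (w / γ)| ≤ γ * (η / 2) * n + γ * (η / 2) * n := by linarith
    _ = η * n * γ := by ring
    _ ≤ η * n * g := by gcongr

namespace Model

open scoped Matrix.Norms.Frobenius Topology

variable {M K : ℕ} (S : Model M K) {Mv : ℕ}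

lemma exists_xi_bound (Mv : ℕ) (k : Fin K) : ∃ κ : ℝ, 0 ≤ κ ∧
    ∀ C : Matrix (Fin M) (Fin M) ℂ, |(S.xi Mv k ⬝ᵥ C.vec).re| ≤ κ * ‖C‖ := by
  refine ⟨∑ qp, ‖S.xi Mv k qp‖, by positivity, fun C => ?_⟩
  refine (Complex.abs_re_le_norm _).trans ((norm_sum_le _ _).trans ?_)
  rw [Finset.sum_mul]
  refine Finset.sum_le_sum fun qp _ => ?_
  rw [norm_mul]
  exact mul_le_mul_of_nonneg_left (norm_entry_le_frobenius C _ _) (norm_nonneg _)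

/-- If the sample covariance matrix is close to the true one, then the estimates of MUSIC are well
defined and agree to first order with the true directions plus a linear functional of the error of
the covariance matrix. -/
lemma exists_estimate_expansion
    (hd₀ : 0 < S.d₀) (hlam : 0 < S.lam) (hhalf : S.d₀ ≤ S.lam / 2)
    (hpos : Function.Injective S.pos)
    (hMv : ∀ l : ℤ, |l| < (Mv : ℤ) → ∃ m n : Fin M, S.pos m - S.pos n = l)
    (hK : K < Mv)
    (hθ : ∀ k, S.θ k ∈ Set.Ioo (-(Real.pi / 2)) (Real.pi / 2))
    (hθinj : Function.Injective S.θ)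
    (hp : ∀ k, 0 < S.p k) (hσ : 0 < S.noiseVar) {η : ℝ} (hη : 0 < η) :
    ∃ δ : ℝ, 0 < δ ∧ ∀ C : Matrix (Fin M) (Fin M) ℂ, Cᴴ = C → ‖C - S.cov‖ ≤ δ →
      ∀ est : Fin K → ℝ, (IsMusicEstimate (S.vsteer Mv) S.θ (daMatrix S.pos Mv C) est ∨
        IsMusicEstimate (S.vsteer Mv) S.θ (ssMatrix S.pos Mv C) est) → ∀ k,
        |est k - S.θ k + (S.xi Mv k ⬝ᵥ (C - S.cov).vec).re / S.p k / S.gamma Mv k|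
          ≤ η * ‖C - S.cov‖ := by
  have hinj := S.vsteerMat_injective hd₀ hlam hhalf hK hθ hθinj
  have hγ := S.gamma_pos hd₀ hlam hhalf hK hθ hθinj
  set Q := projPerp (S.vsteerMat Mv) with hQ
  obtain ⟨κ, hκ, hslope⟩ := S.exists_slope_expansion hpos hMv hK hp hinj
  obtain ⟨δs, hδs, hss⟩ := S.exists_isMusicEstimate_of_ssMatrix hpos hMv hK hp hσ
  obtain ⟨κn, hκn, hnull⟩ := S.exists_nullForm_bound Mv
  choose κx hκx hxi using S.exists_xi_bound Mv
  -- the tolerance for the curvature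
  obtain ⟨ε, hε0, hε⟩ := exists_pos_of_eventually
    (p := fun k ε => 1 * ε ≤ S.gamma Mv k ∧ κx k / S.p k / S.gamma Mv k ^ 2 * ε ≤ η / 2)
    fun k => (eventually_mul_le_of_pos _ (hγ k)).and (eventually_mul_le_of_pos _ (half_pos hη))
  -- the radius of the neighbourhoods of the sources
  obtain ⟨r, hr0, hr⟩ := exists_pos_of_eventually
    (p := fun k r => Set.Icc (S.θ k - r) (S.θ k + r) ⊆ Set.Ioo (-(Real.pi / 2)) (Real.pi / 2) ∧
      (∀ j, j ≠ k → 2 * r < |S.θ j - S.θ k|) ∧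
      ∀ t, |t - S.θ k| ≤ r → |S.nullFormDeriv2 Mv Q t - 2 * S.gamma Mv k| ≤ ε / 2) (by
    intro k
    refine Filter.Eventually.and ?_ (Filter.Eventually.and ?_ ?_)
    · obtain ⟨h1, h2⟩ := hθ k
      have hpos1 : 0 < min (S.θ k + Real.pi / 2) (Real.pi / 2 - S.θ k) :=
        lt_min (by linarith) (by linarith)
      have := (Iio_mem_nhds hpos1)
      filter_upwards [nhdsWithin_le_nhds this] with x hx
      have h3 := lt_of_lt_of_le (Set.mem_Iio.1 hx) (min_le_left _ _)
      have h4 := lt_of_lt_of_le (Set.mem_Iio.1 hx) (min_le_right _ _)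
      rintro t ⟨ht1, ht2⟩
      exact ⟨by linarith, by linarith⟩
    · refine Filter.eventually_all.2 fun j => ?_
      by_cases hjk : j = k
      · simp [hjk]
      · have h1 : 0 < |S.θ j - S.θ k| / 2 :=
          half_pos (abs_pos.2 (sub_ne_zero.2 (hθinj.ne hjk)))
        filter_upwards [nhdsWithin_le_nhds (Iio_mem_nhds h1)] with x hx _
        linarith [Set.mem_Iio.1 hx]
    · have hc := (S.continuous_nullFormDeriv2 Q).continuousAt (x := S.θ k)
      rw [Metric.continuousAt_iff] at hc
      obtain ⟨d, hd, hcd⟩ := hc (ε / 2) (half_pos hε0)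
      filter_upwards [nhdsWithin_le_nhds (Iio_mem_nhds hd)] with x hx t ht
      have := hcd (x := t) (by rw [Real.dist_eq]; exact lt_of_le_of_lt ht hx)
      rw [Real.dist_eq, hQ, S.nullFormDeriv2_projPerp_source hinj] at this
      exact this.le)
  -- the null spectrum is bounded below away from the sources
  obtain ⟨c, hc0, hc⟩ : ∃ c : ℝ, 0 < c ∧ ∀ t ∈ Set.Icc (-(Real.pi / 2)) (Real.pi / 2) ∩
      {t | ∀ k, r ≤ |t - S.θ k|}, c ≤ S.nullForm Mv Q t := by
    have hclosed : IsClosed {t : ℝ | ∀ k, r ≤ |t - S.θ k|} := by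
      rw [Set.ofPred_forall]
      exact isClosed_iInter fun k => isClosed_le continuous_const (by fun_prop)
    refine (isCompact_Icc.inter_right hclosed).exists_forall_le'
      (S.continuous_nullForm Q).continuousOn ?_
    rintro t ⟨ht, htr⟩
    refine dotProduct_projPerp_pos hinj
      (S.vsteer_ne_mulVec hd₀ hlam hhalf hK hθ ht fun k hk => ?_)
    have := htr k
    rw [hk, sub_self, abs_zero] at this
    linarith
  obtain ⟨δ, hδ0, hδ⟩ := exists_pos_of_eventually
    (p := fun k δ => κ / S.gamma Mv k * δ ≤ η / 2)
    fun k => eventually_mul_le_of_pos _ (half_pos hη)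
  obtain ⟨δ', hδ'0, hδ'⟩ := exists_pos_of_eventually (ι := Unit)
    (p := fun _ δ => κn * κ * δ ≤ ε / 2 ∧ κn * κ * δ ≤ c / 4)
    fun _ => (eventually_mul_le_of_pos _ (by linarith)).and
      (eventually_mul_le_of_pos _ (by linarith))
  obtain ⟨hδ'1, hδ'2⟩ := hδ' ()
  refine ⟨min δ (min δ' δs), lt_min hδ0 (lt_min hδ'0 hδs), ?_⟩
  intro C hC hCδ est hor k
  have hest : IsMusicEstimate (S.vsteer Mv) S.θ (daMatrix S.pos Mv C) est :=
    hor.elim id (hss C hC (hCδ.trans ((min_le_right _ _).trans (min_le_right _ _))) est)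
  obtain ⟨hIcc, U, ev, hU, hmusic⟩ := hest
  obtain ⟨hPn, hPs⟩ := hslope C U ev hU
  set P := noiseProj K U with hP
  have hPQ : κn * ‖P - Q‖ ≤ κn * κ * δ' := by
    rw [mul_assoc]
    gcongr
    exact hPn.trans (by gcongr; exact hCδ.trans ((min_le_right _ _).trans (min_le_left _ _)))
  have hspec : nullSpectrum K U (S.vsteer Mv) = S.nullForm Mv P :=
    funext fun t => nullSpectrum_eq _ t
  rw [hspec] at hmusic
  have hclose : ∀ t ∈ Set.Icc (-(Real.pi / 2)) (Real.pi / 2),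
      |S.nullForm Mv P t - S.nullForm Mv Q t| ≤ c / 4 ∧
      |S.nullFormDeriv2 Mv P t - S.nullFormDeriv2 Mv Q t| ≤ ε / 2 := by
    intro t ht
    rw [← nullForm_sub, ← nullFormDeriv2_sub]
    have h := hnull (P - Q) t ht
    exact ⟨h.1.trans (hPQ.trans hδ'2), h.2.trans (hPQ.trans hδ'1)⟩
  have hball : ∀ j t, |t - S.θ j| ≤ r → t ∈ Set.Icc (-(Real.pi / 2)) (Real.pi / 2) := by
    intro j t ht
    rw [abs_le] at ht
    exact Set.Ioo_subset_Icc_self ((hr j).1 ⟨by linarith, by linarith⟩)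
  have hcurv : ∀ j t, |t - S.θ j| ≤ r →
      |S.nullFormDeriv2 Mv P t - 2 * S.gamma Mv j| ≤ ε := by
    intro j t ht
    have h1 := (hr j).2.2 t ht
    have h2 := (hclose t (hball j t ht)).2
    have h3 := abs_sub_le (S.nullFormDeriv2 Mv P t) (S.nullFormDeriv2 Mv Q t) (2 * S.gamma Mv j)
    linarith
  have hstationary : ∀ t, IsLocalMin (S.nullForm Mv P) t → S.nullFormDeriv Mv P t = 0 :=
    fun t ht => ht.hasDerivAt_eq_zero (S.hasDerivAt_nullForm P t)
  -- mean value form of Taylor's formula for the slope next to a source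
  have hmvt : ∀ j s t, |s - S.θ j| < r → |t - S.θ j| < r → s < t →
      ∃ u, |u - S.θ j| ≤ r ∧ S.nullFormDeriv Mv P t - S.nullFormDeriv Mv P s
        = S.nullFormDeriv2 Mv P u * (t - s) := by
    intro j s t hs ht hst
    obtain ⟨u, hu, hu'⟩ := exists_hasDerivAt_eq_slope (S.nullFormDeriv Mv P)
      (S.nullFormDeriv2 Mv P) hst
      (fun x _ => (S.hasDerivAt_nullFormDeriv P x).continuousAt.continuousWithinAt)
      (fun x _ => S.hasDerivAt_nullFormDeriv P x)
    refine ⟨u, ?_, ?_⟩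
    · rw [abs_lt] at hs ht
      rw [abs_le]
      constructor <;> linarith [hu.1, hu.2]
    · rw [hu', div_mul_cancel₀ _ (sub_ne_zero.2 hst.ne')]
  have hcurvpos : ∀ j u, |u - S.θ j| ≤ r → 0 < S.nullFormDeriv2 Mv P u := by
    intro j u hu
    have h1 := (abs_le.1 (hcurv j u hu)).1
    have h2 := (hε j).1
    linarith [hγ j]
  have huniq' : ∀ j s t, |s - S.θ j| < r → |t - S.θ j| < r → IsLocalMin (S.nullForm Mv P) s →
      IsLocalMin (S.nullForm Mv P) t → ¬ s < t := by
    intro j s t hs ht hms hmt hst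
    obtain ⟨u, hu, heq⟩ := hmvt j s t hs ht hst
    rw [hstationary s hms, hstationary t hmt, sub_zero] at heq
    have := mul_pos (hcurvpos j u hu) (sub_pos.2 hst)
    linarith
  obtain ⟨hnear, hlocmin⟩ := near_of_smallest_localMinima (c := c / 2) hθinj hr0
    (fun k => (hr k).1) (fun j k => (hr k).2.1 j) (S.continuous_nullForm P)
    (fun j => by
      have h1 := (abs_le.1 (hclose (S.θ j) (Set.Ioo_subset_Icc_self (hθ j))).1).2
      rw [hQ, S.nullForm_projPerp_source hinj] at h1
      linarith)
    (fun t ht htr => by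
      have h1 := (abs_le.1 (hclose t ht).1).1
      have h2 := hc t ⟨ht, htr⟩
      linarith)
    (fun j s t hs ht hms hmt => by
      rcases lt_trichotomy s t with h | h | h
      · exact absurd h (huniq' j s t hs ht hms hmt)
      · exact h
      · exact absurd h (huniq' j t s ht hs hmt hms))
    hmusic k
  have hest0 := hstationary _ hlocmin
  have hcenter : |S.θ k - S.θ k| < r := by rw [sub_self, abs_zero]; exact hr0
  obtain ⟨u, hu, heq⟩ : ∃ u, |u - S.θ k| ≤ r ∧
      (est k - S.θ k) * S.nullFormDeriv2 Mv P u = -S.nullFormDeriv Mv P (S.θ k) := by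
    rcases lt_trichotomy (est k) (S.θ k) with h | h | h
    · obtain ⟨u, hu, heq⟩ := hmvt k _ _ hnear hcenter h
      rw [hest0] at heq
      exact ⟨u, hu, by linarith⟩
    · exact ⟨S.θ k, hcenter.le, by rw [h] at hest0; rw [h, hest0]; ring⟩
    · obtain ⟨u, hu, heq⟩ := hmvt k _ _ hcenter hnear h
      rw [hest0] at heq
      exact ⟨u, hu, by linarith⟩
  refine abs_newton_step_le (κw := κx k / S.p k) (hγ k) (hcurv k u hu) ?_ heq (hPs k) ?_ hκ
    (norm_nonneg _) (hCδ.trans (min_le_left _ _)) (hδ k) (hε k).2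
  · have := (hε k).1
    linarith
  · rw [abs_div, abs_of_pos (hp k), div_mul_eq_mul_div]
    exact div_le_div_of_nonneg_right (hxi k _) (hp k).le

end Model

/-! ### Moments of circularly-symmetric complex Gaussian variables -/

section GaussianMoments

open scoped NNReal

lemma integrable_pow_gaussianReal (s : ℝ≥0) (n : ℕ) :
    Integrable (fun x : ℝ => x ^ n) (gaussianReal 0 s) := by
  have h := (memLp_id_gaussianReal' (μ := 0) (v := s) (n : ENNReal)
    (ENNReal.natCast_ne_top n)).integrable_norm_pow'
  refine (integrable_norm_iff (by fun_prop)).1 (h.congr (ae_of_all _ fun x => ?_))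
  simp

lemma integral_sq_gaussianReal (s : ℝ≥0) : ∫ x : ℝ, x ^ 2 ∂(gaussianReal 0 s) = s := by
  have h := variance_fun_id_gaussianReal (μ := 0) (v := s)
  rw [variance_eq_integral (by fun_prop)] at h
  simpa [integral_id_gaussianReal] using h

/-- The fourth moment of a real Gaussian, from the invariance of the plane Gaussian measure under
the rotation by half a right angle. -/
lemma integral_pow_four_gaussianReal (s : ℝ≥0) :
    ∫ x : ℝ, x ^ 4 ∂(gaussianReal 0 s) = 3 * (s : ℝ) ^ 2 := by
  set g := gaussianReal 0 s with hg
  have hrot := IsGaussian.map_rotation_eq_self (μ := g)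
    (by simp [hg, integral_id_gaussianReal]) (Real.pi / 4)
  have h1 : ∫ z : ℝ × ℝ, z.1 ^ 4 ∂(g.prod g) = ∫ x, x ^ 4 ∂g := by
    have := integral_prod_mul (μ := g) (ν := g) (fun x : ℝ => x ^ 4) (fun _ => (1 : ℝ))
    simpa using this
  have h2 : ∫ z : ℝ × ℝ, z.1 ^ 4 ∂(g.prod g)
      = ∫ z : ℝ × ℝ, (Real.sqrt 2 / 2 * (z.1 + z.2)) ^ 4 ∂(g.prod g) := by
    conv_lhs => rw [← hrot]
    rw [integral_map (by fun_prop) (by fun_prop)]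
    refine integral_congr_ae (ae_of_all _ fun z => ?_)
    simp only [ContinuousLinearMap.rotation_apply, Real.cos_pi_div_four, Real.sin_pi_div_four,
      smul_eq_mul]
    ring
  have hI : ∀ i j : ℕ, Integrable (fun z : ℝ × ℝ => z.1 ^ i * z.2 ^ j) (g.prod g) := fun i j =>
    (integrable_pow_gaussianReal s i).mul_prod (integrable_pow_gaussianReal s j)
  have hm : ∀ i j : ℕ, ∫ z : ℝ × ℝ, z.1 ^ i * z.2 ^ j ∂(g.prod g)
      = (∫ x, x ^ i ∂g) * ∫ x, x ^ j ∂g := fun i j =>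
    integral_prod_mul (μ := g) (ν := g) (fun x : ℝ => x ^ i) (fun x : ℝ => x ^ j)
  have hs4 : (Real.sqrt 2 / 2) ^ 4 = 1 / 4 := by
    have : Real.sqrt 2 ^ 2 = 2 := Real.sq_sqrt (by norm_num)
    calc (Real.sqrt 2 / 2) ^ 4 = (Real.sqrt 2 ^ 2) ^ 2 / 16 := by ring
      _ = 1 / 4 := by rw [this]; norm_num
  have h3 : ∀ z : ℝ × ℝ, (Real.sqrt 2 / 2 * (z.1 + z.2)) ^ 4
      = 1 / 4 * (z.1 ^ 4 * z.2 ^ 0) + (z.1 ^ 3 * z.2 ^ 1) + 3 / 2 * (z.1 ^ 2 * z.2 ^ 2)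
        + (z.1 ^ 1 * z.2 ^ 3) + 1 / 4 * (z.1 ^ 0 * z.2 ^ 4) := by
    intro z
    rw [mul_pow, hs4]
    ring
  have hm1 : ∫ x : ℝ, x ^ 1 ∂g = 0 := by simp [hg, integral_id_gaussianReal]
  have hm0 : ∫ x : ℝ, x ^ 0 ∂g = 1 := by simp
  rw [h1] at h2
  simp only [h3] at h2
  have i1 : Integrable (fun z : ℝ × ℝ => 1 / 4 * (z.1 ^ 4 * z.2 ^ 0)) (g.prod g) :=
    (hI 4 0).const_mul _
  have i2 : Integrable (fun z : ℝ × ℝ => 1 / 4 * (z.1 ^ 4 * z.2 ^ 0) + z.1 ^ 3 * z.2 ^ 1)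
    (g.prod g) := i1.add (hI 3 1)
  have i3 : Integrable (fun z : ℝ × ℝ => 1 / 4 * (z.1 ^ 4 * z.2 ^ 0) + z.1 ^ 3 * z.2 ^ 1
    + 3 / 2 * (z.1 ^ 2 * z.2 ^ 2)) (g.prod g) := i2.add ((hI 2 2).const_mul _)
  have i4 : Integrable (fun z : ℝ × ℝ => 1 / 4 * (z.1 ^ 4 * z.2 ^ 0) + z.1 ^ 3 * z.2 ^ 1
    + 3 / 2 * (z.1 ^ 2 * z.2 ^ 2) + z.1 ^ 1 * z.2 ^ 3) (g.prod g) := i3.add (hI 1 3)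
  rw [integral_add i4 ((hI 0 4).const_mul _), integral_add i3 (hI 1 3),
    integral_add i2 ((hI 2 2).const_mul _), integral_add i1 (hI 3 1), integral_const_mul,
    integral_const_mul, integral_const_mul, hm, hm, hm, hm, hm, hm1, hm0,
    integral_sq_gaussianReal] at h2
  linarith

/-- The coordinates of the plane as real and imaginary part. -/
lemma circGaussian_eq (v : ℝ) : circGaussian v = ((gaussianReal 0 (v / 2).toNNReal).prod
    (gaussianReal 0 (v / 2).toNNReal)).map Complex.equivRealProdCLM.symm := rfl

instance (v : ℝ) : IsGaussian (circGaussian v) := by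
  rw [circGaussian_eq]
  infer_instance

lemma integral_circGaussian (v : ℝ) (f : ℂ → ℂ) :
    ∫ z, f z ∂(circGaussian v) = ∫ z : ℝ × ℝ, f (z.1 + z.2 * Complex.I)
      ∂((gaussianReal 0 (v / 2).toNNReal).prod (gaussianReal 0 (v / 2).toNNReal)) := by
  rw [circGaussian_eq]
  have := integral_map_equiv (μ := ((gaussianReal 0 (v / 2).toNNReal).prod
    (gaussianReal 0 (v / 2).toNNReal)))
    Complex.equivRealProdCLM.symm.toHomeomorph.toMeasurableEquiv f
  refine Eq.trans this (integral_congr_ae (ae_of_all _ fun z => ?_))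
  simp [Complex.equivRealProdCLM_symm_apply]

/-- Invariance of the circular Gaussian under a quarter turn. -/
lemma integral_circGaussian_rotate (v : ℝ) (f : ℂ → ℂ) :
    ∫ z, f (-Complex.I * z) ∂(circGaussian v) = ∫ z, f z ∂(circGaussian v) := by
  rw [integral_circGaussian, integral_circGaussian]
  set g := gaussianReal 0 (v / 2).toNNReal with hg
  have hswap : MeasurePreserving Prod.swap (g.prod g) (g.prod g) :=
    ⟨measurable_swap, Measure.prod_swap⟩
  have hneg : MeasurePreserving (fun x : ℝ => -x) g g :=
    ⟨measurable_neg, by rw [hg, gaussianReal_map_neg, neg_zero]⟩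
  -- multiplication by `-I` maps `(x, y)` to `(y, -x)`
  have hmp : MeasurePreserving (((MeasurableEquiv.refl ℝ).prodCongr (MeasurableEquiv.neg ℝ)) ∘
      MeasurableEquiv.prodComm) (g.prod g) (g.prod g) :=
    ((MeasurePreserving.id g).prod hneg).comp hswap
  have h := hmp.integral_comp' (f := MeasurableEquiv.prodComm.trans
    ((MeasurableEquiv.refl ℝ).prodCongr (MeasurableEquiv.neg ℝ)))
    (fun z : ℝ × ℝ => f (z.1 + z.2 * Complex.I))
  rw [← h]
  refine integral_congr_ae (ae_of_all _ fun z => ?_)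
  change f (-Complex.I * (z.1 + z.2 * Complex.I)) = f ((z.2 : ℂ) + ((-z.1 : ℝ) : ℂ) * Complex.I)
  congr 1
  push_cast
  linear_combination (-(z.2 : ℂ)) * Complex.I_sq

/-- The moment of order `(a, b)` of a circular Gaussian. -/
def circMoment (v : ℝ) (a b : ℕ) : ℂ := ∫ z, z ^ a * star z ^ b ∂(circGaussian v)

lemma circMoment_of_ne (v : ℝ) {a b : ℕ} (ha : a ≤ 2) (hb : b ≤ 2) (hab : a ≠ b) :
    circMoment v a b = 0 := by
  have h := integral_circGaussian_rotate v fun z => z ^ a * star z ^ b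
  have h2 : ∫ z, (-Complex.I * z) ^ a * star (-Complex.I * z) ^ b ∂(circGaussian v)
      = ((-Complex.I) ^ a * Complex.I ^ b) * circMoment v a b := by
    rw [circMoment, ← integral_const_mul]
    refine integral_congr_ae (ae_of_all _ fun z => ?_)
    simp only [star_mul', star_neg, Complex.star_def, Complex.conj_I, mul_pow, neg_neg]
    ring
  rw [h2] at h
  have h3 : ((-Complex.I) ^ a * Complex.I ^ b - 1) * circMoment v a b = 0 := by
    rw [sub_mul, h, one_mul, ← circMoment, sub_self]
  refine (mul_eq_zero.1 h3).resolve_left ?_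
  clear h h2 h3
  interval_cases a <;> interval_cases b <;>
    first | exact absurd rfl hab | norm_num [Complex.ext_iff, pow_succ]

lemma circMoment_zero (v : ℝ) : circMoment v 0 0 = 1 := by
  simp [circMoment]

lemma star_add_mul_I (x y : ℝ) :
    ((x : ℂ) + y * Complex.I) * star ((x : ℂ) + y * Complex.I) = ((x ^ 2 + y ^ 2 : ℝ) : ℂ) := by
  rw [Complex.star_def, Complex.mul_conj, Complex.normSq_add_mul_I]

lemma circMoment_one {v : ℝ} (hv : 0 ≤ v) : circMoment v 1 1 = v := by
  rw [circMoment, integral_circGaussian]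
  set g := gaussianReal 0 (v / 2).toNNReal with hg
  have hI : ∀ i j : ℕ, Integrable (fun z : ℝ × ℝ => z.1 ^ i * z.2 ^ j) (g.prod g) := fun i j =>
    (integrable_pow_gaussianReal _ i).mul_prod (integrable_pow_gaussianReal _ j)
  have hm : ∀ i j : ℕ, ∫ z : ℝ × ℝ, z.1 ^ i * z.2 ^ j ∂(g.prod g)
      = (∫ x, x ^ i ∂g) * ∫ x, x ^ j ∂g := fun i j =>
    integral_prod_mul (μ := g) (ν := g) (fun x : ℝ => x ^ i) (fun x : ℝ => x ^ j)
  have h1 : ∀ z : ℝ × ℝ, ((z.1 : ℂ) + z.2 * Complex.I) ^ 1 * star ((z.1 : ℂ) + z.2 * Complex.I) ^ 1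
      = ((z.1 ^ 2 * z.2 ^ 0 + z.1 ^ 0 * z.2 ^ 2 : ℝ) : ℂ) := by
    intro z
    rw [pow_one, pow_one, star_add_mul_I]
    simp
  have hs : (((v / 2).toNNReal : NNReal) : ℝ) = v / 2 := Real.coe_toNNReal _ (by linarith)
  have hm0 : ∫ x : ℝ, x ^ 0 ∂g = 1 := by simp
  simp only [h1]
  rw [integral_complex_ofReal, integral_add (hI 2 0) (hI 0 2), hm, hm, hm0, integral_sq_gaussianReal, hs]
  congr 1
  ring

lemma circMoment_two {v : ℝ} (hv : 0 ≤ v) : circMoment v 2 2 = 2 * (v : ℂ) ^ 2 := by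
  rw [circMoment, integral_circGaussian]
  set g := gaussianReal 0 (v / 2).toNNReal with hg
  have hI : ∀ i j : ℕ, Integrable (fun z : ℝ × ℝ => z.1 ^ i * z.2 ^ j) (g.prod g) := fun i j =>
    (integrable_pow_gaussianReal _ i).mul_prod (integrable_pow_gaussianReal _ j)
  have hm : ∀ i j : ℕ, ∫ z : ℝ × ℝ, z.1 ^ i * z.2 ^ j ∂(g.prod g)
      = (∫ x, x ^ i ∂g) * ∫ x, x ^ j ∂g := fun i j =>
    integral_prod_mul (μ := g) (ν := g) (fun x : ℝ => x ^ i) (fun x : ℝ => x ^ j)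
  have h1 : ∀ z : ℝ × ℝ, ((z.1 : ℂ) + z.2 * Complex.I) ^ 2 * star ((z.1 : ℂ) + z.2 * Complex.I) ^ 2
      = ((z.1 ^ 4 * z.2 ^ 0 + z.1 ^ 0 * z.2 ^ 4 + 2 * (z.1 ^ 2 * z.2 ^ 2) : ℝ) : ℂ) := by
    intro z
    rw [← mul_pow, star_add_mul_I, ← Complex.ofReal_pow]
    congr 1
    ring
  have hs : (((v / 2).toNNReal : NNReal) : ℝ) = v / 2 := Real.coe_toNNReal _ (by linarith)
  have hm0 : ∫ x : ℝ, x ^ 0 ∂g = 1 := by simp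
  have i1 : Integrable (fun z : ℝ × ℝ => z.1 ^ 4 * z.2 ^ 0 + z.1 ^ 0 * z.2 ^ 4) (g.prod g) :=
    (hI 4 0).add (hI 0 4)
  simp only [h1]
  rw [integral_complex_ofReal, integral_add i1 ((hI 2 2).const_mul _), integral_add (hI 4 0) (hI 0 4),
    integral_const_mul, hm, hm, hm, hm0, integral_sq_gaussianReal,
    integral_pow_four_gaussianReal, hs]
  rw [← Complex.ofReal_pow, ← Complex.ofReal_ofNat, ← Complex.ofReal_mul]
  congr 1
  ring

lemma memLp_circGaussian (v : ℝ) (p : ENNReal) (hp : p ≠ ⊤) : MemLp id p (circGaussian v) :=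
  IsGaussian.memLp_id _ p hp

end GaussianMoments

/-! ### Moments of a vector of independent circular Gaussians -/

section Vector

variable {ι : Type*} [Fintype ι] [DecidableEq ι] (v : ι → ℝ)

/-- The law of a vector of independent circular Gaussians of variances `v`. -/
def circVector (v : ι → ℝ) : Measure (ι → ℂ) := Measure.pi fun i => circGaussian (v i)

instance : IsProbabilityMeasure (circVector v) := by
  unfold circVector; infer_instance

omit [DecidableEq ι] in
lemma memLp_circVector_eval (i : ι) (p : ENNReal) (hp : p ≠ ⊤) :
    MemLp (fun w : ι → ℂ => w i) p (circVector v) :=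
  (memLp_circGaussian (v i) p hp).comp_measurePreserving
    (measurePreserving_eval (fun i => circGaussian (v i)) i)

omit [DecidableEq ι] in
lemma memLp_circVector_mul_star (i j : ι) :
    MemLp (fun w : ι → ℂ => w i * star (w j)) 4 (circVector v) := by
  have : ENNReal.HolderTriple 8 8 4 := by
    constructor
    rw [← two_mul, show (8 : ENNReal) = 2 * 4 by norm_num, ENNReal.mul_inv (by simp) (by simp),
      ← mul_assoc, ENNReal.mul_inv_cancel (by simp) (by simp), one_mul]
  exact MemLp.mul' (p := 8) (q := 8) ((memLp_circVector_eval v j 8 (by simp)).star)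
    (memLp_circVector_eval v i 8 (by simp))

omit [DecidableEq ι] in
lemma integral_circVector_monomial (a b : ι → ℕ) :
    ∫ w, ∏ m, (w m ^ a m * star (w m) ^ b m) ∂(circVector v) = ∏ m, circMoment (v m) (a m) (b m) :=
  integral_fintype_prod_eq_prod (fun m z => z ^ a m * star z ^ b m)

/-- The variance of coordinate `i`, as the covariance of coordinates `i` and `j`. -/
def diagCov (v : ι → ℝ) (i j : ι) : ℂ := if i = j then (v i : ℂ) else 0

omit [Fintype ι] in
/-- The exponent of the variable `m` in a product of the variables `i` and `j`. -/
lemma exponent_le_two (i j m : ι) :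
    (if i = m then 1 else 0) + (if j = m then 1 else 0) ≤ 2 := by
  split_ifs <;> norm_num

lemma prod_pow_exponent (w : ι → ℂ) (i j : ι) :
    ∏ m, w m ^ ((if i = m then 1 else 0) + (if j = m then 1 else 0)) = w i * w j := by
  simp only [pow_add, Finset.prod_mul_distrib, Finset.prod_pow_boole, Finset.mem_univ, if_true]

variable {v}

lemma integral_circVector_pair (hv : ∀ i, 0 ≤ v i) (i j : ι) :
    ∫ w, w i * star (w j) ∂(circVector v) = diagCov v i j := by
  have h := integral_circVector_monomial v (fun m => if i = m then 1 else 0)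
    (fun m => if j = m then 1 else 0)
  simp only [Finset.prod_mul_distrib, Finset.prod_pow_boole, Finset.mem_univ, if_true] at h
  rw [h, diagCov]
  by_cases hij : i = j
  · subst hij
    rw [if_pos rfl, Finset.prod_eq_single i]
    · simp only [if_true]
      exact circMoment_one (hv i)
    · intro m _ hm
      rw [if_neg hm.symm, circMoment_zero]
    · simp
  · rw [if_neg hij]
    refine Finset.prod_eq_zero (Finset.mem_univ i) ?_
    rw [if_pos rfl, if_neg (Ne.symm hij)]
    exact circMoment_of_ne _ (by norm_num) (by norm_num) (by norm_num)

/-- Isserlis' formula for the fourth moments of independent circular Gaussians. -/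
lemma integral_circVector_quad (hv : ∀ i, 0 ≤ v i) (i j k l : ι) :
    ∫ w, (w j * w k) * star (w i * w l) ∂(circVector v)
      = diagCov v i j * diagCov v k l + diagCov v i k * diagCov v j l := by
  have h := integral_circVector_monomial v
    (fun m => (if j = m then 1 else 0) + (if k = m then 1 else 0))
    (fun m => (if i = m then 1 else 0) + (if l = m then 1 else 0))
  have hstar : ∀ w : ι → ℂ, ∏ m, star (w m) ^ ((if i = m then 1 else 0) + (if l = m then 1 else 0))
      = star (w i * w l) := by
    intro w
    rw [prod_pow_exponent (fun m => star (w m)), star_mul']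
  simp only [Finset.prod_mul_distrib, prod_pow_exponent, hstar] at h
  rw [h]
  -- a variable with unequal exponents makes the moment vanish
  have hzero : ∀ m, (if j = m then 1 else 0) + (if k = m then 1 else 0)
      ≠ (if i = m then 1 else 0) + (if l = m then 1 else 0) →
      ∏ m, circMoment (v m) ((if j = m then 1 else 0) + (if k = m then 1 else 0))
        ((if i = m then 1 else 0) + (if l = m then 1 else 0)) = 0 := fun m hm =>
    Finset.prod_eq_zero (Finset.mem_univ m)
      (circMoment_of_ne _ (exponent_le_two _ _ _) (exponent_le_two _ _ _) hm)
  have hdiag : ∏ m, circMoment (v m) ((if j = m then 1 else 0) + (if k = m then 1 else 0))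
      ((if j = m then 1 else 0) + (if k = m then 1 else 0))
      = (v j : ℂ) * v k + if j = k then (v j : ℂ) * v k else 0 := by
    by_cases hjk : j = k
    · subst hjk
      rw [Finset.prod_eq_single j]
      · simp only [if_true]
        rw [circMoment_two (hv j)]
        ring
      · intro m _ hm
        rw [if_neg hm.symm, circMoment_zero]
      · simp
    · rw [if_neg hjk, add_zero]
      have hfac : ∀ m, circMoment (v m) ((if j = m then 1 else 0) + (if k = m then 1 else 0))
          ((if j = m then 1 else 0) + (if k = m then 1 else 0))
          = (if j = m then (v m : ℂ) else 1) * (if k = m then (v m : ℂ) else 1) := by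
        intro m
        by_cases hj : j = m
        · have hk : k ≠ m := fun hk => hjk (hj.trans hk.symm)
          rw [if_pos hj, if_neg hk, if_pos hj, if_neg hk, circMoment_one (hv m), mul_one]
        · by_cases hk : k = m
          · rw [if_neg hj, if_pos hk, if_neg hj, if_pos hk, circMoment_one (hv m), one_mul]
          · rw [if_neg hj, if_neg hk, if_neg hj, if_neg hk, circMoment_zero, mul_one]
      simp only [hfac, Finset.prod_mul_distrib, Finset.prod_ite_eq, Finset.mem_univ, if_true]
  by_cases hij : i = j
  · subst hij
    by_cases hkl : k = l
    · subst hkl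
      rw [hdiag]
      simp only [diagCov, if_true]
      by_cases hik : i = k
      · subst hik; simp
      · simp [hik]
    · rw [hzero k (by simp [Ne.symm hkl])]
      simp only [diagCov, hkl, if_false, mul_zero, zero_add]
      by_cases hik : i = k
      · subst hik; simp [hkl]
      · simp [hik]
  · by_cases hjl : j = l
    · subst hjl
      by_cases hik : i = k
      · subst hik
        have hcomm : (∏ m, circMoment (v m) ((if j = m then 1 else 0) + (if i = m then 1 else 0))
            ((if i = m then 1 else 0) + (if j = m then 1 else 0)))
            = ∏ m, circMoment (v m) ((if j = m then 1 else 0) + (if i = m then 1 else 0))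
            ((if j = m then 1 else 0) + (if i = m then 1 else 0)) :=
          Finset.prod_congr rfl fun m _ => by rw [add_comm (if i = m then 1 else 0)]
        rw [hcomm, hdiag]
        simp only [diagCov, hij, Ne.symm hij, if_true, if_false]
        ring
      · rw [hzero k (by simp [hik, add_comm])]
        simp [diagCov, hij, hik]
    · rw [hzero j (by simp [hij, Ne.symm hjl])]
      simp [diagCov, hij, hjl]

/-- A product of coordinates minus its mean. -/
def centeredPair (v : ι → ℝ) (i j : ι) (w : ι → ℂ) : ℂ := w i * star (w j) - diagCov v i j

lemma memLp_centeredPair (i j : ι) : MemLp (centeredPair v i j) 4 (circVector v) :=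
  (memLp_circVector_mul_star v i j).sub (memLp_const _)

lemma integral_centeredPair (hv : ∀ i, 0 ≤ v i) (i j : ι) :
    ∫ w, centeredPair v i j w ∂(circVector v) = 0 := by
  have h : Integrable (fun w : ι → ℂ => w i * star (w j)) (circVector v) :=
    (memLp_circVector_mul_star v i j).integrable (by norm_num)
  simp only [centeredPair]
  rw [integral_sub h (integrable_const _), integral_circVector_pair hv]
  simp

lemma integrable_star_mul {Ω : Type*} [MeasurableSpace Ω] {μ : Measure Ω} [IsProbabilityMeasure μ]
    {f g : Ω → ℂ} (hf : MemLp f 4 μ) (hg : MemLp g 4 μ) :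
    Integrable (fun w => star (f w) * g w) μ :=
  MemLp.integrable_mul (p := 2) (q := 2) ((hf.mono_exponent (by norm_num)).star)
    (hg.mono_exponent (by norm_num))

omit [Fintype ι] in
lemma star_diagCov (i j : ι) : star (diagCov v i j) = diagCov v i j := by
  unfold diagCov
  split_ifs <;> simp

lemma integral_star_centeredPair_mul (hv : ∀ i, 0 ≤ v i) (i j k l : ι) :
    ∫ w, star (centeredPair v i j w) * centeredPair v k l w ∂(circVector v)
      = diagCov v i k * diagCov v j l := by
  have hm : ∀ i j, MemLp (fun w : ι → ℂ => w i * star (w j)) 4 (circVector v) :=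
    memLp_circVector_mul_star v
  have h1 : ∀ w : ι → ℂ, star (centeredPair v i j w) * centeredPair v k l w
      = star (w i * star (w j)) * (w k * star (w l)) - diagCov v k l * (w j * star (w i))
        - diagCov v i j * centeredPair v k l w := by
    intro w
    simp only [centeredPair, star_sub, star_diagCov, star_mul', star_star]
    ring
  have i1 : Integrable (fun w : ι → ℂ => star (w i * star (w j)) * (w k * star (w l)))
      (circVector v) := integrable_star_mul (hm i j) (hm k l)
  have i2 : Integrable (fun w : ι → ℂ => diagCov v k l * (w j * star (w i))) (circVector v) :=
    ((hm j i).integrable (by norm_num)).const_mul _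
  have i3 : Integrable (fun w : ι → ℂ => star (w i * star (w j)) * (w k * star (w l))
      - diagCov v k l * (w j * star (w i))) (circVector v) := i1.sub i2
  have i4 : Integrable (fun w : ι → ℂ => diagCov v i j * centeredPair v k l w) (circVector v) :=
    ((memLp_centeredPair k l).integrable (by norm_num)).const_mul _
  have hq : ∫ w, star (w i * star (w j)) * (w k * star (w l)) ∂(circVector v)
      = diagCov v i j * diagCov v k l + diagCov v i k * diagCov v j l := by
    rw [← integral_circVector_quad hv]
    refine integral_congr_ae (ae_of_all _ fun w => ?_)
    simp only [star_mul', star_star]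
    ring
  have hji : diagCov v j i = diagCov v i j := by
    unfold diagCov
    by_cases h : i = j
    · subst h; rfl
    · rw [if_neg h, if_neg (Ne.symm h)]
  simp only [h1]
  rw [integral_sub i3 i4, integral_sub i1 i2, integral_const_mul, integral_const_mul,
    integral_centeredPair hv, integral_circVector_pair hv, hq, hji]
  ring

/-- A centered sesquilinear form in the coordinates. -/
def centeredForm (v : ι → ℝ) (c : ι → ι → ℂ) (w : ι → ℂ) : ℂ :=
  ∑ i, ∑ j, c i j * centeredPair v i j w

lemma memLp_centeredForm (c : ι → ι → ℂ) : MemLp (centeredForm v c) 4 (circVector v) :=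
  memLp_finsetSum _ fun i _ => memLp_finsetSum _ fun j _ =>
    (memLp_centeredPair i j).const_mul (c i j)

lemma integral_centeredForm (hv : ∀ i, 0 ≤ v i) (c : ι → ι → ℂ) :
    ∫ w, centeredForm v c w ∂(circVector v) = 0 := by
  have h : ∀ i j, Integrable (fun w => c i j * centeredPair v i j w) (circVector v) := fun i j =>
    ((memLp_centeredPair i j).integrable (by norm_num)).const_mul _
  simp only [centeredForm]
  rw [integral_finsetSum _ fun i _ => integrable_finsetSum _ fun j _ => h i j]
  refine Finset.sum_eq_zero fun i _ => ?_
  rw [integral_finsetSum _ fun j _ => h i j]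
  refine Finset.sum_eq_zero fun j _ => ?_
  rw [integral_const_mul, integral_centeredPair hv, mul_zero]

/-- The covariance of two centered sesquilinear forms. -/
lemma integral_star_centeredForm_mul (hv : ∀ i, 0 ≤ v i) (c d : ι → ι → ℂ) :
    ∫ w, star (centeredForm v c w) * centeredForm v d w ∂(circVector v)
      = ∑ i, ∑ j, star (c i j) * d i j * ((v i : ℂ) * v j) := by
  have h1 : ∀ w, star (centeredForm v c w) * centeredForm v d w
      = ∑ i, ∑ j, ∑ k, ∑ l, (star (c i j) * d k l) *
          (star (centeredPair v i j w) * centeredPair v k l w) := by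
    intro w
    rw [centeredForm, centeredForm, star_sum, Finset.sum_mul]
    refine Finset.sum_congr rfl fun i _ => ?_
    rw [star_sum, Finset.sum_mul]
    refine Finset.sum_congr rfl fun j _ => ?_
    rw [Finset.mul_sum]
    refine Finset.sum_congr rfl fun k _ => ?_
    rw [Finset.mul_sum]
    refine Finset.sum_congr rfl fun l _ => ?_
    rw [star_mul']
    ring
  have hI : ∀ i j k l, Integrable (fun w => (star (c i j) * d k l) *
      (star (centeredPair v i j w) * centeredPair v k l w)) (circVector v) := fun i j k l =>
    (integrable_star_mul (memLp_centeredPair i j) (memLp_centeredPair k l)).const_mul _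
  simp only [h1]
  rw [integral_finsetSum _ fun i _ => integrable_finsetSum _ fun j _ =>
    integrable_finsetSum _ fun k _ => integrable_finsetSum _ fun l _ => hI i j k l]
  refine Finset.sum_congr rfl fun i _ => ?_
  rw [integral_finsetSum _ fun j _ =>
    integrable_finsetSum _ fun k _ => integrable_finsetSum _ fun l _ => hI i j k l]
  refine Finset.sum_congr rfl fun j _ => ?_
  rw [integral_finsetSum _ fun k _ => integrable_finsetSum _ fun l _ => hI i j k l,
    Finset.sum_eq_single i, integral_finsetSum _ fun l _ => hI i j i l, Finset.sum_eq_single j]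
  · rw [integral_const_mul, integral_star_centeredPair_mul hv, diagCov, diagCov, if_pos rfl,
      if_pos rfl]
  · intro l _ hl
    rw [integral_const_mul, integral_star_centeredPair_mul hv, diagCov, diagCov,
      if_neg (Ne.symm hl), mul_zero, mul_zero]
  · simp
  · intro k _ hk
    rw [integral_finsetSum _ fun l _ => hI i j k l]
    refine Finset.sum_eq_zero fun l _ => ?_
    rw [integral_const_mul, integral_star_centeredPair_mul hv, diagCov, if_neg (Ne.symm hk),
      zero_mul, mul_zero]
  · simp

end Vector

/-! ### Moments of sums of independent identically distributed variables -/

section PartialSum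

variable {Ω 𝓧 : Type*} [MeasurableSpace Ω] [MeasurableSpace 𝓧] {μ : Measure Ω}
  {ν : Measure 𝓧} {W : ℕ → Ω → 𝓧} {f g : 𝓧 → ℝ}

/-- The sum of `f` over the first `n` terms of the sequence `W`. -/
def partialSum (W : ℕ → Ω → 𝓧) (f : 𝓧 → ℝ) (n : ℕ) (ω : Ω) : ℝ :=
  ∑ t ∈ Finset.range n, f (W t ω)

omit [MeasurableSpace Ω] [MeasurableSpace 𝓧] in
lemma partialSum_succ (n : ℕ) (ω : Ω) :
    partialSum W f (n + 1) ω = partialSum W f n ω + f (W n ω) := by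
  rw [partialSum, Finset.sum_range_succ, partialSum]

lemma indepFun_partialSum
    (hind : ∀ n, IndepFun (fun ω (t : Finset.range n) => W t ω) (W n) μ)
    (hf : Measurable f) (hg : Measurable g) (n : ℕ) :
    IndepFun (partialSum W f n) (fun ω => g (W n ω)) μ := by
  have h := (hind n).comp (φ := fun w : Finset.range n → 𝓧 => ∑ t, f (w t)) (ψ := g)
    (by fun_prop) hg
  have h1 : partialSum W f n = (fun w : Finset.range n → 𝓧 => ∑ t, f (w t)) ∘
      fun ω (t : Finset.range n) => W t ω := by
    ext ω
    exact (Finset.sum_coe_sort (Finset.range n) fun t => f (W t ω)).symm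
  rw [h1]
  exact h

lemma memLp_comp_of_hasLaw (hW : ∀ t, HasLaw (W t) ν μ) {p : ENNReal} (hfp : MemLp f p ν) (t : ℕ) :
    MemLp (fun ω => f (W t ω)) p μ := by
  refine MemLp.comp_of_map (f := W t) ?_ (hW t).aemeasurable
  rwa [(hW t).map_eq]

lemma memLp_partialSum (hW : ∀ t, HasLaw (W t) ν μ) {p : ENNReal} (hfp : MemLp f p ν) (n : ℕ) :
    MemLp (partialSum W f n) p μ :=
  memLp_finsetSum _ fun t _ => memLp_comp_of_hasLaw hW hfp t

lemma integral_comp_of_hasLaw (hW : ∀ t, HasLaw (W t) ν μ) (hf : Measurable f) (t : ℕ) :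
    ∫ ω, f (W t ω) ∂μ = ∫ w, f w ∂ν :=
  (hW t).integral_comp hf.aestronglyMeasurable

variable [IsProbabilityMeasure μ]

lemma MemLp.integrable_mul_of_four {a b : Ω → ℝ} (ha : MemLp a 4 μ) (hb : MemLp b 4 μ) :
    Integrable (fun ω => a ω * b ω) μ :=
  MemLp.integrable_mul (p := 2) (q := 2) (ha.mono_exponent (by norm_num))
    (hb.mono_exponent (by norm_num))

lemma MemLp.integrable_pow_of_four {a : Ω → ℝ} (ha : MemLp a 4 μ) {k : ℕ} (hk : k ≤ 4) :
    Integrable (fun ω => a ω ^ k) μ := by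
  have h := (ha.mono_exponent (p := (k : ENNReal)) (by exact_mod_cast hk)).integrable_norm_pow'
  refine (integrable_norm_iff (ha.1.pow k)).1 (h.congr (ae_of_all _ fun x => ?_))
  simp

lemma integral_partialSum (hW : ∀ t, HasLaw (W t) ν μ) (hf : Measurable f) (hf4 : MemLp f 4 ν)
    (hf0 : ∫ w, f w ∂ν = 0) (n : ℕ) : ∫ ω, partialSum W f n ω ∂μ = 0 := by
  simp only [partialSum]
  rw [integral_finsetSum _ fun t _ => (memLp_comp_of_hasLaw hW hf4 t).integrable (by norm_num)]
  exact Finset.sum_eq_zero fun t _ => by rw [integral_comp_of_hasLaw hW hf, hf0]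

lemma integral_partialSum_mul (hind : ∀ n, IndepFun (fun ω (t : Finset.range n) => W t ω) (W n) μ)
    (hW : ∀ t, HasLaw (W t) ν μ) (hf : Measurable f) (hg : Measurable g)
    (hf4 : MemLp f 4 ν) (hg4 : MemLp g 4 ν) (hf0 : ∫ w, f w ∂ν = 0) (hg0 : ∫ w, g w ∂ν = 0)
    (n : ℕ) :
    ∫ ω, partialSum W f n ω * partialSum W g n ω ∂μ = n * ∫ w, f w * g w ∂ν := by
  induction n with
  | zero => simp [partialSum]
  | succ n ih =>
    have hS := memLp_partialSum hW hf4 n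
    have hT := memLp_partialSum hW hg4 n
    have hX := memLp_comp_of_hasLaw hW hf4 n
    have hY := memLp_comp_of_hasLaw hW hg4 n
    have e1 : ∫ ω, partialSum W f n ω * g (W n ω) ∂μ = 0 := by
      rw [(indepFun_partialSum hind hf hg n).integral_fun_mul_eq_mul_integral hS.1 hY.1,
        integral_comp_of_hasLaw hW hg, hg0, mul_zero]
    have e2 : ∫ ω, partialSum W g n ω * f (W n ω) ∂μ = 0 := by
      rw [(indepFun_partialSum hind hg hf n).integral_fun_mul_eq_mul_integral hT.1 hX.1,
        integral_comp_of_hasLaw hW hf, hf0, mul_zero]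
    have e3 : ∫ ω, f (W n ω) * g (W n ω) ∂μ = ∫ w, f w * g w ∂ν :=
      integral_comp_of_hasLaw (f := fun w => f w * g w) hW (hf.mul hg) n
    have h1 : ∀ ω, partialSum W f (n + 1) ω * partialSum W g (n + 1) ω
        = partialSum W f n ω * partialSum W g n ω + partialSum W f n ω * g (W n ω)
          + partialSum W g n ω * f (W n ω) + f (W n ω) * g (W n ω) := by
      intro ω
      rw [partialSum_succ, partialSum_succ]
      ring
    have i1 := MemLp.integrable_mul_of_four hS hT
    have i2 := MemLp.integrable_mul_of_four hS hY
    have i3 := MemLp.integrable_mul_of_four hT hX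
    have i4 := MemLp.integrable_mul_of_four hX hY
    simp only [h1]
    rw [integral_add ((i1.fun_add i2).fun_add i3) i4, integral_add (i1.fun_add i2) i3, integral_add i1 i2,
      e1, e2, e3, ih]
    push_cast
    ring

/-- The fourth moment of a sum of `n` centered independent variables is of order `n²`. -/
lemma integral_partialSum_pow_four_le
    (hind : ∀ n, IndepFun (fun ω (t : Finset.range n) => W t ω) (W n) μ)
    (hW : ∀ t, HasLaw (W t) ν μ) (hf : Measurable f) (hf4 : MemLp f 4 ν)
    (hf0 : ∫ w, f w ∂ν = 0) (n : ℕ) :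
    ∫ ω, partialSum W f n ω ^ 4 ∂μ
      ≤ (3 * (∫ w, f w ^ 2 ∂ν) ^ 2 + ∫ w, f w ^ 4 ∂ν) * (n : ℝ) ^ 2 := by
  have hb : 0 ≤ ∫ w, f w ^ 4 ∂ν := integral_nonneg fun w => by positivity
  induction n with
  | zero => simp [partialSum]
  | succ n ih =>
    set S := partialSum W f n
    have hS : MemLp S 4 μ := memLp_partialSum hW hf4 n
    have hX := memLp_comp_of_hasLaw hW hf4 n
    have hind' : IndepFun S (fun ω => f (W n ω)) μ := indepFun_partialSum hind hf hf n
    have hprod : ∀ i j : ℕ, IndepFun (fun ω => S ω ^ i) (fun ω => f (W n ω) ^ j) μ := fun i j =>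
      hind'.comp (φ := fun x : ℝ => x ^ i) (ψ := fun x : ℝ => x ^ j) (by fun_prop) (by fun_prop)
    have hI : ∀ i j : ℕ, i ≤ 4 → j ≤ 4 → Integrable (fun ω => S ω ^ i * f (W n ω) ^ j) μ :=
      fun i j hi hj => (hprod i j).integrable_mul (MemLp.integrable_pow_of_four hS hi)
        (MemLp.integrable_pow_of_four hX hj)
    have hm : ∀ i j : ℕ, ∫ ω, S ω ^ i * f (W n ω) ^ j ∂μ
        = (∫ ω, S ω ^ i ∂μ) * ∫ w, f w ^ j ∂ν := by
      intro i j
      rw [(hprod i j).integral_fun_mul_eq_mul_integral (hS.1.pow i) (hX.1.pow j)]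
      congr 1
      exact integral_comp_of_hasLaw (f := fun w => f w ^ j) hW (hf.pow_const j) n
    have hS1 : ∫ ω, S ω ^ 1 ∂μ = 0 := by
      simp only [pow_one]
      exact integral_partialSum hW hf hf4 hf0 n
    have hf1 : ∫ w, f w ^ 1 ∂ν = 0 := by simpa only [pow_one] using hf0
    have hS2 : ∫ ω, S ω ^ 2 ∂μ = n * ∫ w, f w ^ 2 ∂ν := by
      simp only [pow_two]
      exact integral_partialSum_mul hind hW hf hf hf4 hf4 hf0 hf0 n
    have h1 : ∀ ω, partialSum W f (n + 1) ω ^ 4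
        = S ω ^ 4 * f (W n ω) ^ 0 + 4 * (S ω ^ 3 * f (W n ω) ^ 1) + 6 * (S ω ^ 2 * f (W n ω) ^ 2)
          + 4 * (S ω ^ 1 * f (W n ω) ^ 3) + S ω ^ 0 * f (W n ω) ^ 4 := by
      intro ω
      rw [partialSum_succ]
      ring
    have i0 := hI 4 0 le_rfl (by norm_num)
    have i1 := (hI 3 1 (by norm_num) (by norm_num)).const_mul 4
    have i2 := (hI 2 2 (by norm_num) (by norm_num)).const_mul 6
    have i3 := (hI 1 3 (by norm_num) (by norm_num)).const_mul 4
    have i4 := hI 0 4 (by norm_num) le_rfl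
    have hν : IsProbabilityMeasure ν := (hW 0).isProbabilityMeasure_iff.1 inferInstance
    simp only [h1]
    rw [integral_add (((i0.fun_add i1).fun_add i2).fun_add i3) i4,
      integral_add ((i0.fun_add i1).fun_add i2) i3, integral_add (i0.fun_add i1) i2,
      integral_add i0 i1, integral_const_mul, integral_const_mul,
      integral_const_mul, hm, hm, hm, hm, hm, hf1, hS1, hS2]
    simp only [pow_zero, integral_const, probReal_univ, smul_eq_mul]
    push_cast
    nlinarith [sq_nonneg (∫ w, f w ^ 2 ∂ν), mul_nonneg hb (Nat.cast_nonneg (α := ℝ) n)]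

end PartialSum

/-! ### The error of one snapshot as a centered form in the sources and the noise -/

lemma measurable_centeredForm {ι : Type*} [Fintype ι] [DecidableEq ι] (v : ι → ℝ)
    (c : ι → ι → ℂ) : Measurable (centeredForm v c) := by
  unfold centeredForm centeredPair
  fun_prop

namespace Model

variable {M K : ℕ} (S : Model M K)

/-- The matrix `[A I]` which maps sources and noise to the snapshot. -/
def mixing : Matrix (Fin M) (Fin K ⊕ Fin M) ℂ := Matrix.fromCols S.steerMat 1

/-- The variances of sources and noise. -/
def variances : Fin K ⊕ Fin M → ℝ := Sum.elim S.p fun _ => S.noiseVar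

lemma cov_apply (p q : Fin M) :
    S.cov p q = ∑ i, S.mixing p i * star (S.mixing q i) * (S.variances i : ℂ) := by
  rw [Fintype.sum_sum_type]
  simp only [cov, mixing, variances, Matrix.add_apply, Matrix.smul_apply, Matrix.mul_apply,
    Matrix.conjTranspose_apply, Matrix.fromCols_apply_inl,
    Matrix.fromCols_apply_inr, Sum.elim_inl, Sum.elim_inr, Matrix.one_apply]
  congr 1
  · exact Finset.sum_congr rfl fun k _ => by
      rw [← Matrix.mul_apply, Matrix.mul_diagonal]
      ring
  · simp only [ite_mul, one_mul, zero_mul, Finset.sum_ite_eq, Finset.mem_univ, if_true,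
      smul_eq_mul]
    by_cases h : p = q
    · subst h; simp
    · simp [h, Ne.symm h]

/-- The error `y yᴴ - R` of the snapshot `y` with sources and noise `w`. -/
def snapshotError (w : Fin K ⊕ Fin M → ℂ) : Matrix (Fin M) (Fin M) ℂ :=
  Matrix.vecMulVec (S.mixing *ᵥ w) (star (S.mixing *ᵥ w)) - S.cov

lemma snapshotError_isHermitian (w : Fin K ⊕ Fin M → ℂ) :
    (S.snapshotError w)ᴴ = S.snapshotError w := by
  rw [snapshotError, Matrix.conjTranspose_sub, cov_isHermitian, Matrix.conjTranspose_vecMulVec,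
    star_star]

lemma snapshotError_apply (p q : Fin M) (w : Fin K ⊕ Fin M → ℂ) :
    S.snapshotError w p q
      = centeredForm S.variances (fun i j => S.mixing p i * star (S.mixing q j)) w := by
  simp only [snapshotError, Matrix.sub_apply, Matrix.vecMulVec_apply, Matrix.mulVec, dotProduct,
    Pi.star_apply, star_sum, cov_apply, centeredForm, centeredPair, mul_sub,
    Finset.sum_sub_distrib, Finset.sum_mul_sum]
  congr 1
  · refine Finset.sum_congr rfl fun i _ => Finset.sum_congr rfl fun j _ => ?_
    rw [star_mul']
    ring
  · refine Finset.sum_congr rfl fun i _ => ?_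
    rw [Finset.sum_eq_single i]
    · rw [diagCov, if_pos rfl]
    · intro j _ hj
      rw [diagCov, if_neg (Ne.symm hj), mul_zero]
    · simp

/-- The coefficients of `ξ_k · vec(y yᴴ - R)` as a centered form in sources and noise. -/
def xiCoeff (Mv : ℕ) (k : Fin K) (i j : Fin K ⊕ Fin M) : ℂ :=
  ∑ qp : Fin M × Fin M, S.xi Mv k qp * (S.mixing qp.2 i * star (S.mixing qp.1 j))

lemma xi_dotProduct_snapshotError (Mv : ℕ) (k : Fin K) (w : Fin K ⊕ Fin M → ℂ) :
    S.xi Mv k ⬝ᵥ (S.snapshotError w).vec = centeredForm S.variances (S.xiCoeff Mv k) w := by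
  simp only [dotProduct, Matrix.vec, snapshotError_apply, centeredForm, xiCoeff, Finset.mul_sum,
    Finset.sum_mul]
  rw [Finset.sum_comm]
  refine Finset.sum_congr rfl fun i _ => ?_
  rw [Finset.sum_comm]
  refine Finset.sum_congr rfl fun j _ => Finset.sum_congr rfl fun qp _ => ?_
  ring

/-- The covariance of two of the forms `ξ_k · vec(y yᴴ - R)`, by independence of the coordinates, is
the error form. -/
lemma sum_star_xiCoeff_mul (Mv : ℕ) (k l : Fin K) :
    ∑ i, ∑ j, star (S.xiCoeff Mv k i j) * S.xiCoeff Mv l i j *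
      ((S.variances i : ℂ) * S.variances j) = S.errForm Mv k l := by
  have h1 : ∀ i j, star (S.xiCoeff Mv k i j) * S.xiCoeff Mv l i j *
      ((S.variances i : ℂ) * S.variances j)
      = ∑ qp : Fin M × Fin M, ∑ sr : Fin M × Fin M, star (S.xi Mv k qp) * S.xi Mv l sr *
        ((S.mixing sr.2 i * star (S.mixing qp.2 i) * (S.variances i : ℂ)) *
          (S.mixing qp.1 j * star (S.mixing sr.1 j) * (S.variances j : ℂ))) := by
    intro i j
    rw [xiCoeff, xiCoeff, star_sum, Finset.sum_mul_sum, Finset.sum_mul]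
    refine Finset.sum_congr rfl fun qp _ => ?_
    rw [Finset.sum_mul]
    refine Finset.sum_congr rfl fun sr _ => ?_
    simp only [star_mul', star_star]
    ring
  rw [errForm_eq]
  simp only [h1]
  have h2 : ∀ i, ∑ j, ∑ qp : Fin M × Fin M, ∑ sr : Fin M × Fin M,
      star (S.xi Mv k qp) * S.xi Mv l sr *
        ((S.mixing sr.2 i * star (S.mixing qp.2 i) * (S.variances i : ℂ)) *
          (S.mixing qp.1 j * star (S.mixing sr.1 j) * (S.variances j : ℂ)))
      = ∑ qp : Fin M × Fin M, ∑ sr : Fin M × Fin M, star (S.xi Mv k qp) * S.xi Mv l sr *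
        ((S.mixing sr.2 i * star (S.mixing qp.2 i) * (S.variances i : ℂ)) *
          S.cov qp.1 sr.1) := by
    intro i
    rw [Finset.sum_comm]
    refine Finset.sum_congr rfl fun qp _ => ?_
    rw [Finset.sum_comm]
    refine Finset.sum_congr rfl fun sr _ => ?_
    rw [cov_apply, Finset.mul_sum, Finset.mul_sum]
  simp only [h2]
  rw [Finset.sum_comm]
  refine Finset.sum_congr rfl fun qp _ => ?_
  rw [Finset.sum_comm]
  refine Finset.sum_congr rfl fun sr _ => ?_
  rw [cov_apply S sr.2 qp.2, Finset.mul_sum, Finset.mul_sum]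
  exact Finset.sum_congr rfl fun i _ => by ring

/-- The real random variable `ξ_k · vec(y yᴴ - R)`, in terms of sources and noise. -/
def xiForm (Mv : ℕ) (k : Fin K) (w : Fin K ⊕ Fin M → ℂ) : ℝ :=
  (S.xi Mv k ⬝ᵥ (S.snapshotError w).vec).re

lemma measurable_xiForm (Mv : ℕ) (k : Fin K) : Measurable (S.xiForm Mv k) := by
  have h := measurable_centeredForm S.variances (S.xiCoeff Mv k)
  unfold xiForm
  simp only [xi_dotProduct_snapshotError]
  fun_prop

lemma memLp_xiForm (Mv : ℕ) (k : Fin K) : MemLp (S.xiForm Mv k) 4 (circVector S.variances) := by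
  have h : MemLp (centeredForm S.variances (S.xiCoeff Mv k)) 4 (circVector S.variances) :=
    memLp_centeredForm _
  unfold xiForm
  simp only [xi_dotProduct_snapshotError]
  exact h.re

lemma integral_re_centeredForm {ι : Type*} [Fintype ι] [DecidableEq ι] {v : ι → ℝ}
    (hv : ∀ i, 0 ≤ v i) (c : ι → ι → ℂ) : ∫ w, (centeredForm v c w).re ∂(circVector v) = 0 := by
  have h := integral_re (𝕜 := ℂ) ((memLp_centeredForm (v := v) c).integrable (by norm_num))
  rw [integral_centeredForm hv] at h
  simpa using h

lemma integral_im_centeredForm {ι : Type*} [Fintype ι] [DecidableEq ι] {v : ι → ℝ}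
    (hv : ∀ i, 0 ≤ v i) (c : ι → ι → ℂ) : ∫ w, (centeredForm v c w).im ∂(circVector v) = 0 := by
  have h := integral_im (𝕜 := ℂ) ((memLp_centeredForm (v := v) c).integrable (by norm_num))
  rw [integral_centeredForm hv] at h
  simpa using h

variable {S}

lemma variances_nonneg (hp : ∀ k, 0 < S.p k) (hσ : 0 < S.noiseVar) (i : Fin K ⊕ Fin M) :
    0 ≤ S.variances i := by
  rcases i with k | m
  · exact (hp k).le
  · exact hσ.le

lemma integral_xiForm (hp : ∀ k, 0 < S.p k) (hσ : 0 < S.noiseVar) (Mv : ℕ) (k : Fin K) :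
    ∫ w, S.xiForm Mv k w ∂(circVector S.variances) = 0 := by
  unfold xiForm
  simp only [xi_dotProduct_snapshotError]
  exact integral_re_centeredForm (variances_nonneg hp hσ) _

/-- The error form is the covariance of the variables `ξ_k · vec(y yᴴ - R)`; it is real because
these are. -/
lemma errForm_eq_integral {Mv : ℕ} (hinj : Function.Injective (S.vsteerMat Mv).mulVec)
    (hp : ∀ k, 0 < S.p k) (hσ : 0 < S.noiseVar) (k l : Fin K) :
    S.errForm Mv k l
      = ((∫ w, S.xiForm Mv k w * S.xiForm Mv l w ∂(circVector S.variances) : ℝ) : ℂ) := by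
  have hreal : ∀ k w, centeredForm S.variances (S.xiCoeff Mv k) w = (S.xiForm Mv k w : ℂ) := by
    intro k w
    have h := S.star_alpha_daMatrix_beta hinj k (S.snapshotError_isHermitian w)
    rw [← xi_dotProduct_vec] at h
    rw [← xi_dotProduct_snapshotError]
    exact (Complex.conj_eq_iff_re.1 h).symm
  rw [← sum_star_xiCoeff_mul, ← integral_star_centeredForm_mul (variances_nonneg hp hσ),
    ← integral_complex_ofReal]
  refine integral_congr_ae (ae_of_all _ fun w => ?_)
  simp only [hreal]
  simp

end Model

/-! ### The moments of the error of the sample covariance matrix -/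

namespace Model

variable {M K : ℕ} {S : Model M K}
variable {Ω : Type*} [MeasurableSpace Ω] {μ : Measure Ω}
  {x : ℕ → Ω → Fin K → ℂ} {n : ℕ → Ω → Fin M → ℂ}

/-- The vector of sources and noise of the snapshot `t`. -/
def sourceNoise (x : ℕ → Ω → Fin K → ℂ) (n : ℕ → Ω → Fin M → ℂ) (t : ℕ) (ω : Ω) :
    Fin K ⊕ Fin M → ℂ := Sum.elim (x t ω) (n t ω)

namespace IsSignal

lemma hasLaw_component (h : S.IsSignal x n μ) (i : ℕ × (Fin K ⊕ Fin M)) :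
    HasLaw (fun ω => Sum.elim (x i.1 ω) (n i.1 ω) i.2) (circGaussian (S.variances i.2)) μ := by
  obtain ⟨t, k | m⟩ := i
  · exact h.law_source t k
  · exact h.law_noise t m

lemma hasLaw_sourceNoise (h : S.IsSignal x n μ) (t : ℕ) :
    HasLaw (sourceNoise x n t) (circVector S.variances) μ :=
  iIndepFun.hasLaw_pi (fun i => h.hasLaw_component (t, i))
    (h.indep.precomp (g := fun i => (t, i)) (Prod.mk_right_injective t))

/-- Each snapshot is independent of the ones before it. -/
lemma indepFun_past (h : S.IsSignal x n μ) (N : ℕ) :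
    IndepFun (fun ω (t : Finset.range N) => sourceNoise x n t ω) (sourceNoise x n N) μ := by
  have hdisj : Disjoint (Finset.range N ×ˢ (Finset.univ : Finset (Fin K ⊕ Fin M)))
      ({N} ×ˢ Finset.univ) := by
    rw [Finset.disjoint_left]
    rintro ⟨t, i⟩ h1 h2
    simp only [Finset.mem_product, Finset.mem_range, Finset.mem_univ, and_true,
      Finset.mem_singleton] at h1 h2
    omega
  have h0 := h.indep.indepFun_finset₀ _ _ hdisj fun i => (h.hasLaw_component i).aemeasurable
  exact h0.comp
    (φ := fun w (t : Finset.range N) i =>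
      w ⟨(t, i), Finset.mem_product.2 ⟨t.2, Finset.mem_univ i⟩⟩)
    (ψ := fun w i =>
      w ⟨(N, i), Finset.mem_product.2 ⟨Finset.mem_singleton_self N, Finset.mem_univ i⟩⟩)
    (by fun_prop) (by fun_prop)

end IsSignal

omit [MeasurableSpace Ω] in
lemma received_eq (t : ℕ) (ω : Ω) :
    S.received x n t ω = S.mixing *ᵥ sourceNoise x n t ω := by
  rw [mixing, sourceNoise, Matrix.fromCols_mulVec_sumElim, Matrix.one_mulVec, received]

omit [MeasurableSpace Ω] in
lemma sampleCov_isHermitian (N : ℕ) (ω : Ω) : (S.sampleCov x n N ω)ᴴ = S.sampleCov x n N ω := by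
  rw [sampleCov, Matrix.conjTranspose_smul, Matrix.conjTranspose_sum]
  simp [Matrix.conjTranspose_vecMulVec]

omit [MeasurableSpace Ω] in
lemma sampleCov_sub_cov {N : ℕ} (hN : N ≠ 0) (ω : Ω) :
    S.sampleCov x n N ω - S.cov
      = (1 / (N : ℂ)) • ∑ t ∈ Finset.range N, S.snapshotError (sourceNoise x n t ω) := by
  have hN' : (N : ℂ) ≠ 0 := Nat.cast_ne_zero.2 hN
  simp only [snapshotError, ← received_eq, Finset.sum_sub_distrib, Finset.sum_const,
    Finset.card_range, smul_sub, sampleCov]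
  rw [← Nat.cast_smul_eq_nsmul ℂ, smul_smul, one_div, inv_mul_cancel₀ hN', one_smul]

omit [MeasurableSpace Ω] in
lemma re_xi_dotProduct_sub {N : ℕ} (hN : N ≠ 0) (Mv : ℕ) (k : Fin K) (ω : Ω) :
    (S.xi Mv k ⬝ᵥ (S.sampleCov x n N ω - S.cov).vec).re
      = partialSum (sourceNoise x n) (S.xiForm Mv k) N ω / N := by
  have h : S.xi Mv k ⬝ᵥ (S.sampleCov x n N ω - S.cov).vec
      = (1 / (N : ℂ)) * ∑ t ∈ Finset.range N,
        S.xi Mv k ⬝ᵥ (S.snapshotError (sourceNoise x n t ω)).vec := by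
    rw [sampleCov_sub_cov hN]
    simp only [dotProduct, Matrix.vec, Matrix.smul_apply, Matrix.sum_apply, smul_eq_mul,
      Finset.mul_sum]
    rw [Finset.sum_comm]
    exact Finset.sum_congr rfl fun t _ => Finset.sum_congr rfl fun i _ => by ring
  have h2 : (1 / (N : ℂ)) = ((1 / (N : ℝ) : ℝ) : ℂ) := by push_cast; rfl
  rw [h, h2, Complex.re_ofReal_mul, Complex.re_sum, partialSum]
  simp only [xiForm]
  ring

/-- The real and imaginary parts of the entries of the error of a snapshot. -/
def errorPart (S : Model M K) (j : (Fin M × Fin M) × Bool) (w : Fin K ⊕ Fin M → ℂ) : ℝ :=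
  cond j.2 (S.snapshotError w j.1.1 j.1.2).re (S.snapshotError w j.1.1 j.1.2).im

lemma measurable_errorPart (j : (Fin M × Fin M) × Bool) : Measurable (S.errorPart j) := by
  obtain ⟨pq, b⟩ := j
  unfold errorPart
  simp only [snapshotError_apply]
  have h := measurable_centeredForm S.variances
    (fun i j => S.mixing pq.1 i * star (S.mixing pq.2 j))
  cases b
  · exact Complex.measurable_im.comp h
  · exact Complex.measurable_re.comp h

lemma memLp_errorPart (j : (Fin M × Fin M) × Bool) :
    MemLp (S.errorPart j) 4 (circVector S.variances) := by
  obtain ⟨pq, b⟩ := j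
  unfold errorPart
  simp only [snapshotError_apply]
  have h := memLp_centeredForm (v := S.variances)
    (fun i j => S.mixing pq.1 i * star (S.mixing pq.2 j))
  cases b
  · exact h.im
  · exact h.re

lemma integral_errorPart (hp : ∀ k, 0 < S.p k) (hσ : 0 < S.noiseVar)
    (j : (Fin M × Fin M) × Bool) : ∫ w, S.errorPart j w ∂(circVector S.variances) = 0 := by
  obtain ⟨pq, b⟩ := j
  unfold errorPart
  simp only [snapshotError_apply]
  cases b
  · exact integral_im_centeredForm (variances_nonneg hp hσ) _
  · exact integral_re_centeredForm (variances_nonneg hp hσ) _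

section
open scoped Matrix.Norms.Frobenius

omit [MeasurableSpace Ω] in
lemma norm_sampleCov_sub_sq {N : ℕ} (hN : N ≠ 0) (ω : Ω) :
    ‖S.sampleCov x n N ω - S.cov‖ ^ 2
      = (∑ j, partialSum (sourceNoise x n) (S.errorPart j) N ω ^ 2) / (N : ℝ) ^ 2 := by
  rw [frobenius_sq_eq_sum, Fintype.sum_prod_type, Fintype.sum_prod_type, Finset.sum_div]
  refine Finset.sum_congr rfl fun p _ => ?_
  rw [Finset.sum_div]
  refine Finset.sum_congr rfl fun q _ => ?_
  have h2 : (1 / (N : ℂ)) = ((1 / (N : ℝ) : ℝ) : ℂ) := by push_cast; rfl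
  rw [Fintype.sum_bool, sampleCov_sub_cov hN, Matrix.smul_apply, Matrix.sum_apply, smul_eq_mul,
    norm_mul, mul_pow, ← Complex.normSq_eq_norm_sq (∑ t ∈ Finset.range N, _),
    Complex.normSq_apply, Complex.re_sum, Complex.im_sum, h2, Complex.norm_real, Real.norm_eq_abs,
    sq_abs]
  simp only [partialSum, errorPart, cond_true, cond_false]
  ring

variable [IsProbabilityMeasure μ]

/-- The error of the sample covariance matrix has second and fourth moments of orders `1 / N` and
`1 / N²`. -/
lemma exists_moment_bound (hp : ∀ k, 0 < S.p k) (hσ : 0 < S.noiseVar) (h : S.IsSignal x n μ) :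
    ∃ C : ℝ, 0 ≤ C ∧ ∀ N : ℕ, N ≠ 0 →
      Integrable (fun ω => ‖S.sampleCov x n N ω - S.cov‖ ^ 2) μ ∧
      Integrable (fun ω => ‖S.sampleCov x n N ω - S.cov‖ ^ 4) μ ∧
      ∫ ω, ‖S.sampleCov x n N ω - S.cov‖ ^ 2 ∂μ ≤ C / N ∧
      ∫ ω, ‖S.sampleCov x n N ω - S.cov‖ ^ 4 ∂μ ≤ C / (N : ℝ) ^ 2 := by
  have hW := h.hasLaw_sourceNoise
  have hind := h.indepFun_past
  set ν := circVector S.variances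
  set J := (Fin M × Fin M) × Bool
  set T : J → ℕ → Ω → ℝ := fun j => partialSum (sourceNoise x n) (S.errorPart j) with hT
  have hT4 : ∀ j N, MemLp (T j N) 4 μ := fun j N => memLp_partialSum hW (memLp_errorPart j) N
  set C₂ : ℝ := ∑ j : J, ∫ w, S.errorPart j w * S.errorPart j w ∂ν with hC₂
  set C₄ : ℝ := ∑ j : J, (3 * (∫ w, S.errorPart j w ^ 2 ∂ν) ^ 2 + ∫ w, S.errorPart j w ^ 4 ∂ν)
    with hC₄
  have hC₂0 : 0 ≤ C₂ := Finset.sum_nonneg fun j _ => integral_nonneg fun w => mul_self_nonneg _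
  have hC₄0 : 0 ≤ C₄ := Finset.sum_nonneg fun j _ => add_nonneg (by positivity)
    (integral_nonneg fun w => by positivity)
  have i2 : ∀ N, Integrable (fun ω => ∑ j, T j N ω ^ 2) μ := fun N =>
    integrable_finsetSum _ fun j _ => MemLp.integrable_pow_of_four (hT4 j N) (by norm_num)
  have i4 : ∀ N, Integrable (fun ω => ∑ j, T j N ω ^ 4) μ := fun N =>
    integrable_finsetSum _ fun j _ => MemLp.integrable_pow_of_four (hT4 j N) le_rfl
  have b2 : ∀ N : ℕ, ∫ ω, ∑ j, T j N ω ^ 2 ∂μ = C₂ * N := by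
    intro N
    rw [integral_finsetSum _ fun j _ => MemLp.integrable_pow_of_four (hT4 j N) (by norm_num),
      hC₂, Finset.sum_mul]
    refine Finset.sum_congr rfl fun j _ => ?_
    simp only [pow_two, hT]
    rw [integral_partialSum_mul hind hW (measurable_errorPart j) (measurable_errorPart j)
      (memLp_errorPart j) (memLp_errorPart j) (integral_errorPart hp hσ j)
      (integral_errorPart hp hσ j), mul_comm]
  have b4 : ∀ N : ℕ, ∫ ω, ∑ j, T j N ω ^ 4 ∂μ ≤ C₄ * (N : ℝ) ^ 2 := by
    intro N
    rw [integral_finsetSum _ fun j _ => MemLp.integrable_pow_of_four (hT4 j N) le_rfl,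
      hC₄, Finset.sum_mul]
    exact Finset.sum_le_sum fun j _ => integral_partialSum_pow_four_le hind hW
      (measurable_errorPart j) (memLp_errorPart j) (integral_errorPart hp hσ j) N
  set m : ℝ := (Fintype.card J : ℝ)
  have hm : 0 ≤ m := Nat.cast_nonneg _
  refine ⟨C₂ + m * C₄, by positivity, fun N hN => ?_⟩
  have hN0 : (0 : ℝ) < N := Nat.cast_pos.2 (Nat.pos_of_ne_zero hN)
  have e2 : ∀ ω, ‖S.sampleCov x n N ω - S.cov‖ ^ 2 = (∑ j, T j N ω ^ 2) / (N : ℝ) ^ 2 :=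
    norm_sampleCov_sub_sq hN
  have e4 : ∀ ω, ‖S.sampleCov x n N ω - S.cov‖ ^ 4 = (∑ j, T j N ω ^ 2) ^ 2 / (N : ℝ) ^ 4 := by
    intro ω
    rw [show 4 = 2 * 2 from rfl, pow_mul, e2, div_pow, ← pow_mul]
  have l4 : ∀ ω, ‖S.sampleCov x n N ω - S.cov‖ ^ 4 ≤ m / (N : ℝ) ^ 4 * ∑ j, T j N ω ^ 4 := by
    intro ω
    have hcs := sq_sum_le_card_mul_sum_sq (s := (Finset.univ : Finset J))
      (f := fun j => T j N ω ^ 2)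
    simp only [← pow_mul, Finset.card_univ] at hcs
    rw [e4, div_mul_eq_mul_div]
    exact div_le_div_of_nonneg_right hcs (by positivity)
  have j2 : Integrable (fun ω => ‖S.sampleCov x n N ω - S.cov‖ ^ 2) μ := by
    simp only [e2]
    exact (i2 N).div_const _
  have j4 : Integrable (fun ω => ‖S.sampleCov x n N ω - S.cov‖ ^ 4) μ := by
    refine Integrable.mono' ((i4 N).const_mul (m / (N : ℝ) ^ 4)) ?_ (ae_of_all _ fun ω => ?_)
    · simp only [e4]
      exact (((i2 N).1.aemeasurable.pow_const 2).div_const _).aestronglyMeasurable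
    · rw [Real.norm_of_nonneg (by positivity)]
      exact l4 ω
  refine ⟨j2, j4, ?_, ?_⟩
  · simp only [e2]
    rw [integral_div, b2]
    calc C₂ * N / (N : ℝ) ^ 2 = C₂ / N := by field_simp
      _ ≤ (C₂ + m * C₄) / N := by
        gcongr
        exact le_add_of_nonneg_right (by positivity)
  · calc ∫ ω, ‖S.sampleCov x n N ω - S.cov‖ ^ 4 ∂μ
        ≤ ∫ ω, m / (N : ℝ) ^ 4 * ∑ j, T j N ω ^ 4 ∂μ :=
          integral_mono j4 ((i4 N).const_mul _) l4
      _ = m / (N : ℝ) ^ 4 * ∫ ω, ∑ j, T j N ω ^ 4 ∂μ := integral_const_mul _ _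
      _ ≤ m / (N : ℝ) ^ 4 * (C₄ * (N : ℝ) ^ 2) := by gcongr; exact b4 N
      _ = m * C₄ / (N : ℝ) ^ 2 := by field_simp
      _ ≤ (C₂ + m * C₄) / (N : ℝ) ^ 2 := by
        gcongr
        exact le_add_of_nonneg_left hC₂0

end

end Model

/-! ### Second moments of variables with a linear expansion -/

section Expansion

variable {Ω : Type*} [MeasurableSpace Ω] {μ : Measure Ω} [IsProbabilityMeasure μ]

/-- The pointwise bound behind the expansion of second moments: where the size `d` of the
perturbation is at most `δ` the linearisation errors `η d` are used, elsewhere `1 ≤ d⁴ / δ⁴`. -/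
lemma abs_mul_sub_mul_le {e f l g d B E η δ : ℝ} (hB : 0 ≤ B) (hη : 0 ≤ η)
    (hδ : 0 < δ) (hd : 0 ≤ d) (he : |e| ≤ E) (hf : |f| ≤ E) (hl : |l| ≤ B * d) (hg : |g| ≤ B * d)
    (hexp : d ≤ δ → |e - l| ≤ η * d ∧ |f - g| ≤ η * d) :
    |e * f - l * g| ≤ (η ^ 2 + 2 * B * η) * d ^ 2 + (E ^ 2 / δ ^ 4 + B ^ 2 / δ ^ 2) * d ^ 4 := by
  have hE : 0 ≤ E := (abs_nonneg e).trans he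
  by_cases h : d ≤ δ
  · obtain ⟨h1, h2⟩ := hexp h
    have key : |e * f - l * g| ≤ (η ^ 2 + 2 * B * η) * d ^ 2 := by
      calc |e * f - l * g| = |(e - l) * (f - g) + l * (f - g) + (e - l) * g| := by ring_nf
        _ ≤ |e - l| * |f - g| + |l| * |f - g| + |e - l| * |g| := by
          rw [← abs_mul, ← abs_mul, ← abs_mul]
          exact (abs_add_le _ _).trans (add_le_add_left (abs_add_le _ _) _)
        _ ≤ (η * d) * (η * d) + (B * d) * (η * d) + (η * d) * (B * d) := by gcongr
        _ = (η ^ 2 + 2 * B * η) * d ^ 2 := by ring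
    have : 0 ≤ (E ^ 2 / δ ^ 4 + B ^ 2 / δ ^ 2) * d ^ 4 := by positivity
    linarith
  · push Not at h
    have h1 : 1 ≤ d ^ 2 / δ ^ 2 := by
      rw [one_le_div (by positivity)]
      gcongr
    have h2 : |e * f| ≤ E ^ 2 * (d ^ 2 / δ ^ 2) ^ 2 := by
      rw [abs_mul]
      calc |e| * |f| ≤ E * E := by gcongr
        _ = E ^ 2 * 1 ^ 2 := by ring
        _ ≤ E ^ 2 * (d ^ 2 / δ ^ 2) ^ 2 := by gcongr
    have h3 : |l * g| ≤ B ^ 2 * d ^ 2 * (d ^ 2 / δ ^ 2) := by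
      rw [abs_mul]
      calc |l| * |g| ≤ (B * d) * (B * d) := by gcongr
        _ = B ^ 2 * d ^ 2 * 1 := by ring
        _ ≤ B ^ 2 * d ^ 2 * (d ^ 2 / δ ^ 2) := by gcongr
    have h4 : E ^ 2 * (d ^ 2 / δ ^ 2) ^ 2 + B ^ 2 * d ^ 2 * (d ^ 2 / δ ^ 2)
        = (E ^ 2 / δ ^ 4 + B ^ 2 / δ ^ 2) * d ^ 4 := by
      field_simp
    have h5 : 0 ≤ (η ^ 2 + 2 * B * η) * d ^ 2 := by positivity
    have h6 := abs_sub (e * f) (l * g)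
    linarith

omit [IsProbabilityMeasure μ] in
/-- If `e N` and `f N` are bounded and agree with `l N` and `g N` up to a small multiple of `d N`
where `d N` is small, and `d N` has second and fourth moments of orders `1 / N` and `1 / N²`, then
the mixed second moments of the two pairs differ by `o(1 / N)`. -/
lemma integral_mul_sub_isLittleO {e f l g d : ℕ → Ω → ℝ} {B C E : ℝ} (hB : 0 ≤ B) (hC : 0 ≤ C)
    (hd : ∀ N ω, 0 ≤ d N ω)
    (he : ∀ N, ∀ᵐ ω ∂μ, |e N ω| ≤ E) (hf : ∀ N, ∀ᵐ ω ∂μ, |f N ω| ≤ E)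
    (hl : ∀ N, N ≠ 0 → ∀ ω, |l N ω| ≤ B * d N ω) (hg : ∀ N, N ≠ 0 → ∀ ω, |g N ω| ≤ B * d N ω)
    (hef : ∀ N, Integrable (fun ω => e N ω * f N ω) μ)
    (hlg : ∀ N, N ≠ 0 → Integrable (fun ω => l N ω * g N ω) μ)
    (hmom : ∀ N : ℕ, N ≠ 0 → Integrable (fun ω => d N ω ^ 2) μ ∧
      Integrable (fun ω => d N ω ^ 4) μ ∧ ∫ ω, d N ω ^ 2 ∂μ ≤ C / N ∧
      ∫ ω, d N ω ^ 4 ∂μ ≤ C / (N : ℝ) ^ 2)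
    (hexp : ∀ η > 0, ∃ δ > 0, ∀ N, N ≠ 0 → ∀ᵐ ω ∂μ, d N ω ≤ δ →
      |e N ω - l N ω| ≤ η * d N ω ∧ |f N ω - g N ω| ≤ η * d N ω) :
    (fun N : ℕ => ∫ ω, e N ω * f N ω ∂μ - ∫ ω, l N ω * g N ω ∂μ)
      =o[atTop] (fun N : ℕ => 1 / (N : ℝ)) := by
  refine isLittleO_iff.2 fun c hc => ?_
  -- `η ≤ 1` makes the contribution of the linearisation error at most `c / (2 N)`
  set η : ℝ := min 1 (c / (2 * ((1 + 2 * B) * C + 1))) with hη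
  have hη0 : 0 < η := lt_min one_pos (by positivity)
  have hη1 : η ≤ 1 := min_le_left _ _
  have hη2 : (η ^ 2 + 2 * B * η) * C ≤ c / 2 := by
    have h1 : η * (2 * ((1 + 2 * B) * C + 1)) ≤ c := by
      rw [← le_div_iff₀ (by positivity)]
      exact min_le_right _ _
    have h2 : η ^ 2 ≤ η := by nlinarith
    have h3 : (η ^ 2 + 2 * B * η) * C ≤ (η + 2 * B * η) * C := by gcongr
    nlinarith
  obtain ⟨δ, hδ, hexp⟩ := hexp η hη0
  set A : ℝ := E ^ 2 / δ ^ 4 + B ^ 2 / δ ^ 2 with hA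
  have hA0 : 0 ≤ A := by positivity
  obtain ⟨N₀, hN₀⟩ := exists_nat_ge (2 * (A * C) / c)
  filter_upwards [eventually_ge_atTop N₀, eventually_ne_atTop 0] with N hN hN0
  have hNpos : (0 : ℝ) < N := Nat.cast_pos.2 (Nat.pos_of_ne_zero hN0)
  obtain ⟨i2, i4, m2, m4⟩ := hmom N hN0
  have hint : Integrable (fun ω => (η ^ 2 + 2 * B * η) * d N ω ^ 2 + A * d N ω ^ 4) μ :=
    (i2.const_mul _).add (i4.const_mul _)
  have hAC : A * C / N ≤ c / 2 := by
    have h1 : 2 * (A * C) / c ≤ N := hN₀.trans (Nat.cast_le.2 hN)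
    rw [div_le_iff₀ hc] at h1
    rw [div_le_iff₀ hNpos]
    linarith
  rw [← integral_sub (hef N) (hlg N hN0)]
  calc ‖∫ ω, (e N ω * f N ω - l N ω * g N ω) ∂μ‖
      ≤ ∫ ω, ((η ^ 2 + 2 * B * η) * d N ω ^ 2 + A * d N ω ^ 4) ∂μ := by
        refine norm_integral_le_of_norm_le hint ?_
        filter_upwards [he N, hf N, hexp N hN0] with ω h1 h2 h3
        exact abs_mul_sub_mul_le hB hη0.le hδ (hd N ω) h1 h2 (hl N hN0 ω) (hg N hN0 ω) h3
    _ = (η ^ 2 + 2 * B * η) * ∫ ω, d N ω ^ 2 ∂μ + A * ∫ ω, d N ω ^ 4 ∂μ := by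
        rw [integral_add (i2.const_mul _) (i4.const_mul _), integral_const_mul,
          integral_const_mul]
    _ ≤ (η ^ 2 + 2 * B * η) * (C / N) + A * (C / (N : ℝ) ^ 2) := by gcongr
    _ = ((η ^ 2 + 2 * B * η) * C + A * C / N) * (1 / N) := by field_simp
    _ ≤ (c / 2 + c / 2) * (1 / N) := by gcongr
    _ = c * ‖1 / (N : ℝ)‖ := by
        rw [Real.norm_of_nonneg (by positivity), add_halves]

end Expansion

namespace Model

variable {M K Mv : ℕ} {S : Model M K}
variable {Ω : Type*} [MeasurableSpace Ω] {μ : Measure Ω} [IsProbabilityMeasure μ]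
  {x : ℕ → Ω → Fin K → ℂ} {n : ℕ → Ω → Fin M → ℂ} {est : ℕ → Ω → Fin K → ℝ}

omit [IsProbabilityMeasure μ] in
/-- Both DA-MUSIC and SS-MUSIC are almost surely outputs of MUSIC on one of the two augmented
covariance matrices. -/
lemma ae_isMusicEstimate (hest : S.IsDAMusic Mv x n μ est ∨ S.IsSSMusic Mv x n μ est) (N : ℕ) :
    AEMeasurable (est N) μ ∧ ∀ᵐ ω ∂μ,
      IsMusicEstimate (S.vsteer Mv) S.θ (daMatrix S.pos Mv (S.sampleCov x n N ω)) (est N ω) ∨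
      IsMusicEstimate (S.vsteer Mv) S.θ (ssMatrix S.pos Mv (S.sampleCov x n N ω)) (est N ω) := by
  rcases hest with h | h
  · exact ⟨(h N).1, (h N).2.mono fun ω hω => Or.inl hω⟩
  · exact ⟨(h N).1, (h N).2.mono fun ω hω => Or.inr hω⟩

omit [IsProbabilityMeasure μ] in
lemma ae_abs_est_sub_le (hθ : ∀ k, S.θ k ∈ Set.Ioo (-(Real.pi / 2)) (Real.pi / 2))
    (hest : S.IsDAMusic Mv x n μ est ∨ S.IsSSMusic Mv x n μ est) (N : ℕ) (k : Fin K) :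
    ∀ᵐ ω ∂μ, |est N ω k - S.θ k| ≤ Real.pi := by
  filter_upwards [(ae_isMusicEstimate hest N).2] with ω hω
  have h : est N ω k ∈ Set.Icc (-(Real.pi / 2)) (Real.pi / 2) := by
    rcases hω with h | h <;> exact h.1 k
  rw [abs_le]
  constructor <;> linarith [h.1, h.2, (hθ k).1, (hθ k).2]

lemma integrable_est_mul (hθ : ∀ k, S.θ k ∈ Set.Ioo (-(Real.pi / 2)) (Real.pi / 2))
    (hest : S.IsDAMusic Mv x n μ est ∨ S.IsSSMusic Mv x n μ est) (N : ℕ) (k l : Fin K) :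
    Integrable (fun ω => (est N ω k - S.θ k) * (est N ω l - S.θ l)) μ := by
  have hm : ∀ k, AEMeasurable (fun ω => est N ω k - S.θ k) μ := fun k =>
    ((measurable_pi_apply k).comp_aemeasurable (ae_isMusicEstimate hest N).1).sub_const _
  refine Integrable.of_bound ((hm k).mul (hm l)).aestronglyMeasurable (Real.pi * Real.pi) ?_
  filter_upwards [ae_abs_est_sub_le hθ hest N k, ae_abs_est_sub_le hθ hest N l] with ω h1 h2
  rw [norm_mul, Real.norm_eq_abs, Real.norm_eq_abs]
  gcongr

open scoped Matrix.Norms.Frobenius in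
/-- The mixed second moments of the errors of the estimates. -/
lemma errorMoment_isLittleO (hd₀ : 0 < S.d₀) (hlam : 0 < S.lam) (hhalf : S.d₀ ≤ S.lam / 2)
    (hpos : Function.Injective S.pos)
    (hMv : ∀ l : ℤ, |l| < (Mv : ℤ) → ∃ m n : Fin M, S.pos m - S.pos n = l)
    (hK : K < Mv) (hθ : ∀ k, S.θ k ∈ Set.Ioo (-(Real.pi / 2)) (Real.pi / 2))
    (hθinj : Function.Injective S.θ) (hp : ∀ k, 0 < S.p k) (hσ : 0 < S.noiseVar)
    (hxn : S.IsSignal x n μ)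
    (hest : S.IsDAMusic Mv x n μ est ∨ S.IsSSMusic Mv x n μ est) (k l : Fin K) :
    (fun N : ℕ => (∫ ω, (est N ω k - S.θ k) * (est N ω l - S.θ l) ∂μ)
          - (S.errForm Mv k l).re / (N * S.p k * S.p l * S.gamma Mv k * S.gamma Mv l))
        =o[atTop] (fun N : ℕ => 1 / (N : ℝ)) := by
  have hinj := S.vsteerMat_injective hd₀ hlam hhalf hK hθ hθinj
  have hγ := S.gamma_pos hd₀ hlam hhalf hK hθ hθinj
  have hW := hxn.hasLaw_sourceNoise
  obtain ⟨C, hC, hmom⟩ := exists_moment_bound hp hσ hxn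
  choose κ hκ hxi using S.exists_xi_bound Mv
  set lin : Fin K → ℕ → Ω → ℝ := fun k N ω =>
    -((S.xi Mv k ⬝ᵥ (S.sampleCov x n N ω - S.cov).vec).re / S.p k / S.gamma Mv k) with hlin
  set B : ℝ := max (κ k / S.p k / S.gamma Mv k) (κ l / S.p l / S.gamma Mv l)
  have hlinB : ∀ j N ω, |lin j N ω|
      ≤ κ j / S.p j / S.gamma Mv j * ‖S.sampleCov x n N ω - S.cov‖ := by
    intro j N ω
    simp only [hlin]
    rw [abs_neg, abs_div, abs_div, abs_of_pos (hp j), abs_of_pos (hγ j), div_mul_eq_mul_div,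
      div_mul_eq_mul_div]
    have h1 := hp j
    have h2 := hγ j
    gcongr
    exact hxi j _
  -- the linear term as a normalised sum of independent variables
  have hlinT : ∀ j N ω, N ≠ 0 → lin j N ω
      = -(1 / (N * S.p j * S.gamma Mv j)) * partialSum (sourceNoise x n) (S.xiForm Mv j) N ω := by
    intro j N ω hN
    simp only [hlin]
    rw [re_xi_dotProduct_sub hN, div_div, div_div, ← mul_assoc]
    ring
  have hlinI : ∀ N ω, N ≠ 0 → lin k N ω * lin l N ω
      = 1 / ((N : ℝ) ^ 2 * S.p k * S.p l * S.gamma Mv k * S.gamma Mv l) *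
        (partialSum (sourceNoise x n) (S.xiForm Mv k) N ω *
          partialSum (sourceNoise x n) (S.xiForm Mv l) N ω) := by
    intro N ω hN
    rw [hlinT k N ω hN, hlinT l N ω hN, mul_mul_mul_comm, neg_mul_neg, one_div_mul_one_div]
    congr 2
    ring
  have hmoment : ∀ N : ℕ, N ≠ 0 → ∫ ω, lin k N ω * lin l N ω ∂μ
      = (S.errForm Mv k l).re / (N * S.p k * S.p l * S.gamma Mv k * S.gamma Mv l) := by
    intro N hN
    have hN' : (N : ℝ) ≠ 0 := Nat.cast_ne_zero.2 hN
    simp only [hlinI N _ hN]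
    rw [integral_const_mul, integral_partialSum_mul hxn.indepFun_past hW (S.measurable_xiForm Mv k)
      (S.measurable_xiForm Mv l) (S.memLp_xiForm Mv k) (S.memLp_xiForm Mv l)
      (integral_xiForm hp hσ Mv k) (integral_xiForm hp hσ Mv l),
      errForm_eq_integral hinj hp hσ, Complex.ofReal_re]
    have h1 := (hp k).ne'
    have h2 := (hp l).ne'
    have h3 := (hγ k).ne'
    have h4 := (hγ l).ne'
    field_simp
  have key := integral_mul_sub_isLittleO (μ := μ) (B := B) (C := C) (E := Real.pi)
    (e := fun N ω => est N ω k - S.θ k) (f := fun N ω => est N ω l - S.θ l)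
    (l := lin k) (g := lin l) (d := fun N ω => ‖S.sampleCov x n N ω - S.cov‖)
    (le_max_of_le_left (div_nonneg (div_nonneg (hκ k) (hp k).le) (hγ k).le)) hC
    (fun N ω => norm_nonneg _)
    (fun N => ae_abs_est_sub_le hθ hest N k) (fun N => ae_abs_est_sub_le hθ hest N l)
    (fun N _ ω => (hlinB k N ω).trans
      (mul_le_mul_of_nonneg_right (le_max_left _ _) (norm_nonneg _)))
    (fun N _ ω => (hlinB l N ω).trans
      (mul_le_mul_of_nonneg_right (le_max_right _ _) (norm_nonneg _)))
    (fun N => integrable_est_mul hθ hest N k l)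
    (fun N hN => by
      simp only [hlinI N _ hN]
      exact (MemLp.integrable_mul_of_four (memLp_partialSum hW (S.memLp_xiForm Mv k) N)
        (memLp_partialSum hW (S.memLp_xiForm Mv l) N)).const_mul _)
    hmom
    (fun η hη => by
      obtain ⟨δ, hδ, hexp⟩ :=
        S.exists_estimate_expansion hd₀ hlam hhalf hpos hMv hK hθ hθinj hp hσ hη
      refine ⟨δ, hδ, fun N _ => ?_⟩
      filter_upwards [(ae_isMusicEstimate hest N).2] with ω hω hd
      have h := hexp _ (sampleCov_isHermitian N ω) hd _ hω
      simp only [hlin, sub_neg_eq_add]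
      exact ⟨h k, h l⟩)
  refine key.congr' ?_ EventuallyEq.rfl
  filter_upwards [eventually_ne_atTop 0] with N hN
  rw [hmoment N hN]

end Model

end CoarrayMusic

end

theorem theorem2 {M K Mv : ℕ} (S : Model M K)
    (hd₀ : 0 < S.d₀) (hlam : 0 < S.lam) (hhalf : S.d₀ ≤ S.lam / 2)
    (hpos : Function.Injective S.pos)
    (hMv : ∀ l : ℤ, |l| < (Mv : ℤ) → ∃ m n : Fin M, S.pos m - S.pos n = l)
    (hK : K < Mv)
    (hθ : ∀ k, S.θ k ∈ Set.Ioo (-(Real.pi / 2)) (Real.pi / 2))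
    (hθinj : Function.Injective S.θ)
    (hp : ∀ k, 0 < S.p k) (hσ : 0 < S.noiseVar)
    {Ω : Type*} [MeasurableSpace Ω] (μ : Measure Ω) [IsProbabilityMeasure μ]
    (x : ℕ → Ω → Fin K → ℂ) (n : ℕ → Ω → Fin M → ℂ) (hxn : S.IsSignal x n μ)
    (est : ℕ → Ω → Fin K → ℝ)
    (hest : S.IsDAMusic Mv x n μ est ∨ S.IsSSMusic Mv x n μ est) :
    (∀ k, 0 < S.gamma Mv k) ∧
    (∀ k₁ k₂ N, Integrable (fun ω => (est N ω k₁ - S.θ k₁) * (est N ω k₂ - S.θ k₂)) μ) ∧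
    (∀ k₁ k₂,
      (fun N : ℕ => (∫ ω, (est N ω k₁ - S.θ k₁) * (est N ω k₂ - S.θ k₂) ∂μ)
          - (S.errForm Mv k₁ k₂).re
            / (N * S.p k₁ * S.p k₂ * S.gamma Mv k₁ * S.gamma Mv k₂))
        =o[atTop] (fun N : ℕ => 1 / (N : ℝ))) ∧
    (∀ k,
      (S.errForm Mv k k).im = 0 ∧
      (fun N : ℕ => ((∫ ω, (est N ω k - S.θ k) ^ 2 ∂μ : ℝ) : ℂ)
          - S.errForm Mv k k / (N * (S.p k : ℂ) ^ 2 * (S.gamma Mv k : ℂ) ^ 2))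
        =o[atTop] (fun N : ℕ => 1 / (N : ℝ))) := by
  have hinj := S.vsteerMat_injective hd₀ hlam hhalf hK hθ hθinj
  have hmain := Model.errorMoment_isLittleO hd₀ hlam hhalf hpos hMv hK hθ hθinj hp hσ hxn hest
  have hreal : ∀ k, S.errForm Mv k k = ((S.errForm Mv k k).re : ℂ) := by
    intro k
    rw [Model.errForm_eq_integral hinj hp hσ, Complex.ofReal_re]
  refine ⟨S.gamma_pos hd₀ hlam hhalf hK hθ hθinj,
    fun k₁ k₂ N => Model.integrable_est_mul hθ hest N k₁ k₂, hmain, fun k => ⟨?_, ?_⟩⟩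
  · rw [hreal k, Complex.ofReal_im]
  · refine ((hmain k k).norm_left.congr_left fun N => ?_).of_norm_left
    rw [hreal k, Complex.ofReal_re]
    simp only [← pow_two]
    rw [← Complex.norm_real]
    congr 1
    push_cast
    ring
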